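/- **Setting.** Let $b_1,b_2,c_1,c_2,\lambda,q>0$ with $b_1+b_2=1$. Let $N$ be a Poisson process of intensity $\lambda$, and let $U_1,U_2,\dots\ge 0$ be i.i.d. claim sizes, independent of $N$, with an absolutely continuous law $G$. For initial surplus $\bar x=(x_1,x_2)\in[0,\infty)^2$ put $X_i(t)=x_i+c_it-b_i\sum_{k\le N_t}U_k$, $i=1,2$. An admissible dividend strategy is a pair $\bar L=(L_1,L_2)$ of nondecreasing, left-continuous processes with $L_i(0)=0$, predictable for the filtration generated by $(X_1,X_2)$ (under the usual conditions), with $L_i(t)\le X_i(t)$ before the ruin time $\hat\tau=\inf\{t: X_1(t)<L_1(t)\text{ or }X_2(t)<L_2(t)\}$. Its value is $V_{\bar L}(\bar x)=E\big(\int_{[0,\hat\tau)}e^{-qs}\,dL_1(s)+\int_{[0,\hat\tau)}e^{-qs}\,dL_2(s)\big)$ (a lump sum at time $0$ counts), and the optimal value function is $V(\bar x)=\sup_{\bar L}V_{\bar L}(\bar x)$. Let $\mathcal M=\{(x_1,x_2)\in[0,\infty)^2: x_2=(b_2/b_1)x_1\}$, and let $\tilde V(\bar x)$ be the supremum of $V_{\bar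 L}(\bar x)$ over those admissible strategies which immediately bring the surplus to $\mathcal M$ (the first branch immediately paying at least $x_1-(b_1/b_2)x_2$ if this is positive, the second branch immediately paying at least $x_2-(b_2/b_1)x_1$ if this is positive) and for which the controlled surplus $\bar X-\bar L$ stays in $\mathcal M$ at all times $0<t<\hat\tau$. **One-dimensional problem.** For $y\ge 0$ let $\overline W(y)$ be the supremum of $$E\Big(\int_0^{\tau}e^{-qs}\big(c_1-\tfrac{b_1}{b_2}c_2\big)ds+\big(1+\tfrac{b_1}{b_2}\big)\int_{[0,\tau)}e^{-qs}\,dL_2(s)\Big)$$ over the admissible strategies $L_2$ for the one-dimensional surplus $X_2$ with $x_2=y$, where $\tau=\inf\{t: X_2(t)<L_2(t)\}$. Put $$\Lambda(y)=(c_1+c_2)-(\lambda+q)\overline W(y)+\lambda\int_0^{y/b_2}\overline W(y-b_2\alpha)\,dG(\alpha),$$ $\overline{\mathcal A}=\{y\ge0:\Lambda(y)=0\}$, $\overline{\mathcal B}=\{y\ge 0:\overline W'(y)=1+b_1/b_2,\ \Lambda(y)<0\}$ (one-sided derivative at $y=0$), $\overline{\mathcal C}=[0,\infty)\setminus(\overline{\mathcal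 A}\cup\overline{\mathcal B})$ and $\mathcal C_{\mathcal M}=\{((b_1/b_2)y,y): y\in\overline{\mathcal C}\}$. **HJB equation.** For $u$ on $[0,\infty)^2$ let $$\mathcal L(u)(\bar x)=c_1u_{x_1}(\bar x)+c_2u_{x_2}(\bar x)-(q+\lambda)u(\bar x)+\lambda\int_0^{(x_1/b_1)\wedge(x_2/b_2)}u(x_1-b_1\alpha,x_2-b_2\alpha)\,dG(\alpha)$$ and consider $$\max\{\mathcal L(u),\,1-u_{x_1},\,1-u_{x_2}\}=0.\qquad(\ast)$$ A function $u$, locally Lipschitz on $(0,\infty)^2$, is a viscosity supersolution (resp. subsolution) of $(\ast)$ at $\bar x\in(0,\infty)^2$ if $\max\{\mathcal L(\varphi)(\bar x),1-\varphi_{x_1}(\bar x),1-\varphi_{x_2}(\bar x)\}\le0$ (resp. $\ge0$) for every $\varphi\in C^1([0,\infty)^2)$ with $\varphi(\bar x)=u(\bar x)$ such that $u-\varphi$ attains its minimum (resp. maximum) over $[0,\infty)^2$ at $\bar x$. A viscosity solution at $\bar x$ is both. **Proposition 4.10.** If $c_2/c_1<b_2/b_1$ and $\mathcal C_{\mathcal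 M}\ne\emptyset$, then $\tilde V$ is locally Lipschitz on $(0,\infty)^2$, but there is a point of $(0,\infty)^2$ at which $\tilde V$ is not a viscosity solution of $(\ast)$. Moreover, $\tilde V$ is not the optimal value function: there is a point $\bar x\in(0,\infty)^2$ with $\tilde V(\bar x)\ne V(\bar x)$. -/

import Mathlib

open MeasureTheory ProbabilityTheory
open scoped NNReal ENNReal

noncomputable section

/-! ### Dividend processes and discounted dividends -/

/-- `𝓕` augmented by all `P`-null events and then made right-continuous. -/
def usualAugmentation {Ω : Type*} {mΩ : MeasurableSpace Ω} (P : Measure Ω)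
    (𝓕 : Filtration ℝ≥0 mΩ) : Filtration ℝ≥0 mΩ :=
  (𝓕 ⊔ Filtration.const ℝ≥0
    (MeasurableSpace.generateFrom {A : Set Ω | MeasurableSet A ∧ P A = 0})
    (MeasurableSpace.generateFrom_le fun _ hA => hA.1)).rightCont

/-- A cumulative dividend process of one branch: nondecreasing, left-continuous with right limits
(the right limits exist by monotonicity), predictable, and started at `0`. Left-continuity means
that `L t` does not yet contain a lump sum paid at time `t`; in particular a lump sum paid at
time `0` is the jump from `L 0 = 0` to the right limit at `0`. -/
structure IsDividendProcess {Ω : Type*} {mΩ : MeasurableSpace Ω} (𝓕 : Filtration ℝ≥0 mΩ)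
    (L : ℝ≥0 → Ω → ℝ) : Prop where
  predictable : IsStronglyPredictable 𝓕 L
  mono : ∀ ω, Monotone fun t => L t ω
  leftCont : ∀ ω t, ContinuousWithinAt (fun s => L s ω) (Set.Iic t) t
  zero : ∀ ω, L 0 ω = 0

open Classical in
/-- The Lebesgue-Stieltjes measure `dl` of a nondecreasing path `l` on `[0, ∞)`; the mass of `{t}`
is the jump `l (t+) - l (t-)`, and at `t = 0` it is `l (0+) - l 0`. -/
def pathMeasure (l : ℝ≥0 → ℝ) : Measure ℝ :=
  if h : Monotone l then (h.comp fun _ _ hst => Real.toNNReal_mono hst).stieltjesFunction.measure else 0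

/-- The interval `[0, T)` of times, for `T ∈ [0, ∞]`. -/
def timesBefore (T : ℝ≥0∞) : Set ℝ := {s : ℝ | 0 ≤ s ∧ ENNReal.ofReal s < T}

/-- The discounted dividends `∫_{[0, T)} e^{-q s} dl(s)` of a nondecreasing path. -/
def discountedDividends (q : ℝ) (l : ℝ≥0 → ℝ) (T : ℝ≥0∞) : ℝ≥0∞ :=
  ∫⁻ s in timesBefore T, ENNReal.ofReal (Real.exp (-q * s)) ∂(pathMeasure l)

/-! ### The two-branch risk model -/

/-- Two insurance branches which split each claim in the proportions `b₁ + b₂ = 1`.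
`wait i` is the time between the `i`-th and the `(i+1)`-st claim (so that the claim arrivals form a
Poisson process of intensity `lam`) and `claim i` is the size of the claim with index `i`, with
absolutely continuous law `G` on `[0, ∞)`. All these random variables are independent.
`c₁`, `c₂` are the premium rates and `q` is the discount rate. -/
structure TwoBranchModel {Ω : Type*} [MeasurableSpace Ω] (P : Measure Ω) where
  b₁ : ℝ
  b₂ : ℝ
  c₁ : ℝ
  c₂ : ℝ
  lam : ℝ
  q : ℝ
  G : Measure ℝ
  wait : ℕ → Ω → ℝ
  claim : ℕ → Ω → ℝ
  b₁_pos : 0 < b₁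
  b₂_pos : 0 < b₂
  b_add : b₁ + b₂ = 1
  c₁_pos : 0 < c₁
  c₂_pos : 0 < c₂
  premium_le : c₂ / b₂ ≤ c₁ / b₁
  lam_pos : 0 < lam
  q_pos : 0 < q
  measurable_wait : ∀ i, Measurable (wait i)
  measurable_claim : ∀ i, Measurable (claim i)
  law_wait : ∀ i, HasLaw (wait i) (expMeasure lam) P
  law_claim : ∀ i, HasLaw (claim i) G P
  G_nonneg : ∀ᵐ α ∂G, 0 ≤ α
  G_absCont : G ≪ volume
  indep : iIndepFun (Sum.elim wait claim) P

namespace TwoBranchModel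

variable {Ω : Type*} [MeasurableSpace Ω] {P : Measure Ω} (m : TwoBranchModel P)

/-- The arrival time of the claim with index `n` (indices start at `0`). -/
def arrival (n : ℕ) (ω : Ω) : ℝ := ∑ i ∈ Finset.range (n + 1), m.wait i ω

/-- `N_t`, the number of claims up to time `t` (almost surely finite). -/
def claimCount (t : ℝ≥0) (ω : Ω) : ℕ := {n : ℕ | m.arrival n ω ≤ t}.ncard

/-- The total claim amount `∑_{i ≤ N_t} U_i` up to time `t`. -/
def totalClaims (t : ℝ≥0) (ω : Ω) : ℝ := ∑ i ∈ Finset.range (m.claimCount t ω), m.claim i ω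

/-- The uncontrolled surplus of the first branch with initial surplus `x`. -/
def surplus₁ (x : ℝ) (t : ℝ≥0) (ω : Ω) : ℝ := x + m.c₁ * t - m.b₁ * m.totalClaims t ω

/-- The uncontrolled surplus of the second branch with initial surplus `x`. -/
def surplus₂ (x : ℝ) (t : ℝ≥0) (ω : Ω) : ℝ := x + m.c₂ * t - m.b₂ * m.totalClaims t ω

lemma measurable_totalClaims (t : ℝ≥0) : Measurable (m.totalClaims t) := by
  have hT : ∀ n, Measurable (m.arrival n) := fun n =>
    Finset.measurable_sum _ fun i _ => m.measurable_wait i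
  have hN : Measurable (m.claimCount t) := by
    refine measurable_ncard.comp (measurable_set_iff.2 fun n => ?_)
    exact measurableSet_setOfPred.1 (measurableSet_le (hT n) measurable_const)
  have hS : Measurable fun p : ℕ × Ω => ∑ i ∈ Finset.range p.1, m.claim i p.2 :=
    measurable_from_prod_countable_right fun n =>
      Finset.measurable_sum (Finset.range n) fun i _ => m.measurable_claim i
  exact hS.comp (hN.prodMk measurable_id)

lemma measurable_surplus₁ (x : ℝ) (t : ℝ≥0) : Measurable (m.surplus₁ x t) :=
  measurable_const.sub ((m.measurable_totalClaims t).const_mul _)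

lemma measurable_surplus₂ (x : ℝ) (t : ℝ≥0) : Measurable (m.surplus₂ x t) :=
  measurable_const.sub ((m.measurable_totalClaims t).const_mul _)

/-- The filtration generated by the bivariate surplus process, under the usual conditions. -/
def filtration (x : ℝ × ℝ) : Filtration ℝ≥0 (inferInstance : MeasurableSpace Ω) :=
  usualAugmentation P (Filtration.natural
    (fun t ω => (m.surplus₁ x.1 t ω, m.surplus₂ x.2 t ω))
    fun t => ((m.measurable_surplus₁ x.1 t).prodMk
      (m.measurable_surplus₂ x.2 t)).stronglyMeasurable)

/-- The filtration generated by the surplus process of the second branch alone, under the usual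
conditions. -/
def filtration₂ (x₂ : ℝ) : Filtration ℝ≥0 (inferInstance : MeasurableSpace Ω) :=
  usualAugmentation P (Filtration.natural (m.surplus₂ x₂)
    fun t => (m.measurable_surplus₂ x₂ t).stronglyMeasurable)

/-! ### The bivariate dividend problem -/

/-- The ruin time of the controlled bivariate surplus: the first time at which at least one branch
has negative surplus after dividends (`∞` if there is none). -/
def ruinTime (x : ℝ × ℝ) (L₁ L₂ : ℝ≥0 → Ω → ℝ) (ω : Ω) : ℝ≥0∞ :=
  ⨅ (t : ℝ≥0) (_ : m.surplus₁ x.1 t ω - L₁ t ω < 0 ∨ m.surplus₂ x.2 t ω - L₂ t ω < 0), (t : ℝ≥0∞)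

/-- Admissible dividend strategies for the initial surplus `x`. -/
structure IsAdmissible (x : ℝ × ℝ) (L₁ L₂ : ℝ≥0 → Ω → ℝ) : Prop where
  dividend₁ : IsDividendProcess (m.filtration x) L₁
  dividend₂ : IsDividendProcess (m.filtration x) L₂
  le_surplus : ∀ᵐ ω ∂P, ∀ t : ℝ≥0, (t : ℝ≥0∞) < m.ruinTime x L₁ L₂ ω →
    L₁ t ω ≤ m.surplus₁ x.1 t ω ∧ L₂ t ω ≤ m.surplus₂ x.2 t ω

/-- The expected discounted dividends of both branches until ruin. -/
def payoff (x : ℝ × ℝ) (L₁ L₂ : ℝ≥0 → Ω → ℝ) : ℝ≥0∞ :=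
  ∫⁻ ω, (discountedDividends m.q (fun t => L₁ t ω) (m.ruinTime x L₁ L₂ ω)
    + discountedDividends m.q (fun t => L₂ t ω) (m.ruinTime x L₁ L₂ ω)) ∂P

/-- The optimal value function `V`. The supremum is finite. -/
def optimalValue (x : ℝ × ℝ) : ℝ :=
  (⨆ (L : (ℝ≥0 → Ω → ℝ) × (ℝ≥0 → Ω → ℝ)) (_ : m.IsAdmissible x L.1 L.2),
    m.payoff x L.1 L.2).toReal

/-- The half line `𝓜` from the origin with slope `b₂ / b₁`. -/
def halfLine : Set (ℝ × ℝ) := {x | 0 ≤ x.1 ∧ 0 ≤ x.2 ∧ x.2 = m.b₂ / m.b₁ * x.1}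

/-- Admissible strategies which immediately pay what is needed to bring the surplus to `𝓜` (the
first branch pays `x₁ - (b₁/b₂) x₂` if this is positive, the second branch pays
`x₂ - (b₂/b₁) x₁` if that is positive) and afterwards keep the controlled surplus in `𝓜` until
ruin. -/
structure IsHalfLineStrategy (x : ℝ × ℝ) (L₁ L₂ : ℝ≥0 → Ω → ℝ) : Prop where
  admissible : m.IsAdmissible x L₁ L₂
  initial_payment : ∀ᵐ ω ∂P, ∀ t : ℝ≥0, 0 < t →
    x.1 - m.b₁ / m.b₂ * x.2 ≤ L₁ t ω ∧ x.2 - m.b₂ / m.b₁ * x.1 ≤ L₂ t ω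
  mem_halfLine : ∀ᵐ ω ∂P, ∀ t : ℝ≥0, 0 < t → (t : ℝ≥0∞) < m.ruinTime x L₁ L₂ ω →
    (m.surplus₁ x.1 t ω - L₁ t ω, m.surplus₂ x.2 t ω - L₂ t ω) ∈ m.halfLine

/-- The function `Ṽ`: the best value among the strategies that stay in `𝓜`. The supremum is
finite. -/
def halfLineValue (x : ℝ × ℝ) : ℝ :=
  (⨆ (L : (ℝ≥0 → Ω → ℝ) × (ℝ≥0 → Ω → ℝ)) (_ : m.IsHalfLineStrategy x L.1 L.2),
    m.payoff x L.1 L.2).toReal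

/-! ### The auxiliary one-dimensional problem -/

/-- The ruin time of the controlled surplus of the second branch alone. -/
def ruinTime₂ (x₂ : ℝ) (L₂ : ℝ≥0 → Ω → ℝ) (ω : Ω) : ℝ≥0∞ :=
  ⨅ (t : ℝ≥0) (_ : m.surplus₂ x₂ t ω - L₂ t ω < 0), (t : ℝ≥0∞)

/-- Admissible dividend strategies of the one-dimensional problem. -/
structure IsAdmissible₂ (x₂ : ℝ) (L₂ : ℝ≥0 → Ω → ℝ) : Prop where
  dividend : IsDividendProcess (m.filtration₂ x₂) L₂
  le_surplus : ∀ᵐ ω ∂P, ∀ t : ℝ≥0, (t : ℝ≥0∞) < m.ruinTime₂ x₂ L₂ ω →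
    L₂ t ω ≤ m.surplus₂ x₂ t ω

/-- The expected reward `E (∫_0^τ e^{-qs} (c₁ - (b₁/b₂) c₂) ds + (1 + b₁/b₂) ∫_0^τ e^{-qs} dL₂(s))`;
the rate `c₁ - (b₁/b₂) c₂` is nonnegative by `premium_le`. -/
def payoff₂ (x₂ : ℝ) (L₂ : ℝ≥0 → Ω → ℝ) : ℝ≥0∞ :=
  ∫⁻ ω, ((∫⁻ s in timesBefore (m.ruinTime₂ x₂ L₂ ω),
      ENNReal.ofReal (Real.exp (-m.q * s) * (m.c₁ - m.b₁ / m.b₂ * m.c₂)))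
    + ENNReal.ofReal (1 + m.b₁ / m.b₂)
      * discountedDividends m.q (fun t => L₂ t ω) (m.ruinTime₂ x₂ L₂ ω)) ∂P

/-- The optimal value function `W̄` of the one-dimensional problem. The supremum is finite. -/
def value₂ (x₂ : ℝ) : ℝ :=
  (⨆ (L₂ : ℝ≥0 → Ω → ℝ) (_ : m.IsAdmissible₂ x₂ L₂), m.payoff₂ x₂ L₂).toReal

/-- `(c₁ + c₂) - (lam + q) W̄(y) + lam ∫_0^{y/b₂} W̄(y - b₂ α) dG(α)`. -/
def premiumOperator (y : ℝ) : ℝ :=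
  (m.c₁ + m.c₂) - (m.lam + m.q) * m.value₂ y
    + m.lam * ∫ α in Set.Icc 0 (y / m.b₂), m.value₂ (y - m.b₂ * α) ∂m.G

/-- The set `𝓐`: incoming premiums are paid as dividends. -/
def setA : Set ℝ := {y | 0 ≤ y ∧ m.premiumOperator y = 0}

/-- The set `𝓑`: a lump sum is paid as dividends (at `y = 0` the derivative is one-sided). -/
def setB : Set ℝ :=
  {y | 0 ≤ y ∧ HasDerivWithinAt m.value₂ (1 + m.b₁ / m.b₂) (Set.Ici 0) y ∧ m.premiumOperator y < 0}

/-- The set `𝓒`: no dividends are paid. -/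
def setC : Set ℝ := Set.Ici 0 \ (m.setA ∪ m.setB)

/-- The no-dividend part `𝓒_𝓜` of the half line `𝓜`. -/
def halfLineC : Set (ℝ × ℝ) := (fun y => (m.b₁ / m.b₂ * y, y)) '' m.setC

/-! ### The Hamilton-Jacobi-Bellman equation -/

/-- The nonlocal term `𝓘(u)`. -/
def nonlocalTerm (u : ℝ × ℝ → ℝ) (x : ℝ × ℝ) : ℝ :=
  m.lam * ∫ α in Set.Icc 0 (min (x.1 / m.b₁) (x.2 / m.b₂)),
    u (x.1 - m.b₁ * α, x.2 - m.b₂ * α) ∂m.G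

/-- The partial derivative with respect to the first variable. -/
def partial₁ (u : ℝ × ℝ → ℝ) (x : ℝ × ℝ) : ℝ := deriv (fun s => u (s, x.2)) x.1

/-- The partial derivative with respect to the second variable. -/
def partial₂ (u : ℝ × ℝ → ℝ) (x : ℝ × ℝ) : ℝ := deriv (fun s => u (x.1, s)) x.2

/-- The integro-differential operator `𝓛`. -/
def operatorL (u : ℝ × ℝ → ℝ) (x : ℝ × ℝ) : ℝ :=
  m.c₁ * partial₁ u x + m.c₂ * partial₂ u x - (m.q + m.lam) * u x + m.nonlocalTerm u x

/-- `max {𝓛(u)(x), 1 - u_{x₁}(x), 1 - u_{x₂}(x)}`, the left side of the HJB equation. -/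
def hjb (u : ℝ × ℝ → ℝ) (x : ℝ × ℝ) : ℝ :=
  max (m.operatorL u x) (max (1 - partial₁ u x) (1 - partial₂ u x))

/-- The open first quadrant `(0, ∞)²`. -/
def openQuadrant : Set (ℝ × ℝ) := {x | 0 < x.1 ∧ 0 < x.2}

/-- The closed first quadrant `[0, ∞)²`. -/
def closedQuadrant : Set (ℝ × ℝ) := {x | 0 ≤ x.1 ∧ 0 ≤ x.2}

/-- `u` is a viscosity supersolution of `hjb u = 0` at the point `x` of the open quadrant. Test
functions are continuously differentiable up to the boundary of the quadrant, so that the integral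
in `nonlocalTerm` exists. -/
def IsViscositySupersolutionAt (u : ℝ × ℝ → ℝ) (x : ℝ × ℝ) : Prop :=
  LocallyLipschitzOn openQuadrant u ∧
    ∀ φ : ℝ × ℝ → ℝ, ContDiffOn ℝ 1 φ closedQuadrant → φ x = u x →
      IsMinOn (fun y => u y - φ y) closedQuadrant x → m.hjb φ x ≤ 0

/-- `u` is a viscosity subsolution of `hjb u = 0` at the point `x` of the open quadrant. -/
def IsViscositySubsolutionAt (u : ℝ × ℝ → ℝ) (x : ℝ × ℝ) : Prop :=
  ∀ ψ : ℝ × ℝ → ℝ, ContDiffOn ℝ 1 ψ closedQuadrant → ψ x = u x →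
    IsMaxOn (fun y => u y - ψ y) closedQuadrant x → 0 ≤ m.hjb ψ x

/-- `u` is a viscosity solution of `hjb u = 0` at the point `x`. -/
def IsViscositySolutionAt (u : ℝ × ℝ → ℝ) (x : ℝ × ℝ) : Prop :=
  m.IsViscositySupersolutionAt u x ∧ m.IsViscositySubsolutionAt u x

end TwoBranchModel

end

set_option linter.unusedSectionVars false

noncomputable section

/-! ### Exponential times and discounted dividends -/

/-! Write W for `value₂`, Λ for `premiumOperator`, κ = b₁/b₂, and s = (b₂/b₁)x₁. A strategy that
stays on the half line 𝓜 is determined by its second component, and this reduces Ṽ to W: above 𝓜,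
Ṽ(x) = x₂ - s + W(s) (`halfLineValue_eq`, `halfLineValue_of_le`). Local Lipschitz continuity of Ṽ is
inherited from W, whose growth is limited because one may simply wait until premiums have raised the
surplus (`value₂_sub_le`).

On 𝓜 the second coordinate can grow only at rate c₂; the excess premiums of the first branch are
paid out. Strictly above 𝓜 the first branch is the scarce one, and its premiums, measured along 𝓜 in
the second coordinate, come in at the larger rate f = c₁b₂/b₁ (`fastRate`). If Ṽ were a
supersolution everywhere, or if Ṽ were optimal, W would have to respect this faster rate: W' ≤ 1 + κ
- Λ/f, in the integrated form `HasFastGrowthBound`.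

For a supersolution: if a smooth function of slope p touches W from below at z₀, it lifts to a test
function that touches Ṽ at a point slightly above 𝓜. Letting the distance to 𝓜 vanish in the
inequality for the test function gives f(p - 1 - κ) + Λ(z₀) ≤ 0 (`slope_le_of_supersolution`). A
function that grows faster than with slope M is touched from below with some slope larger than M
(`exists_touching_below`), so the bound follows. For optimality: start at height (f - c₂)h above 𝓜
and pay nothing until time h. At that time the surplus is exactly on 𝓜, at level z + fh - b₂S with S
the claims so far, and one continues on 𝓜. Comparing this value with Ṽ as h → 0 gives the same bound
(`le_optimalValue_dynamic`, `value₂_sub_le_of_optimal`).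

The bound is incompatible with c₂ < f and 𝓒 ≠ ∅ (`HasFastGrowthBound.setC_eq_empty`). Lump sums
force W to grow with slope at least 1 + κ, so Λ ≤ 0. If Λ(y) < 0, then not paying at once in the
one-dimensional problem changes the expected value at a rate of at most Λ + c₂(W' - 1 - κ) ≤ Λ(1 -
c₂/f) < 0. Near-optimal strategies therefore pay a lump sum immediately
(`HasFastGrowthBound.value₂_le_of_lump`). This is impossible at y = 0, and for y > 0 it makes W
affine with slope 1 + κ around y, so y ∈ 𝓑. No HJB equation for W is used, only a short time
expansion of the payoff (`payoff₂_le_of_short_time`).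

The probabilistic groundwork is the Markov property of the claims at deterministic times
(`lintegral_past_future`), the representation of dividend processes as functionals of the claim path
(`exists_pathStrategy`), and the replacement of discounting by an independent exponential clock
(`discountedDividends_eq`). -/

lemma expMeasure_eq_withDensity {q : ℝ} :
    expMeasure q = (volume.restrict (Set.Ici 0)).withDensity
      fun x => ENNReal.ofReal (q * Real.exp (-q * x)) := by
  have h : exponentialPDF q = (Set.Ici (0 : ℝ)).indicator
      fun x => ENNReal.ofReal (q * Real.exp (-q * x)) := by
    ext x
    rw [exponentialPDF_eq]
    by_cases hx : 0 ≤ x <;> simp [hx]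
  change volume.withDensity (exponentialPDF q) = _
  rw [h, withDensity_indicator measurableSet_Ici]

lemma expMeasure_Ioi {q a : ℝ} (hq : 0 < q) (ha : 0 ≤ a) :
    expMeasure q (Set.Ioi a) = ENNReal.ofReal (Real.exp (-q * a)) := by
  have := isProbabilityMeasure_expMeasure hq
  have h := cdf_expMeasure_eq hq a
  rw [if_pos ha, cdf_eq_real] at h
  have h2 : expMeasure q (Set.Iic a) = ENNReal.ofReal (1 - Real.exp (-(q * a))) := by
    rw [← h, ofReal_measureReal]
  rw [← Set.compl_Iic, prob_compl_eq_one_sub measurableSet_Iic, h2,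
    ← ENNReal.ofReal_one, ← ENNReal.ofReal_sub]
  · congr 1
    ring_nf
  · have : Real.exp (-(q * a)) ≤ 1 := Real.exp_le_one_iff.2 (by nlinarith)
    linarith

lemma expMeasure_Iic_zero {q : ℝ} (hq : 0 < q) : expMeasure q (Set.Iic 0) = 0 := by
  have := isProbabilityMeasure_expMeasure hq
  rw [← prob_compl_eq_one_iff measurableSet_Iic, Set.compl_Iic, expMeasure_Ioi hq le_rfl]
  simp

/-- The exponential law is memoryless. -/
lemma lintegral_expMeasure_memoryless {q a : ℝ} (ha : 0 ≤ a) {f : ℝ → ℝ≥0∞}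
    (hf : Measurable f) :
    ∫⁻ x in Set.Ioi a, f (x - a) ∂(expMeasure q) =
      ENNReal.ofReal (Real.exp (-q * a)) * ∫⁻ x, f x ∂(expMeasure q) := by
  have hm : ∀ b : ℝ, Measurable fun x : ℝ => ENNReal.ofReal (q * Real.exp (-q * (x + b))) := by
    intro b; fun_prop
  have hm0 : Measurable fun x : ℝ => ENNReal.ofReal (q * Real.exp (-q * x)) := by fun_prop
  have h0 : ∀ g : ℝ → ℝ≥0∞, Measurable g → ∫⁻ x, g x ∂(expMeasure q) =
      ∫⁻ x in Set.Ioi (0 : ℝ), ENNReal.ofReal (q * Real.exp (-q * x)) * g x := by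
    intro g hg
    rw [expMeasure_eq_withDensity, lintegral_withDensity_eq_lintegral_mul _ hm0 hg,
      Measure.restrict_congr_set Ioi_ae_eq_Ici.symm]
    rfl
  have h1 : ∫⁻ x in Set.Ioi a, f (x - a) ∂(expMeasure q) =
      ∫⁻ x in Set.Ioi a, ENNReal.ofReal (q * Real.exp (-q * x)) * f (x - a) := by
    rw [← lintegral_indicator measurableSet_Ioi, h0 _ (Measurable.indicator (by fun_prop : Measurable fun x : ℝ => f (x - a))
      measurableSet_Ioi), ← lintegral_indicator measurableSet_Ioi,
      ← lintegral_indicator measurableSet_Ioi]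
    congr 1
    ext x
    by_cases hx : a < x
    · have : 0 < x := ha.trans_lt hx
      simp [hx, this]
    · simp [hx, Set.indicator]
  rw [h1, h0 f hf, ← lintegral_const_mul _ (by fun_prop : Measurable fun x : ℝ =>
      ENNReal.ofReal (q * Real.exp (-q * x)) * f x), ← lintegral_indicator measurableSet_Ioi,
    ← lintegral_indicator measurableSet_Ioi, ← lintegral_add_right_eq_self _ a]
  congr 1
  ext x
  by_cases hx : 0 < x
  · simp only [Set.indicator, Set.mem_Ioi, lt_add_iff_pos_left, hx, if_true, add_sub_cancel_right]
    rw [← mul_assoc, ← ENNReal.ofReal_mul (Real.exp_pos _).le]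
    congr 2
    rw [mul_add, Real.exp_add]
    ring
  · simp [hx, Set.indicator]

/-- The law of an exponential time as a measure on `[0, ∞)`. -/
def expTime (q : ℝ) : Measure ℝ≥0 := (expMeasure q).map Real.toNNReal

lemma isProbabilityMeasure_expTime {q : ℝ} (hq : 0 < q) : IsProbabilityMeasure (expTime q) := by
  have := isProbabilityMeasure_expMeasure hq
  exact Measure.isProbabilityMeasure_map (by fun_prop)

lemma lintegral_expTime {q : ℝ} {f : ℝ≥0 → ℝ≥0∞} (hf : Measurable f) :
    ∫⁻ u, f u ∂(expTime q) = ∫⁻ x, f x.toNNReal ∂(expMeasure q) :=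
  lintegral_map hf (by fun_prop)

lemma expTime_Ioi {q : ℝ} (hq : 0 < q) (a : ℝ≥0) :
    expTime q (Set.Ioi a) = ENNReal.ofReal (Real.exp (-q * a)) := by
  rw [expTime, Measure.map_apply (by fun_prop) measurableSet_Ioi, ← expMeasure_Ioi hq a.coe_nonneg]
  congr 1
  ext x
  simp [Real.lt_toNNReal_iff_coe_lt]

lemma lintegral_expTime_memoryless {q : ℝ} (a : ℝ≥0) {f : ℝ≥0 → ℝ≥0∞}
    (hf : Measurable f) :
    ∫⁻ u in Set.Ioi a, f (u - a) ∂(expTime q) =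
      ENNReal.ofReal (Real.exp (-q * a)) * ∫⁻ u, f u ∂(expTime q) := by
  rw [lintegral_expTime hf, ← lintegral_expMeasure_memoryless a.coe_nonneg (f := fun x => f x.toNNReal)
    (hf.comp (by fun_prop)), ← lintegral_indicator measurableSet_Ioi,
    lintegral_expTime (Measurable.indicator (by fun_prop : Measurable fun u : ℝ≥0 => f (u - a))
      measurableSet_Ioi),
    ← lintegral_indicator measurableSet_Ioi]
  congr 1
  ext x
  by_cases hx : (a : ℝ) < x
  · have : a < x.toNNReal := Real.lt_toNNReal_iff_coe_lt.2 hx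
    simp only [Set.indicator, Set.mem_Ioi, this, if_true]
    rw [if_pos hx]
    congr 1
    rw [NNReal.sub_def, Real.coe_toNNReal _ (a.coe_nonneg.trans hx.le)]
  · have : ¬ a < x.toNNReal := fun h => hx (Real.lt_toNNReal_iff_coe_lt.1 h)
    simp only [Set.indicator, Set.mem_Ioi, this, if_false]
    rw [if_neg hx]

/-- The time `u`, stopped at `T`. -/
def stopAt (T : ℝ≥0∞) (u : ℝ≥0) : ℝ≥0 := (min (u : ℝ≥0∞) T).toNNReal

lemma coe_stopAt (T : ℝ≥0∞) (u : ℝ≥0) : (stopAt T u : ℝ≥0∞) = min (u : ℝ≥0∞) T :=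
  ENNReal.coe_toNNReal (ne_top_of_le_ne_top ENNReal.coe_ne_top (min_le_left _ _))

lemma stopAt_le_right (T : ℝ≥0∞) (u : ℝ≥0) : (stopAt T u : ℝ≥0∞) ≤ T := by
  rw [coe_stopAt]; exact min_le_right _ _

lemma stopAt_le_left (T : ℝ≥0∞) (u : ℝ≥0) : stopAt T u ≤ u := by
  rw [← ENNReal.coe_le_coe, coe_stopAt]; exact min_le_left _ _

lemma stopAt_of_le {T : ℝ≥0∞} {u : ℝ≥0} (h : (u : ℝ≥0∞) ≤ T) : stopAt T u = u := by
  rw [← ENNReal.coe_inj, coe_stopAt, min_eq_left h]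

lemma stopAt_mono_left {T T' : ℝ≥0∞} (h : T ≤ T') (u : ℝ≥0) : stopAt T u ≤ stopAt T' u := by
  rw [← ENNReal.coe_le_coe, coe_stopAt, coe_stopAt]
  exact min_le_min_left _ h

lemma measurable_stopAt : Measurable fun p : ℝ≥0∞ × ℝ≥0 => stopAt p.1 p.2 := by
  unfold stopAt
  fun_prop

lemma timesBefore_inter_Iio (T : ℝ≥0∞) (x : ℝ) :
    timesBefore T ∩ Set.Iio x = Set.Ico 0 (stopAt T x.toNNReal : ℝ) := by
  ext s
  simp only [timesBefore, Set.mem_inter_iff, Set.mem_ofPred_eq, Set.mem_Iio, Set.mem_Ico]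
  rw [and_assoc]
  refine and_congr_right fun hs => ?_
  lift s to ℝ≥0 using hs
  rw [NNReal.coe_lt_coe, ← ENNReal.coe_lt_coe, coe_stopAt, lt_min_iff, ENNReal.ofReal_coe_nnreal,
    ENNReal.coe_lt_coe, Real.lt_toNNReal_iff_coe_lt]
  exact and_comm

lemma measurableSet_timesBefore (T : ℝ≥0∞) : MeasurableSet (timesBefore T) :=
  (measurableSet_le measurable_const measurable_id).inter
    (measurableSet_lt ENNReal.measurable_ofReal measurable_const)

/-- Discounting at rate `q` amounts to stopping at an independent exponential time. -/
lemma lintegral_timesBefore_exp {q : ℝ} (hq : 0 < q) (μ : Measure ℝ) [SFinite μ] (T : ℝ≥0∞) :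
    ∫⁻ s in timesBefore T, ENNReal.ofReal (Real.exp (-q * s)) ∂μ =
      ∫⁻ x, μ (Set.Ico 0 (stopAt T x.toNNReal : ℝ)) ∂(expMeasure q) := by
  have := isProbabilityMeasure_expMeasure hq
  -- The discount factor at s is the probability that the exponential clock rings after s; Tonelli
  -- then exchanges the clock with μ.
  have h1 : ∫⁻ s in timesBefore T, ENNReal.ofReal (Real.exp (-q * s)) ∂μ =
      ∫⁻ s in timesBefore T, ∫⁻ x, (Set.Ioi s).indicator 1 x ∂(expMeasure q) ∂μ := by
    refine setLIntegral_congr_fun (measurableSet_timesBefore T) fun s hs => ?_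
    rw [lintegral_indicator_one measurableSet_Ioi, expMeasure_Ioi hq hs.1]
  have hS : MeasurableSet {p : ℝ × ℝ | p.1 < p.2} := measurableSet_lt measurable_fst measurable_snd
  rw [h1, lintegral_lintegral_swap]
  · refine lintegral_congr fun x => ?_
    rw [← timesBefore_inter_Iio, Set.inter_comm, ← Measure.restrict_apply measurableSet_Iio,
      ← lintegral_indicator_one measurableSet_Iio]
    rfl
  · exact ((measurable_one.indicator hS :
      Measurable ({p : ℝ × ℝ | p.1 < p.2}.indicator (1 : ℝ × ℝ → ℝ≥0∞)))).aemeasurable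

/-- The Stieltjes function is the right-continuous version of the path, and its left limits give
back the path itself by left-continuity. The half-open interval is the right one: a lump sum at t is
not yet contained in the path at t. -/
lemma pathMeasure_Ico {l : ℝ≥0 → ℝ} (hl : Monotone l)
    (hc : ∀ t, ContinuousWithinAt l (Set.Iic t) t) (h0 : l 0 = 0) (t : ℝ≥0) :
    pathMeasure l (Set.Ico 0 (t : ℝ)) = ENNReal.ofReal (l t) := by
  have hm : Monotone (fun x : ℝ => l x.toNNReal) := hl.comp fun _ _ h => Real.toNNReal_mono h
  have hL : ∀ x : ℝ, Function.leftLim hm.stieltjesFunction x = l x.toNNReal := by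
    intro x
    have hcx : ContinuousWithinAt (fun x : ℝ => l x.toNNReal) (Set.Iic x) x :=
      (hc x.toNNReal).comp continuous_real_toNNReal.continuousWithinAt
        fun y hy => Real.toNNReal_mono hy
    exact (leftLim_rightLim (hm.tendsto_leftLim x)).trans hcx.leftLim_eq
  rw [pathMeasure, dif_pos hl]
  erw [StieltjesFunction.measure_Ico]
  rw [hL, hL]
  simp [h0]

/-- This form removes Stieltjes integrals from the rest of the proof: payoffs become averages of the
path at a stopped exponential time, and splitting them at a fixed time is the memoryless property of
the clock. -/
lemma discountedDividends_eq {q : ℝ} (hq : 0 < q) {l : ℝ≥0 → ℝ} (hl : Monotone l)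
    (hc : ∀ t, ContinuousWithinAt l (Set.Iic t) t) (h0 : l 0 = 0) (T : ℝ≥0∞) :
    discountedDividends q l T = ∫⁻ u, ENNReal.ofReal (l (stopAt T u)) ∂(expTime q) := by
  have : SFinite (pathMeasure l) := by
    rw [pathMeasure, dif_pos hl]; infer_instance
  have hmeas : Measurable fun u => ENNReal.ofReal (l (stopAt T u)) :=
    (ENNReal.measurable_ofReal.comp hl.measurable).comp
      (measurable_stopAt.comp (measurable_const.prodMk measurable_id))
  rw [discountedDividends, lintegral_timesBefore_exp hq, lintegral_expTime hmeas]
  simp_rw [pathMeasure_Ico hl hc h0]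

lemma lintegral_discounted_rate {q : ℝ} (hq : 0 < q) {r : ℝ} (hr : 0 ≤ r) (T : ℝ≥0∞) :
    ∫⁻ s in timesBefore T, ENNReal.ofReal (Real.exp (-q * s) * r) =
      ∫⁻ u, ENNReal.ofReal (r * stopAt T u) ∂(expTime q) := by
  have hmeas : Measurable fun u => ENNReal.ofReal (r * stopAt T u) :=
    ENNReal.measurable_ofReal.comp (measurable_const.mul (measurable_subtype_coe.comp
      (measurable_stopAt.comp (measurable_const.prodMk measurable_id))))
  simp_rw [ENNReal.ofReal_mul (Real.exp_pos _).le]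
  rw [lintegral_mul_const _ (by fun_prop), lintegral_timesBefore_exp hq, lintegral_expTime hmeas,
    mul_comm, ← lintegral_const_mul]
  · simp_rw [Real.volume_Ico, sub_zero, ← ENNReal.ofReal_mul hr]
  · simp_rw [Real.volume_Ico, sub_zero]
    exact ENNReal.measurable_ofReal.comp (measurable_subtype_coe.comp
      (measurable_stopAt.comp (measurable_const.prodMk (by fun_prop))))

/-! ### Claim paths -/

/-- The time of the `n`-th arrival (with `0` for `n = 0`) as a function of the waiting times. -/
def markTime (e : ℕ ⊕ ℕ → ℝ) (n : ℕ) : ℝ := ∑ i ∈ Finset.range n, e (Sum.inl i)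

/-- The path of aggregate claims as a function of the waiting times and the claim sizes. -/
def claimPath (e : ℕ ⊕ ℕ → ℝ) (t : ℝ≥0) : ℝ :=
  ∑ i ∈ Finset.range {n : ℕ | markTime e (n + 1) ≤ t}.ncard, e (Sum.inr i)

/-- Marks with positive waiting times and claim sizes and without accumulation of arrivals. -/
structure IsRegularMarks (e : ℕ ⊕ ℕ → ℝ) : Prop where
  wait_pos : ∀ i, 0 < e (Sum.inl i)
  claim_pos : ∀ i, 0 < e (Sum.inr i)
  unbounded : ∀ t, ∃ n, t < markTime e n

lemma markTime_succ (e : ℕ ⊕ ℕ → ℝ) (n : ℕ) : markTime e (n + 1) = markTime e n + e (Sum.inl n) :=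
  Finset.sum_range_succ _ _

@[simp] lemma markTime_zero (e : ℕ ⊕ ℕ → ℝ) : markTime e 0 = 0 := rfl

lemma markTime_mono {e : ℕ ⊕ ℕ → ℝ} (he : ∀ i, 0 ≤ e (Sum.inl i)) : Monotone (markTime e) :=
  monotone_nat_of_le_succ fun n => by rw [markTime_succ]; linarith [he n]

lemma claimPath_eq {e : ℕ ⊕ ℕ → ℝ} (he : ∀ i, 0 ≤ e (Sum.inl i)) {t : ℝ≥0} {n : ℕ}
    (h1 : markTime e n ≤ t) (h2 : (t : ℝ) < markTime e (n + 1)) :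
    claimPath e t = ∑ i ∈ Finset.range n, e (Sum.inr i) := by
  have : {k : ℕ | markTime e (k + 1) ≤ t} = (Finset.range n : Set ℕ) := by
    ext k
    simp only [Set.mem_ofPred_eq, Finset.coe_range, Set.mem_Iio]
    constructor
    · intro hk
      by_contra hn
      have := markTime_mono he (show n + 1 ≤ k + 1 by lia)
      linarith
    · intro hk
      exact (markTime_mono he (show k + 1 ≤ n by lia)).trans h1
  rw [claimPath, this, Set.ncard_coe_finset, Finset.card_range]

namespace IsRegularMarks

variable {e : ℕ ⊕ ℕ → ℝ}

lemma exists_index (he : IsRegularMarks e) (t : ℝ≥0) :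
    ∃ n, markTime e n ≤ t ∧ (t : ℝ) < markTime e (n + 1) := by
  classical
  have hex := he.unbounded t
  have hpos : Nat.find hex ≠ 0 := fun h0 => by
    have := Nat.find_spec hex
    rw [h0, markTime_zero] at this
    exact absurd this (not_lt.2 t.coe_nonneg)
  obtain ⟨n, hn⟩ := Nat.exists_eq_succ_of_ne_zero hpos
  refine ⟨n, not_lt.1 (Nat.find_min hex (by lia)), ?_⟩
  have := Nat.find_spec hex
  rwa [hn] at this

lemma claimPath_mono (he : IsRegularMarks e) : Monotone (claimPath e) := by
  intro s t hst
  obtain ⟨n, h1, h2⟩ := he.exists_index s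
  obtain ⟨k, h3, h4⟩ := he.exists_index t
  have hw := fun i => (he.wait_pos i).le
  rw [claimPath_eq hw h1 h2, claimPath_eq hw h3 h4]
  have hnk : n ≤ k := by
    by_contra hlt
    have := markTime_mono hw (show k + 1 ≤ n by lia)
    have : (s : ℝ) ≤ t := by exact_mod_cast hst
    linarith
  exact Finset.sum_le_sum_of_subset_of_nonneg (Finset.range_mono hnk)
    fun i _ _ => (he.claim_pos i).le

lemma claimPath_zero (he : IsRegularMarks e) : claimPath e 0 = 0 := by
  rw [claimPath_eq (n := 0) (fun i => (he.wait_pos i).le) (by simp)]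
  · simp
  · simpa [markTime_succ] using he.wait_pos 0

lemma claimPath_nonneg (he : IsRegularMarks e) (t : ℝ≥0) : 0 ≤ claimPath e t :=
  he.claimPath_zero ▸ he.claimPath_mono zero_le

/-- Claim paths are locally constant to the right. -/
lemma exists_claimPath_eq_right (he : IsRegularMarks e) (t : ℝ≥0) :
    ∃ t' > t, ∀ s, t ≤ s → s < t' → claimPath e s = claimPath e t := by
  obtain ⟨n, h1, h2⟩ := he.exists_index t
  have hw := fun i => (he.wait_pos i).le
  have h0 : 0 ≤ markTime e (n + 1) := t.coe_nonneg.trans h2.le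
  refine ⟨⟨markTime e (n + 1), h0⟩, by exact_mod_cast h2, fun s hs hs' => ?_⟩
  rw [claimPath_eq hw h1 h2, claimPath_eq hw (h1.trans (by exact_mod_cast hs)) (by exact_mod_cast hs')]

lemma claimPath_of_lt (he : IsRegularMarks e) {t : ℝ≥0} (ht : (t : ℝ) < e (Sum.inl 0)) :
    claimPath e t = 0 := by
  rw [claimPath_eq (n := 0) (fun i => (he.wait_pos i).le) (by simp)]
  · simp
  · simpa [markTime_succ] using ht

lemma claimPath_of_mem (he : IsRegularMarks e) {t : ℝ≥0} (ht : e (Sum.inl 0) ≤ t)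
    (ht' : (t : ℝ) < e (Sum.inl 0) + e (Sum.inl 1)) : claimPath e t = e (Sum.inr 0) := by
  rw [claimPath_eq (n := 1) (fun i => (he.wait_pos i).le)]
  · simp
  · simpa [markTime_succ] using ht
  · simpa [markTime_succ] using ht'

end IsRegularMarks

/-- The marks from index `n` on. -/
def shiftMarks (n : ℕ) (e : ℕ ⊕ ℕ → ℝ) : ℕ ⊕ ℕ → ℝ := fun j => e (Sum.map (· + n) (· + n) j)

/-- The marks when `a` has already passed of the first waiting time. -/
def delayMarks (a : ℝ) (e : ℕ ⊕ ℕ → ℝ) : ℕ ⊕ ℕ → ℝ :=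
  fun j => if j = Sum.inl 0 then e j - a else e j

/-- The marks with index `< n`, continued by the constant `c`. -/
def cutMarks (n : ℕ) (c : ℝ) (e : ℕ ⊕ ℕ → ℝ) : ℕ ⊕ ℕ → ℝ :=
  fun j => if Sum.elim id id j < n then e j else c

lemma measurable_markTime (n : ℕ) : Measurable fun e => markTime e n := by
  unfold markTime
  fun_prop

lemma measurable_claimPath : Measurable claimPath := by
  refine measurable_pi_iff.2 fun t => ?_
  have hN : Measurable fun e : ℕ ⊕ ℕ → ℝ => {n : ℕ | markTime e (n + 1) ≤ t}.ncard := by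
    refine measurable_ncard.comp (measurable_set_iff.2 fun n => ?_)
    exact measurableSet_setOfPred.1 (measurableSet_le (measurable_markTime _) measurable_const)
  have hS : Measurable fun p : ℕ × (ℕ ⊕ ℕ → ℝ) => ∑ i ∈ Finset.range p.1, p.2 (Sum.inr i) :=
    measurable_from_prod_countable_right fun n => by
      change Measurable fun e : ℕ ⊕ ℕ → ℝ => ∑ i ∈ Finset.range n, e (Sum.inr i)
      fun_prop
  exact hS.comp (hN.prodMk measurable_id)

lemma measurable_shiftMarks (n : ℕ) : Measurable (shiftMarks n) :=
  measurable_pi_iff.2 fun _ => measurable_pi_apply _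

lemma measurable_delayMarks : Measurable fun p : ℝ × (ℕ ⊕ ℕ → ℝ) => delayMarks p.1 p.2 := by
  refine measurable_pi_iff.2 fun j => ?_
  unfold delayMarks
  split_ifs <;> fun_prop

lemma measurable_cutMarks (n : ℕ) (c : ℝ) : Measurable (cutMarks n c) := by
  refine measurable_pi_iff.2 fun j => ?_
  unfold cutMarks
  split_ifs <;> fun_prop

lemma markTime_cutMarks {n k : ℕ} (hk : k ≤ n) (c : ℝ) (e : ℕ ⊕ ℕ → ℝ) :
    markTime (cutMarks n c e) k = markTime e k := by
  refine Finset.sum_congr rfl fun i hi => ?_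
  have : i < n := (Finset.mem_range.1 hi).trans_le hk
  simp [cutMarks, this]

lemma markTime_delay_shift (n k : ℕ) (a : ℝ) (e : ℕ ⊕ ℕ → ℝ) :
    markTime (delayMarks a (shiftMarks n e)) (k + 1) =
      markTime e (n + k + 1) - markTime e n - a := by
  induction k with
  | zero => simp [markTime_succ, delayMarks, shiftMarks]
  | succ k ih =>
    rw [markTime_succ, ih, ← add_assoc, markTime_succ e (n + k + 1)]
    simp [delayMarks, shiftMarks]
    ring_nf

/-- The path after time `h` in terms of the marks that come after `h`. -/
lemma IsRegularMarks.claimPath_add_sub {e : ℕ ⊕ ℕ → ℝ} (he : IsRegularMarks e) {h : ℝ≥0} {n : ℕ}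
    (h1 : markTime e n ≤ h) (h2 : (h : ℝ) < markTime e (n + 1)) (r : ℝ≥0) :
    claimPath e (h + r) - claimPath e h =
      claimPath (delayMarks (h - markTime e n) (shiftMarks n e)) r := by
  obtain ⟨N, h3, h4⟩ := he.exists_index (h + r)
  have hw := fun i => (he.wait_pos i).le
  have hr := r.coe_nonneg
  rw [NNReal.coe_add] at h3 h4
  have hnN : n ≤ N := by
    by_contra hlt
    have := markTime_mono hw (show N + 1 ≤ n by lia)
    linarith
  obtain ⟨k, rfl⟩ := Nat.exists_eq_add_of_le hnN
  have hw' : ∀ i, 0 ≤ delayMarks (h - markTime e n) (shiftMarks n e) (Sum.inl i) := by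
    intro i
    rcases i with _ | i
    · rw [markTime_succ] at h2
      simp only [delayMarks, shiftMarks, if_true, Sum.map_inl, zero_add]
      linarith
    · simpa [delayMarks, shiftMarks] using hw _
  rw [claimPath_eq hw h1 h2, claimPath_eq hw (by simpa using h3) (by simpa using h4),
    claimPath_eq (n := k) hw', Finset.sum_range_add, add_sub_cancel_left]
  · refine Finset.sum_congr rfl fun i _ => ?_
    simp [delayMarks, shiftMarks, add_comm]
  · rcases k with _ | k
    · simp
    · rw [markTime_delay_shift]
      rw [← add_assoc] at h3
      linarith
  · rw [markTime_delay_shift]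
    linarith

/-- The path before time `h` in terms of the marks that come before `h`. -/
lemma IsRegularMarks.claimPath_cutMarks {e : ℕ ⊕ ℕ → ℝ} (he : IsRegularMarks e) {h : ℝ≥0} {n : ℕ}
    (h1 : markTime e n ≤ h) (h2 : (h : ℝ) < markTime e (n + 1)) {t : ℝ≥0} (ht : t ≤ h) :
    claimPath (cutMarks n (h + 1) e) t = claimPath e t := by
  obtain ⟨N, h3, h4⟩ := he.exists_index t
  have hw := fun i => (he.wait_pos i).le
  have ht' : (t : ℝ) ≤ h := by exact_mod_cast ht
  have hh := h.coe_nonneg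
  have hNn : N ≤ n := by
    by_contra hlt
    have := markTime_mono hw (show n + 1 ≤ N by lia)
    linarith
  have hw' : ∀ i, 0 ≤ cutMarks n (h + 1) e (Sum.inl i) := by
    intro i
    unfold cutMarks
    split_ifs
    · exact hw i
    · linarith
  rw [claimPath_eq hw h3 h4, claimPath_eq (n := N) hw']
  · refine Finset.sum_congr rfl fun i hi => ?_
    have : i < n := (Finset.mem_range.1 hi).trans_le hNn
    simp [cutMarks, this]
  · rwa [markTime_cutMarks hNn]
  -- If t lies after the last kept arrival, the next waiting time is the filler h + 1, which moves
  -- the next arrival beyond h.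
  · rcases hNn.eq_or_lt with rfl | hlt
    · rw [markTime_succ, markTime_cutMarks le_rfl]
      simp only [cutMarks, Sum.elim_inl, id_eq, lt_irrefl, if_false]
      have : 0 ≤ markTime e N := markTime_mono hw (Nat.zero_le N)
      linarith
    · rwa [markTime_cutMarks hlt]

/-! ### The Markov property of the claim process at a deterministic time -/

namespace TwoBranchModel

variable {Ω : Type*} [MeasurableSpace Ω] {P : Measure Ω} [IsProbabilityMeasure P]
  (m : TwoBranchModel P)

/-- Waiting times and claim sizes. -/
def marks (ω : Ω) : ℕ ⊕ ℕ → ℝ := fun j => Sum.elim m.wait m.claim j ω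

/-- The laws of the marks. -/
def markLaw : ℕ ⊕ ℕ → Measure ℝ := Sum.elim (fun _ => expMeasure m.lam) (fun _ => m.G)

lemma totalClaims_eq (t : ℝ≥0) (ω : Ω) : m.totalClaims t ω = claimPath (m.marks ω) t := rfl

lemma measurable_mark (j : ℕ ⊕ ℕ) : Measurable fun ω => m.marks ω j := by
  rcases j with i | i
  · exact m.measurable_wait i
  · exact m.measurable_claim i

lemma measurable_marks : Measurable m.marks := measurable_pi_iff.2 m.measurable_mark

lemma hasLaw_mark (j : ℕ ⊕ ℕ) : HasLaw (fun ω => m.marks ω j) (m.markLaw j) P := by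
  rcases j with i | i
  · exact m.law_wait i
  · exact m.law_claim i

instance isProbabilityMeasure_markLaw (j : ℕ ⊕ ℕ) : IsProbabilityMeasure (m.markLaw j) :=
  by
  rw [← (m.hasLaw_mark j).map_eq]
  exact Measure.isProbabilityMeasure_map (m.measurable_mark j).aemeasurable

instance isProbabilityMeasure_G : IsProbabilityMeasure m.G :=
  m.isProbabilityMeasure_markLaw (Sum.inr 0)

lemma iIndepFun_marks : iIndepFun (fun j ω => m.marks ω j) P := m.indep

lemma map_marks : P.map m.marks = Measure.infinitePi m.markLaw := by
  have := m.iIndepFun_marks.map_fun_eq_infinitePi_map m.measurable_mark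
  simp_rw [(m.hasLaw_mark _).map_eq] at this
  exact this

lemma map_shiftMarks (n : ℕ) :
    P.map (fun ω => shiftMarks n (m.marks ω)) = Measure.infinitePi m.markLaw := by
  have h : P.map (fun ω => shiftMarks n (m.marks ω)) =
      (P.map m.marks).map (shiftMarks n) :=
    (Measure.map_map (measurable_shiftMarks n) m.measurable_marks).symm
  have hinj : Function.Injective (Sum.map (· + n) (· + n) : ℕ ⊕ ℕ → ℕ ⊕ ℕ) :=
    Function.Injective.sumMap (add_left_injective n) (add_left_injective n)
  rw [h, map_marks]
  refine (Measure.map_infinitePi_infinitePi_of_inj (P := m.markLaw) hinj).trans ?_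
  congr 1
  ext1 j
  rcases j with i | i <;> rfl

/-- The two families are built from disjoint sets of independent marks, those with index below n and
those with index at least n. -/
lemma indepFun_cut_shift (n : ℕ) (c : ℝ) :
    IndepFun (fun ω => cutMarks n c (m.marks ω)) (fun ω => shiftMarks n (m.marks ω)) P := by
  have hI := indep_iSup_of_disjoint
    (m := fun j => MeasurableSpace.comap (fun ω => m.marks ω j) inferInstance)
    (fun j => (m.measurable_mark j).comap_le) m.iIndepFun_marks.iIndep
    (S := {j | Sum.elim id id j < n}) (T := {j | n ≤ Sum.elim id id j})
    (Set.disjoint_left.2 fun j hj hj' => by simp only [Set.mem_ofPred_eq] at hj hj'; lia)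
  rw [IndepFun_iff_Indep]
  refine indep_of_indep_of_le_left (indep_of_indep_of_le_right hI ?_) ?_
  · rw [← measurable_iff_comap_le]
    refine (@measurable_pi_iff _ _ _ (_) _ _).2 ?_
    intro j
    refine Measurable.mono (comap_measurable _) (le_iSup₂_of_le (Sum.map (· + n) (· + n) j) ?_ le_rfl)
      le_rfl
    rcases j with i | i <;> simp
  · rw [← measurable_iff_comap_le]
    refine (@measurable_pi_iff _ _ _ (_) _ _).2 ?_
    intro j
    unfold cutMarks
    split_ifs with hj
    · exact Measurable.mono (comap_measurable _) (le_iSup₂_of_le j hj le_rfl) le_rfl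
    · exact measurable_const

/-- Memorylessness of the first waiting time, lifted to the whole sequence of marks. After
normalisation the restricted and shifted law agrees with the product law on finite boxes, where only
the first factor is affected. -/
lemma lintegral_delayMarks {a : ℝ} (ha : 0 ≤ a) {F : (ℕ ⊕ ℕ → ℝ) → ℝ≥0∞} (hF : Measurable F) :
    ∫⁻ e in {e : ℕ ⊕ ℕ → ℝ | a < e (Sum.inl 0)}, F (delayMarks a e)
        ∂(Measure.infinitePi m.markLaw) =
      ENNReal.ofReal (Real.exp (-m.lam * a)) * ∫⁻ e, F e ∂(Measure.infinitePi m.markLaw) := by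
  classical
  set μ := Measure.infinitePi m.markLaw
  have hd : Measurable (delayMarks a) := measurable_delayMarks.comp (measurable_const.prodMk measurable_id)
  set c := ENNReal.ofReal (Real.exp (-m.lam * a)) with hcdef
  have hc0 : c ≠ 0 := by simp [hcdef, Real.exp_pos]
  have hct : c ≠ ⊤ := ENNReal.ofReal_ne_top
  have hmeas : MeasurableSet {e : ℕ ⊕ ℕ → ℝ | a < e (Sum.inl 0)} :=
    measurableSet_lt measurable_const (measurable_pi_apply _)
  have key : c⁻¹ • (μ.restrict {e : ℕ ⊕ ℕ → ℝ | a < e (Sum.inl 0)}).map (delayMarks a) = μ := by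
    refine Measure.eq_infinitePi _ fun s t ht => ?_
    set A : Set ℝ := if Sum.inl 0 ∈ s then t (Sum.inl 0) else Set.univ with hA
    have hAm : MeasurableSet A := by
      rw [hA]; split_ifs; exacts [ht _, .univ]
    have hpi : MeasurableSet (Set.pi (s : Set (ℕ ⊕ ℕ)) t) :=
      MeasurableSet.pi s.countable_toSet fun i _ => ht i
    set B : Set ℝ := Set.Ioi a ∩ (fun x => x - a) ⁻¹' A with hB
    have hBm : MeasurableSet B := measurableSet_Ioi.inter (hAm.preimage (by fun_prop))
    have hexp : expMeasure m.lam B = c * expMeasure m.lam A := by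
      have := lintegral_expMeasure_memoryless (q := m.lam) ha
        (f := A.indicator 1) (measurable_one.indicator hAm)
      rw [lintegral_indicator_one hAm] at this
      rw [hcdef, ← this, ← lintegral_indicator_one hBm, ← lintegral_indicator measurableSet_Ioi]
      congr 1
      ext x
      by_cases h1 : a < x <;> by_cases h2 : x - a ∈ A <;> simp [hB, h1, h2, Set.indicator]
    -- The first waiting time is constrained by the conditioning event even if the box leaves it
    -- free; hence it is inserted into the index set.
    have hset : delayMarks a ⁻¹' (Set.pi s t) ∩ {e : ℕ ⊕ ℕ → ℝ | a < e (Sum.inl 0)} =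
        Set.pi (insert (Sum.inl 0) (s.erase (Sum.inl 0)) : Finset (ℕ ⊕ ℕ))
          (fun j => if j = Sum.inl 0 then B else t j) := by
      ext e
      simp only [Set.mem_inter_iff, Set.mem_preimage, Set.mem_pi, Finset.mem_coe, Set.mem_ofPred_eq,
        Finset.mem_insert, Finset.mem_erase, delayMarks]
      constructor
      · rintro ⟨h1, h2⟩ j hj
        by_cases hj0 : j = Sum.inl 0
        · subst hj0
          rw [if_pos rfl]
          refine ⟨h2, ?_⟩
          change e _ - a ∈ A
          rw [hA]
          split_ifs with hs
          · simpa using h1 _ hs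
          · trivial
        · rw [if_neg hj0]
          have := h1 j (by tauto)
          rwa [if_neg hj0] at this
      · intro h1
        have h0 := h1 (Sum.inl 0) (Or.inl rfl)
        rw [if_pos rfl] at h0
        refine ⟨fun j hj => ?_, h0.1⟩
        by_cases hj0 : j = Sum.inl 0
        · subst hj0
          have h2 : e (Sum.inl 0) - a ∈ A := h0.2
          rw [hA, if_pos hj] at h2
          simpa using h2
        · have := h1 j (Or.inr ⟨hj0, hj⟩)
          rwa [if_neg hj0] at this ⊢
    rw [Measure.smul_apply, Measure.map_apply hd hpi, Measure.restrict_apply (hd hpi), hset,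
      Measure.infinitePi_pi, Finset.prod_insert (Finset.notMem_erase _ _), if_pos rfl]
    · have h1 : ∏ x ∈ s.erase (Sum.inl 0), m.markLaw x (if x = Sum.inl 0 then B else t x) =
          ∏ x ∈ s.erase (Sum.inl 0), m.markLaw x (t x) :=
        Finset.prod_congr rfl fun x hx => by rw [if_neg (Finset.ne_of_mem_erase hx)]
      have h2 : m.markLaw (Sum.inl 0) B = c * m.markLaw (Sum.inl 0) A := hexp
      rw [h1, h2, smul_eq_mul, ← mul_assoc, ← mul_assoc, ENNReal.inv_mul_cancel hc0 hct, one_mul]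
      by_cases hs : Sum.inl 0 ∈ s
      · rw [hA, if_pos hs, Finset.mul_prod_erase s (fun x => m.markLaw x (t x)) hs]
      · rw [hA, if_neg hs, measure_univ, one_mul, Finset.erase_eq_of_notMem hs]
    · intro i _
      split_ifs
      exacts [hBm, ht i]
  have h3 : (μ.restrict {e : ℕ ⊕ ℕ → ℝ | a < e (Sum.inl 0)}).map (delayMarks a) = c • μ := by
    rw [← key, smul_smul, ENNReal.mul_inv_cancel hc0 hct, one_smul]
    rw [key]
  rw [← lintegral_map hF hd, h3, lintegral_smul_measure, smul_eq_mul]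

lemma ae_wait_pos : ∀ᵐ ω ∂P, ∀ i, 0 < m.wait i ω := by
  refine ae_all_iff.2 fun i => ?_
  have h : ∀ᵐ x ∂(expMeasure m.lam), 0 < x := by
    rw [ae_iff]
    simpa [Set.Iic] using expMeasure_Iic_zero m.lam_pos
  rw [← (m.law_wait i).map_eq] at h
  exact ae_of_ae_map (m.measurable_wait i).aemeasurable h

lemma G_pos : ∀ᵐ α ∂m.G, 0 < α := by
  have h0 : ∀ᵐ α ∂m.G, α ≠ 0 := by
    rw [ae_iff]
    simpa using m.G_absCont (Real.volume_singleton (a := 0))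
  filter_upwards [m.G_nonneg, h0] with α h1 h2 using lt_of_le_of_ne h1 h2.symm

lemma ae_claim_pos : ∀ᵐ ω ∂P, ∀ i, 0 < m.claim i ω := by
  refine ae_all_iff.2 fun i => ?_
  have h := m.G_pos
  rw [← (m.law_claim i).map_eq] at h
  exact ae_of_ae_map (m.measurable_claim i).aemeasurable h

/-- The second Borel–Cantelli lemma. Infinitely many waiting times above 1 prevent an accumulation
of arrivals. -/
lemma ae_frequently_wait : ∀ᵐ ω ∂P, ∃ᶠ i in Filter.atTop, 1 < m.wait i ω := by
  have hms : ∀ i, MeasurableSet {ω | 1 < m.wait i ω} := fun i =>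
    measurableSet_lt measurable_const (m.measurable_wait i)
  have hw : iIndepFun m.wait P := m.indep.precomp (g := Sum.inl) Sum.inl_injective
  have hind : iIndepSet (fun i => {ω | 1 < m.wait i ω}) P := by
    rw [iIndepSet_iff_meas_biInter hms]
    intro s
    exact hw.measure_inter_preimage_eq_mul s (fun i _ => (measurableSet_Ioi : MeasurableSet (Set.Ioi (1:ℝ))))
  have hP : ∀ i, P {ω | 1 < m.wait i ω} = ENNReal.ofReal (Real.exp (-m.lam * 1)) := by
    intro i
    rw [← expMeasure_Ioi m.lam_pos zero_le_one, ← (m.law_wait i).map_eq,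
      Measure.map_apply (m.measurable_wait i) measurableSet_Ioi]
    rfl
  have hsum : ∑' i, P {ω | 1 < m.wait i ω} = ⊤ := by
    simp_rw [hP]
    rw [ENNReal.tsum_const_eq_top_of_ne_zero]
    simp [Real.exp_pos]
  have h1 := measure_limsup_eq_one hms hind hsum
  have hm : MeasurableSet (Filter.limsup (fun i => {ω | 1 < m.wait i ω}) Filter.atTop) :=
    MeasurableSet.measurableSet_limsup hms
  have h2 := (prob_compl_eq_zero_iff hm).2 h1
  rw [ae_iff]
  convert h2 using 2
  ext ω
  simp [Filter.mem_limsup_iff_frequently_mem]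

lemma ae_isRegularMarks : ∀ᵐ ω ∂P, IsRegularMarks (m.marks ω) := by
  filter_upwards [m.ae_wait_pos, m.ae_claim_pos, m.ae_frequently_wait] with ω h1 h2 h3
  refine ⟨h1, h2, fun t => ?_⟩
  have hmono : Monotone (markTime (m.marks ω)) := markTime_mono fun i => (h1 i).le
  have : ∀ k : ℕ, ∃ n, (k : ℝ) ≤ markTime (m.marks ω) n := by
    intro k
    induction k with
    | zero => exact ⟨0, by simp⟩
    | succ k ih =>
      obtain ⟨n, hn⟩ := ih
      obtain ⟨i, hi, hi'⟩ := Filter.frequently_atTop.1 h3 n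
      refine ⟨i + 1, ?_⟩
      have := hmono hi
      have h4 : m.marks ω (Sum.inl i) = m.wait i ω := rfl
      rw [markTime_succ, h4]
      push_cast
      linarith
  obtain ⟨k, hk⟩ := exists_nat_gt t
  obtain ⟨n, hn⟩ := this k
  exact ⟨n, hk.trans_le hn⟩

/-- The path of aggregate claims. -/
def claims (ω : Ω) : ℝ≥0 → ℝ := fun r => m.totalClaims r ω

/-- The path of aggregate claims, stopped at time `h`. -/
def pastClaims (h : ℝ≥0) (ω : Ω) : ℝ≥0 → ℝ := fun r => m.totalClaims (min r h) ω

/-- The path of aggregate claims after time `h`. -/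
def futureClaims (h : ℝ≥0) (ω : Ω) : ℝ≥0 → ℝ :=
  fun r => m.totalClaims (h + r) ω - m.totalClaims h ω

lemma measurable_pastClaims (h : ℝ≥0) : Measurable (m.pastClaims h) :=
  measurable_pi_iff.2 fun _ => m.measurable_totalClaims _

lemma measurable_futureClaims (h : ℝ≥0) : Measurable (m.futureClaims h) :=
  measurable_pi_iff.2 fun _ => (m.measurable_totalClaims _).sub (m.measurable_totalClaims _)

/-- The event that there are `n` arrivals up to time `h`. -/
def countEvent (h : ℝ≥0) (n : ℕ) : Set Ω :=
  {ω | markTime (m.marks ω) n ≤ h ∧ (h : ℝ) < markTime (m.marks ω) (n + 1)}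

/-- With exactly n arrivals up to h, the past is a function of the first n marks, and the future is
a function of the later marks with the elapsed time removed from their first waiting time. These
groups are independent, and memorylessness turns the shortened marks into fresh ones at the price of
an exponential factor that depends on the past only. Since the factor does not involve F, applying
the identity once more to the functional already averaged over the future yields the Markov
property. -/
lemma lintegral_past_future_countEvent (h : ℝ≥0) (n : ℕ)
    {F : (ℝ≥0 → ℝ) × (ℝ≥0 → ℝ) → ℝ≥0∞} (hF : Measurable F) :
    ∫⁻ ω in m.countEvent h n, F (m.pastClaims h ω, m.futureClaims h ω) ∂P =
      ∫⁻ ω, {c | markTime c n ≤ h}.indicator (fun c =>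
        ENNReal.ofReal (Real.exp (-m.lam * (h - markTime c n))) *
          ∫⁻ e, F (fun r => claimPath c (min r h), claimPath e) ∂(Measure.infinitePi m.markLaw))
        (cutMarks n (h + 1) (m.marks ω)) ∂P := by
  set μ := Measure.infinitePi m.markLaw with hμ
  have hA : MeasurableSet (m.countEvent h n) :=
    (measurableSet_le ((measurable_markTime n).comp m.measurable_marks) measurable_const).inter
      (measurableSet_lt measurable_const ((measurable_markTime (n + 1)).comp m.measurable_marks))
  have hpast : Measurable fun c : ℕ ⊕ ℕ → ℝ => (fun r : ℝ≥0 => claimPath c (min r h)) :=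
    measurable_pi_iff.2 fun r => (measurable_pi_apply (min r h)).comp measurable_claimPath
  -- Both the event and the functional are expressed through the independent pair of cut and shifted
  -- marks.
  let H : (ℕ ⊕ ℕ → ℝ) × (ℕ ⊕ ℕ → ℝ) → ℝ≥0∞ := fun p =>
    {p : (ℕ ⊕ ℕ → ℝ) × (ℕ ⊕ ℕ → ℝ) | markTime p.1 n ≤ h ∧ h - markTime p.1 n < p.2 (Sum.inl 0)}.indicator
      (fun p => F (fun r => claimPath p.1 (min r h),
        claimPath (delayMarks (h - markTime p.1 n) p.2))) p
  have hT : Measurable fun p : (ℕ ⊕ ℕ → ℝ) × (ℕ ⊕ ℕ → ℝ) => markTime p.1 n :=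
    (measurable_markTime n).comp measurable_fst
  have hH : Measurable H := by
    refine Measurable.indicator (hF.comp ((hpast.comp measurable_fst).prodMk
      (measurable_claimPath.comp (measurable_delayMarks.comp
        ((measurable_const.sub hT).prodMk measurable_snd))))) ?_
    exact (measurableSet_le hT measurable_const).inter
      (measurableSet_lt (measurable_const.sub hT) ((measurable_pi_apply _).comp measurable_snd))
  have hcut : Measurable fun ω => cutMarks n (h + 1) (m.marks ω) :=
    (measurable_cutMarks n _).comp m.measurable_marks
  have hsh : Measurable fun ω => shiftMarks n (m.marks ω) :=
    (measurable_shiftMarks n).comp m.measurable_marks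
  have h1 : ∫⁻ ω in m.countEvent h n, F (m.pastClaims h ω, m.futureClaims h ω) ∂P =
      ∫⁻ ω, H (cutMarks n (h + 1) (m.marks ω), shiftMarks n (m.marks ω)) ∂P := by
    rw [← lintegral_indicator hA]
    refine lintegral_congr_ae ?_
    filter_upwards [m.ae_isRegularMarks] with ω hω
    have hc1 : markTime (cutMarks n (h + 1) (m.marks ω)) n = markTime (m.marks ω) n :=
      markTime_cutMarks le_rfl _ _
    have hc2 : shiftMarks n (m.marks ω) (Sum.inl 0) = m.marks ω (Sum.inl n) := by
      simp [shiftMarks]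
    by_cases hωA : ω ∈ m.countEvent h n
    · have hωA' := hωA
      obtain ⟨h1, h2⟩ := hωA'
      have hmem : (cutMarks n (h + 1) (m.marks ω), shiftMarks n (m.marks ω)) ∈
          {p : (ℕ ⊕ ℕ → ℝ) × (ℕ ⊕ ℕ → ℝ) |
            markTime p.1 n ≤ h ∧ h - markTime p.1 n < p.2 (Sum.inl 0)} := by
        rw [markTime_succ] at h2
        simp only [Set.mem_ofPred_eq, hc1, hc2]
        exact ⟨h1, by linarith⟩
      rw [Set.indicator_of_mem hωA]
      simp only [H]
      rw [Set.indicator_of_mem hmem]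
      simp only [hc1]
      congr 2
      · ext r
        exact (hω.claimPath_cutMarks h1 h2 (min_le_right r h)).symm
      · ext r
        exact hω.claimPath_add_sub h1 h2 r
    · rw [Set.indicator_of_notMem hωA]
      simp only [H]
      rw [Set.indicator_of_notMem]
      simp only [Set.mem_ofPred_eq, hc1, hc2]
      rintro ⟨h1, h2⟩
      refine hωA ⟨h1, ?_⟩
      rw [markTime_succ]
      linarith
  have h2 : ∫⁻ ω, H (cutMarks n (h + 1) (m.marks ω), shiftMarks n (m.marks ω)) ∂P =
      ∫⁻ ω, ∫⁻ e, H (cutMarks n (h + 1) (m.marks ω), e) ∂μ ∂P := by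
    have hprod := (indepFun_iff_map_prod_eq_prod_map_map hcut.aemeasurable hsh.aemeasurable).1
      (m.indepFun_cut_shift n (h + 1))
    rw [map_shiftMarks] at hprod
    rw [← lintegral_map (f := H) hH (hcut.prodMk hsh), hprod, lintegral_prod _ hH.aemeasurable,
      lintegral_map (f := fun c => ∫⁻ e, H (c, e) ∂μ) hH.lintegral_prod_right' hcut]
  rw [h1, h2]
  refine lintegral_congr fun ω => ?_
  set c := cutMarks n (h + 1) (m.marks ω)
  by_cases hc : markTime c n ≤ h
  · rw [Set.indicator_of_mem (by exact hc)]
    have hF' : Measurable fun e => F (fun r => claimPath c (min r h), claimPath e) :=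
      hF.comp (measurable_const.prodMk measurable_claimPath)
    rw [← m.lintegral_delayMarks (sub_nonneg.2 hc) hF', ← lintegral_indicator]
    · refine lintegral_congr fun e => ?_
      simp only [H]
      by_cases he : h - markTime c n < e (Sum.inl 0)
      · rw [Set.indicator_of_mem (by exact ⟨hc, he⟩), Set.indicator_of_mem (by exact he)]
      · rw [Set.indicator_of_notMem (fun hh => he hh.2), Set.indicator_of_notMem (by exact he)]
    · exact measurableSet_lt measurable_const (measurable_pi_apply _)
  · rw [Set.indicator_of_notMem (by exact hc)]
    refine (lintegral_congr fun e => ?_).trans lintegral_zero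
    exact Set.indicator_of_notMem (fun hh => hc hh.1) _

lemma lintegral_eq_tsum_countEvent (h : ℝ≥0) (f : Ω → ℝ≥0∞) :
    ∫⁻ ω, f ω ∂P = ∑' n, ∫⁻ ω in m.countEvent h n, f ω ∂P := by
  have hA : ∀ n, MeasurableSet (m.countEvent h n) := fun n =>
    (measurableSet_le ((measurable_markTime n).comp m.measurable_marks) measurable_const).inter
      (measurableSet_lt measurable_const ((measurable_markTime (n + 1)).comp m.measurable_marks))
  have hdisj : Pairwise (Function.onFun (AEDisjoint P) (m.countEvent h)) := by
    have hlt : ∀ n k, n < k → AEDisjoint P (m.countEvent h n) (m.countEvent h k) := by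
      intro n k hnk
      refine measure_mono_null (t := {ω | ¬ IsRegularMarks (m.marks ω)}) ?_ (ae_iff.1 m.ae_isRegularMarks)
      rintro ω ⟨⟨_, h2⟩, ⟨h3, _⟩⟩ hω
      have := markTime_mono (fun i => (hω.wait_pos i).le) (show n + 1 ≤ k from hnk)
      linarith
    intro n k hnk
    rcases lt_or_gt_of_ne hnk with h1 | h1
    · exact hlt _ _ h1
    · exact (hlt _ _ h1).symm
  rw [← lintegral_iUnion₀ (fun n => (hA n).nullMeasurableSet) hdisj]
  refine (setLIntegral_congr ?_).symm.trans (setLIntegral_univ f) |>.symm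
  refine Filter.EventuallyEq.symm (ae_eq_univ.2 ?_)
  refine measure_mono_null (t := {ω | ¬ IsRegularMarks (m.marks ω)}) ?_ (ae_iff.1 m.ae_isRegularMarks)
  intro ω hω hr
  obtain ⟨n, hn⟩ := hr.exists_index h
  exact hω (Set.mem_iUnion.2 ⟨n, hn⟩)

/-- The Markov property: at a deterministic time `h`, the claim process starts afresh, independently
of the past. -/
lemma lintegral_past_future (h : ℝ≥0) {F : (ℝ≥0 → ℝ) × (ℝ≥0 → ℝ) → ℝ≥0∞} (hF : Measurable F) :
    ∫⁻ ω, F (m.pastClaims h ω, m.futureClaims h ω) ∂P =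
      ∫⁻ ω, ∫⁻ ω', F (m.pastClaims h ω, m.claims ω') ∂P ∂P := by
  set μ := Measure.infinitePi m.markLaw with hμ
  have hE : Measurable fun p : (ℝ≥0 → ℝ) × (ℕ ⊕ ℕ → ℝ) => F (p.1, claimPath p.2) :=
    hF.comp (measurable_fst.prodMk (measurable_claimPath.comp measurable_snd))
  have hF1 : Measurable fun p : (ℝ≥0 → ℝ) × (ℝ≥0 → ℝ) => ∫⁻ e, F (p.1, claimPath e) ∂μ :=
    (hE.lintegral_prod_right').comp measurable_fst
  have h1 : ∀ p, ∫⁻ ω', F (p, m.claims ω') ∂P = ∫⁻ e, F (p, claimPath e) ∂μ := by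
    intro p
    rw [hμ, ← map_marks, lintegral_map _ m.measurable_marks]
    · rfl
    · exact hF.comp (measurable_const.prodMk measurable_claimPath)
  simp_rw [h1]
  rw [m.lintegral_eq_tsum_countEvent h, m.lintegral_eq_tsum_countEvent h]
  refine tsum_congr fun n => ?_
  rw [m.lintegral_past_future_countEvent h n hF,
    m.lintegral_past_future_countEvent h n (F := fun p => ∫⁻ e, F (p.1, claimPath e) ∂μ) hF1]
  simp [hμ]

end TwoBranchModel

/-! ### Dividend processes as functionals of the claim path -/

/-- A function that is measurable modulo null sets has a measurable version. -/
lemma exists_measurable_ae_eq_of_eventuallyMeasurable {Ω : Type*} {mΩ : MeasurableSpace Ω}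
    {P : Measure Ω} {m₀ : MeasurableSpace Ω} {f : Ω → ℝ}
    (hf : Measurable[eventuallyMeasurableSpace m₀ (ae P)] f) :
    ∃ g : Ω → ℝ, Measurable[m₀] g ∧ f =ᵐ[P] g := by
  classical
  have h : ∀ r : ℚ, ∃ B, MeasurableSet[m₀] B ∧ {ω | f ω < r} =ᵐ[P] B := fun r =>
    hf (measurableSet_Iio : MeasurableSet (Set.Iio (r : ℝ)))
  choose B hB hfB using h
  refine ⟨fun ω => (⨅ r : ℚ, if ω ∈ B r then ((r : ℝ) : EReal) else ⊤).toReal, ?_, ?_⟩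
  · refine measurable_ereal_toReal.comp (Measurable.iInf fun r => ?_)
    exact Measurable.ite (hB r) measurable_const measurable_const
  · have h2 : ∀ᵐ ω ∂P, ∀ r : ℚ, (f ω < r ↔ ω ∈ B r) := by
      refine ae_all_iff.2 fun r => ?_
      filter_upwards [hfB r] with ω hω
      exact iff_of_eq hω
    filter_upwards [h2] with ω hω
    have : (⨅ r : ℚ, if ω ∈ B r then ((r : ℝ) : EReal) else ⊤) = (f ω : EReal) := by
      refine le_antisymm (le_of_forall_gt_imp_ge_of_dense fun c hc => ?_) (le_iInf fun r => ?_)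
      · obtain ⟨r, hr1, hr2⟩ := EReal.lt_iff_exists_rat_btwn.1 hc
        refine (iInf_le _ r).trans ?_
        have : f ω < r := by exact_mod_cast hr1
        rw [if_pos ((hω r).1 this)]
        exact_mod_cast hr2.le
      · split_ifs with hr
        · exact_mod_cast ((hω r).2 hr).le
        · exact le_top
    rw [this, EReal.toReal_coe]

/-! ### Construction and closure properties of dividend processes -/

section closure

variable {Ω : Type*} {mΩ : MeasurableSpace Ω} {𝓕 : Filtration ℝ≥0 mΩ}

lemma measurable_predictable_indicator {s : ℝ≥0} {ξ : Ω → ℝ} (hξ : Measurable[𝓕 s] ξ) :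
    Measurable[𝓕.predictable] fun p : ℝ≥0 × Ω => if s < p.1 then ξ p.2 else 0 := by
  refine measurable_of_Ici fun c => ?_
  have hset : MeasurableSet[𝓕.predictable] (Set.Ioi s ×ˢ (Set.univ : Set Ω)) :=
    measurableSet_predictable_Ioi_prod (@MeasurableSet.univ _ (𝓕 s))
  have h1 : MeasurableSet[𝓕.predictable] (Set.Ioi s ×ˢ (ξ ⁻¹' Set.Ici c)) :=
    measurableSet_predictable_Ioi_prod (hξ measurableSet_Ici)
  by_cases hc : c ≤ 0
  · have : (fun p : ℝ≥0 × Ω => if s < p.1 then ξ p.2 else 0) ⁻¹' Set.Ici c =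
        (Set.Ioi s ×ˢ (ξ ⁻¹' Set.Ici c)) ∪ (Set.Ioi s ×ˢ (Set.univ : Set Ω))ᶜ := by
      ext p
      by_cases hp : s < p.1 <;> simp [hp, hc]
    rw [this]
    exact h1.union hset.compl
  · have : (fun p : ℝ≥0 × Ω => if s < p.1 then ξ p.2 else 0) ⁻¹' Set.Ici c =
        (Set.Ioi s ×ˢ (ξ ⁻¹' Set.Ici c)) := by
      ext p
      by_cases hp : s < p.1 <;> simp [hp, hc]
    rw [this]
    exact h1

/-- The running supremum of countably many amounts `ξ i`, which become effective after `s i`. -/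
def supProcess {Ω ι : Type*} (s : ι → ℝ≥0) (ξ : ι → Ω → ℝ) (t : ℝ≥0) (ω : Ω) : ℝ :=
  ⨆ i, if s i < t then ξ i ω else 0

section sup

variable {Ω ι : Type*} {s : ι → ℝ≥0} {ξ : ι → Ω → ℝ} {B : ℝ≥0 → ℝ}

lemma bddAbove_supProcess (hB : Monotone B) (hB0 : 0 ≤ B 0) (hξB : ∀ i ω, ξ i ω ≤ B (s i))
    (t : ℝ≥0) (ω : Ω) : BddAbove (Set.range fun i => if s i < t then ξ i ω else 0) := by
  refine ⟨B t, ?_⟩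
  rintro _ ⟨i, rfl⟩
  dsimp only
  split_ifs with h
  · exact (hξB i ω).trans (hB h.le)
  · exact hB0.trans (hB zero_le)

lemma supProcess_nonneg (hξ : ∀ i ω, 0 ≤ ξ i ω) (t : ℝ≥0) (ω : Ω) : 0 ≤ supProcess s ξ t ω :=
  Real.iSup_nonneg fun i => by split_ifs; exacts [hξ i ω, le_rfl]

lemma supProcess_le (hB : Monotone B) (hB0 : 0 ≤ B 0) (hξB : ∀ i ω, ξ i ω ≤ B (s i))
    (t : ℝ≥0) (ω : Ω) : supProcess s ξ t ω ≤ B t := by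
  refine Real.iSup_le (fun i => ?_) (hB0.trans (hB zero_le))
  split_ifs with h
  · exact (hξB i ω).trans (hB h.le)
  · exact hB0.trans (hB zero_le)

lemma supProcess_zero (ω : Ω) : supProcess s ξ 0 ω = 0 := by
  rcases isEmpty_or_nonempty ι with h | h <;> simp [supProcess]

lemma supProcess_mono (hB : Monotone B) (hB0 : 0 ≤ B 0) (hξB : ∀ i ω, ξ i ω ≤ B (s i))
    (hξ : ∀ i ω, 0 ≤ ξ i ω) (ω : Ω) : Monotone fun t => supProcess s ξ t ω := by
  intro t t' htt'
  refine Real.iSup_le (fun i => ?_) (supProcess_nonneg hξ _ _)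
  split_ifs with h
  · have := le_ciSup (bddAbove_supProcess hB hB0 hξB t' ω) i
    rwa [if_pos (h.trans_le htt')] at this
  · exact supProcess_nonneg hξ _ _

lemma supProcess_leftCont (hB : Monotone B) (hB0 : 0 ≤ B 0) (hξB : ∀ i ω, ξ i ω ≤ B (s i))
    (hξ : ∀ i ω, 0 ≤ ξ i ω) (ω : Ω) (t : ℝ≥0) :
    ContinuousWithinAt (fun u => supProcess s ξ u ω) (Set.Iic t) t := by
  have hmono := supProcess_mono hB hB0 hξB hξ ω
  refine tendsto_order.2 ⟨fun c hc => ?_, fun c hc => ?_⟩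
  · rcases lt_or_ge c 0 with hc0 | hc0
    · exact Filter.Eventually.of_forall fun u => hc0.trans_le (supProcess_nonneg hξ _ _)
    · rcases isEmpty_or_nonempty ι with h | h
      · simp [supProcess] at hc
        linarith
      obtain ⟨i, hi⟩ := exists_lt_of_lt_ciSup hc
      split_ifs at hi with h1
      · filter_upwards [mem_nhdsWithin_of_mem_nhds (Ioi_mem_nhds h1)] with u hu
        refine hi.trans_le ?_
        have := le_ciSup (bddAbove_supProcess hB hB0 hξB u ω) i
        rwa [if_pos (Set.mem_Ioi.1 hu)] at this
      · linarith
  · filter_upwards [self_mem_nhdsWithin] with u hu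
    exact (hmono hu).trans_lt hc

end sup

/-- An amount known at its time and effective strictly afterwards gives a predictable,
left-continuous step, and countable suprema preserve both properties. The deterministic bound B
keeps the real supremum meaningful. Lump sums and restarted strategies are all obtained in this way.
-/
lemma isDividendProcess_supProcess {ι : Type*} [Countable ι] {s : ι → ℝ≥0} {ξ : ι → Ω → ℝ}
    {B : ℝ≥0 → ℝ} (hB : Monotone B) (hB0 : 0 ≤ B 0) (hξB : ∀ i ω, ξ i ω ≤ B (s i))
    (hξ : ∀ i ω, 0 ≤ ξ i ω) (hm : ∀ i, Measurable[𝓕 (s i)] (ξ i)) :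
    IsDividendProcess 𝓕 (supProcess s ξ) where
  predictable := by
    have h1 : Measurable[𝓕.predictable] (Function.uncurry (supProcess s ξ)) :=
      Measurable.iSup fun i => measurable_predictable_indicator (hm i)
    exact h1.stronglyMeasurable
  mono ω := supProcess_mono hB hB0 hξB hξ ω
  leftCont ω t := supProcess_leftCont hB hB0 hξB hξ ω t
  zero ω := supProcess_zero ω

namespace IsDividendProcess

variable {L L' : ℝ≥0 → Ω → ℝ}

lemma stronglyMeasurable_uncurry (h : IsDividendProcess 𝓕 L) :
    StronglyMeasurable[𝓕.predictable] (Function.uncurry L) := h.predictable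

lemma nonneg (h : IsDividendProcess 𝓕 L) (t : ℝ≥0) (ω : Ω) : 0 ≤ L t ω :=
  h.zero ω ▸ h.mono ω zero_le

lemma add (h : IsDividendProcess 𝓕 L) (h' : IsDividendProcess 𝓕 L') :
    IsDividendProcess 𝓕 fun t ω => L t ω + L' t ω where
  predictable := h.stronglyMeasurable_uncurry.add h'.stronglyMeasurable_uncurry
  mono ω := (h.mono ω).add (h'.mono ω)
  leftCont ω t := (h.leftCont ω t).add (h'.leftCont ω t)
  zero ω := by simp [h.zero ω, h'.zero ω]

lemma const_mul (h : IsDividendProcess 𝓕 L) {c : ℝ} (hc : 0 ≤ c) :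
    IsDividendProcess 𝓕 fun t ω => c * L t ω where
  predictable := h.stronglyMeasurable_uncurry.const_mul c
  mono ω := (h.mono ω).const_mul hc
  leftCont ω t := continuousWithinAt_const.mul (h.leftCont ω t)
  zero ω := by simp [h.zero ω]

lemma of_path {v : ℝ≥0 → ℝ} (hv : Monotone v) (hvc : ∀ t, ContinuousWithinAt v (Set.Iic t) t)
    (h0 : v 0 = 0) : IsDividendProcess 𝓕 fun t _ => v t where
  predictable := by
    have h1 : Measurable[𝓕.predictable] (Prod.fst : ℝ≥0 × Ω → ℝ≥0) := by
      refine measurable_of_Ioi fun c => ?_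
      have : MeasurableSet[𝓕.predictable] (Set.Ioi c ×ˢ (Set.univ : Set Ω)) :=
        measurableSet_predictable_Ioi_prod (@MeasurableSet.univ _ (𝓕 c))
      rwa [Set.prod_univ] at this
    exact (hv.measurable.comp h1).stronglyMeasurable
  mono _ := hv
  leftCont _ t := hvc t
  zero _ := h0

lemma zero_process : IsDividendProcess 𝓕 fun _ (_ : Ω) => (0 : ℝ) :=
  of_path monotone_const (fun _ => continuousWithinAt_const) rfl

lemma finset_sum {ι : Type*} (s : Finset ι) {f : ι → ℝ≥0 → Ω → ℝ}
    (h : ∀ i, IsDividendProcess 𝓕 (f i)) : IsDividendProcess 𝓕 fun t ω => ∑ i ∈ s, f i t ω := by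
  classical
  induction s using Finset.induction_on with
  | empty => simpa using zero_process
  | insert i s hi ih => simpa [Finset.sum_insert hi] using (h i).add ih

lemma min_path (h : IsDividendProcess 𝓕 L) {v : ℝ≥0 → ℝ} (hv : Monotone v) (hvc : Continuous v)
    (h0 : 0 ≤ v 0) : IsDividendProcess 𝓕 fun t ω => min (L t ω) (v t) where
  predictable := by
    have := (of_path (𝓕 := 𝓕) (v := fun t => v t - v 0) (fun a b hab => sub_le_sub_right (hv hab) _)
      (fun t => (hvc.sub continuous_const).continuousWithinAt) (sub_self _)).stronglyMeasurable_uncurry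
    have h2 : StronglyMeasurable[𝓕.predictable] fun p : ℝ≥0 × Ω => v p.1 := by
      have := this.add
        (@stronglyMeasurable_const _ _ 𝓕.predictable _ (v 0))
      convert this using 1
      ext p
      simp [Function.uncurry]
    exact (h.stronglyMeasurable_uncurry.measurable.min h2.measurable).stronglyMeasurable
  mono ω := (h.mono ω).min hv
  leftCont ω t := (h.leftCont ω t).min hvc.continuousWithinAt
  zero ω := by simp [h.zero ω, h0]

lemma sub_const_pos (h : IsDividendProcess 𝓕 L) {c : ℝ} (hc : 0 ≤ c) :
    IsDividendProcess 𝓕 fun t ω => max (L t ω - c) 0 where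
  predictable := by
    have h1 := h.stronglyMeasurable_uncurry.sub
        (@stronglyMeasurable_const _ _ 𝓕.predictable _ c)
    exact (h1.measurable.max (@measurable_const _ _ _ 𝓕.predictable 0)).stronglyMeasurable
  mono ω := fun s t hst => max_le_max_right _ (sub_le_sub_right (h.mono ω hst) _)
  leftCont ω t := ((h.leftCont ω t).sub continuousWithinAt_const).max continuousWithinAt_const
  zero ω := by simp [h.zero ω, hc]

/-- A lump sum `κ` paid at time `s`. -/
lemma lump {s : ℝ≥0} {κ : Ω → ℝ} (hκ : ∀ ω, 0 ≤ κ ω) {C : ℝ} (hC : ∀ ω, κ ω ≤ C)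
    (hm : Measurable[𝓕 s] κ) : IsDividendProcess 𝓕 fun t ω => if s < t then κ ω else 0 := by
  rcases isEmpty_or_nonempty Ω with hΩ | ⟨⟨ω₀⟩⟩
  · have : (fun t ω => if s < t then κ ω else 0) = fun _ (_ : Ω) => (0 : ℝ) := by
      ext t ω; exact (hΩ.false ω).elim
    rw [this]
    exact zero_process
  have hC0 : 0 ≤ C := (hκ ω₀).trans (hC ω₀)
  have := isDividendProcess_supProcess (𝓕 := 𝓕) (ι := Unit) (s := fun _ => s) (ξ := fun _ => κ)
    (B := fun _ => C) monotone_const hC0 (fun _ ω => hC ω) (fun _ ω => hκ ω) (fun _ => hm)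
  convert this using 1
  ext t ω
  simp [supProcess]

end IsDividendProcess

end closure

/-! ### Strategies as functionals of the claim path -/

/-- The path `f`, stopped at time `s`. -/
def stopPath (s : ℝ≥0) (f : ℝ≥0 → ℝ) : ℝ≥0 → ℝ := fun r => f (min r s)

lemma measurable_stopPath (s : ℝ≥0) : Measurable (stopPath s) :=
  measurable_pi_iff.2 fun _ => measurable_pi_apply _

/-- Pairs of rational times `s < s'`. -/
abbrev RatPair := {p : ℚ≥0 × ℚ≥0 // p.1 < p.2}

/-- The first time of a pair. -/
def RatPair.fst (i : RatPair) : ℝ≥0 := (i.1.1 : ℝ≥0)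

/-- The second time of a pair. -/
def RatPair.snd (i : RatPair) : ℝ≥0 := (i.1.2 : ℝ≥0)

lemma RatPair.fst_lt_snd (i : RatPair) : i.fst < i.snd := by
  simpa [RatPair.fst, RatPair.snd] using i.2

lemma exists_nnrat_between {a b : ℝ≥0} (h : a < b) : ∃ u : ℚ≥0, a < u ∧ (u : ℝ≥0) < b := by
  obtain ⟨u, hu, h1, h2⟩ := (NNReal.lt_iff_exists_rat_btwn a b).1 h
  lift u to ℚ≥0 using hu
  have : Real.toNNReal ((u : ℚ) : ℝ) = (u : ℝ≥0) := by
    rw [show (((u : ℚ) : ℝ)) = ((u : ℝ≥0) : ℝ) by push_cast; rfl, Real.toNNReal_coe]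
  rw [this] at h1 h2
  exact ⟨u, h1, h2⟩

lemma RatPair.exists_between {a b : ℝ≥0} (h : a < b) :
    ∃ i : RatPair, a < i.fst ∧ i.snd < b := by
  obtain ⟨u, hu1, hu2⟩ := exists_nnrat_between h
  obtain ⟨v, hv1, hv2⟩ := exists_nnrat_between hu2
  exact ⟨⟨(u, v), by exact_mod_cast hv1⟩, hu1, hv2⟩

/-- A dividend strategy as a functional of a past path `p` (a parameter) and a claim path `f`:
for each pair of rational times, an amount depending on `f` up to the second time of the pair, which
the accumulated dividends have to reach after that time. -/
structure PathStrategy where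
  amount : RatPair → (ℝ≥0 → ℝ) × (ℝ≥0 → ℝ) → ℝ
  bound : ℝ≥0 → ℝ
  measurable_amount : ∀ i, Measurable (amount i)
  bound_mono : Monotone bound
  bound_zero : 0 ≤ bound 0
  nonneg : ∀ i x, 0 ≤ amount i x
  le_bound : ∀ i x, amount i x ≤ bound i.snd

namespace PathStrategy

variable (σ : PathStrategy)

/-- The amount for the pair `i`, as a function of the unstopped path. -/
def stopped (i : RatPair) (x : (ℝ≥0 → ℝ) × (ℝ≥0 → ℝ)) : ℝ := σ.amount i (x.1, stopPath i.snd x.2)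

/-- The accumulated dividends of the strategy. -/
def val (p f : ℝ≥0 → ℝ) (t : ℝ≥0) : ℝ := supProcess RatPair.snd σ.stopped t (p, f)

lemma measurable_stopped (i : RatPair) : Measurable (σ.stopped i) :=
  (σ.measurable_amount i).comp
    (measurable_fst.prodMk ((measurable_stopPath _).comp measurable_snd))

lemma stopped_nonneg (i : RatPair) (x : (ℝ≥0 → ℝ) × (ℝ≥0 → ℝ)) : 0 ≤ σ.stopped i x := σ.nonneg _ _

lemma stopped_le (i : RatPair) (x : (ℝ≥0 → ℝ) × (ℝ≥0 → ℝ)) : σ.stopped i x ≤ σ.bound i.snd :=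
  σ.le_bound _ _

lemma val_zero (p f : ℝ≥0 → ℝ) : σ.val p f 0 = 0 := supProcess_zero _

lemma val_mono (p f : ℝ≥0 → ℝ) : Monotone (σ.val p f) :=
  supProcess_mono σ.bound_mono σ.bound_zero σ.stopped_le σ.stopped_nonneg _

lemma val_nonneg (p f : ℝ≥0 → ℝ) (t : ℝ≥0) : 0 ≤ σ.val p f t :=
  supProcess_nonneg σ.stopped_nonneg _ _

lemma val_le (p f : ℝ≥0 → ℝ) (t : ℝ≥0) : σ.val p f t ≤ σ.bound t :=
  supProcess_le σ.bound_mono σ.bound_zero σ.stopped_le _ _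

lemma val_leftCont (p f : ℝ≥0 → ℝ) (t : ℝ≥0) :
    ContinuousWithinAt (σ.val p f) (Set.Iic t) t :=
  supProcess_leftCont σ.bound_mono σ.bound_zero σ.stopped_le
    σ.stopped_nonneg _ _

lemma measurable_val : Measurable fun x : ((ℝ≥0 → ℝ) × (ℝ≥0 → ℝ)) × ℝ≥0 => σ.val x.1.1 x.1.2 x.2 := by
  refine Measurable.iSup fun i => ?_
  exact Measurable.ite (measurableSet_lt measurable_const measurable_snd)
    ((σ.measurable_stopped i).comp measurable_fst) measurable_const

lemma val_congr {p f g : ℝ≥0 → ℝ} {t : ℝ≥0} (h : ∀ r < t, f r = g r) : σ.val p f t = σ.val p g t := by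
  unfold val supProcess
  congr 1
  ext i
  split_ifs with hi
  · have : stopPath i.snd f = stopPath i.snd g := by
      ext r
      exact h _ ((min_le_right _ _).trans_lt hi)
    simp only [stopped, this]
  · rfl

end PathStrategy

/-! ### The filtration of the claims and path representations of its dividend processes -/

namespace TwoBranchModel

variable {Ω : Type*} [MeasurableSpace Ω] {P : Measure Ω} [IsProbabilityMeasure P]
  (m : TwoBranchModel P)

/-- The natural filtration of the aggregate claims. -/
def claimFiltration : Filtration ℝ≥0 (inferInstance : MeasurableSpace Ω) :=
  Filtration.natural m.totalClaims fun t => (m.measurable_totalClaims t).stronglyMeasurable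

/-- The natural filtration of the aggregate claims under the usual conditions. -/
def baseFiltration : Filtration ℝ≥0 (inferInstance : MeasurableSpace Ω) :=
  usualAugmentation P m.claimFiltration

/-- Each surplus is an invertible affine function of the total claims, so the information does not
depend on the initial surplus, and strategies can be transferred between different initial surpluses
and between the two problems. -/
lemma filtration_eq (x : ℝ × ℝ) : m.filtration x = m.baseFiltration := by
  unfold filtration baseFiltration
  congr 1
  refine Filtration.ext (funext fun t => ?_)
  change (⨆ j ≤ t, MeasurableSpace.comap _ _) = ⨆ j ≤ t, MeasurableSpace.comap _ _
  refine iSup_congr fun j => iSup_congr fun _ => le_antisymm ?_ ?_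
  · rw [← measurable_iff_comap_le]
    have h := comap_measurable (m := borel ℝ) (m.totalClaims j)
    exact (measurable_const.sub (measurable_const.mul h)).prodMk
      (measurable_const.sub (measurable_const.mul h))
  · rw [← measurable_iff_comap_le]
    have h := comap_measurable (m := inferInstance) (fun ω => (m.surplus₁ x.1 j ω, m.surplus₂ x.2 j ω))
    have h2 : m.totalClaims j = fun ω => (x.1 + m.c₁ * j - (m.surplus₁ x.1 j ω)) / m.b₁ := by
      ext ω
      have := m.b₁_pos.ne'
      simp only [surplus₁]
      field_simp
      ring
    rw [h2]
    exact (measurable_const.sub (measurable_fst.comp h)).div_const _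

lemma filtration₂_eq (y : ℝ) : m.filtration₂ y = m.baseFiltration := by
  unfold filtration₂ baseFiltration
  congr 1
  refine Filtration.ext (funext fun t => ?_)
  change (⨆ j ≤ t, MeasurableSpace.comap _ _) = ⨆ j ≤ t, MeasurableSpace.comap _ _
  refine iSup_congr fun j => iSup_congr fun _ => le_antisymm ?_ ?_
  · rw [← measurable_iff_comap_le]
    have h := comap_measurable (m := borel ℝ) (m.totalClaims j)
    exact measurable_const.sub (measurable_const.mul h)
  · rw [← measurable_iff_comap_le]
    have h := comap_measurable (m := inferInstance) (m.surplus₂ y j)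
    have h2 : m.totalClaims j = fun ω => (y + m.c₂ * j - (m.surplus₂ y j ω)) / m.b₂ := by
      ext ω
      have := m.b₂_pos.ne'
      simp only [surplus₂]
      field_simp
      ring
    rw [h2]
    exact (measurable_const.sub h).div_const _

lemma measurable_totalClaims_base {r t : ℝ≥0} (h : r ≤ t) :
    Measurable[m.baseFiltration t] (m.totalClaims r) := by
  have h1 : Measurable[m.claimFiltration t] (m.totalClaims r) := by
    refine Measurable.mono (comap_measurable _) ?_ le_rfl
    exact le_iSup₂_of_le r h le_rfl
  refine h1.mono ?_ le_rfl
  have h2 : m.claimFiltration ≤ m.baseFiltration := by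
    unfold baseFiltration usualAugmentation
    exact le_sup_left.trans (Filtration.le_rightCont _)
  exact h2 t

/-- The usual conditions are undone: right-continuity costs the passage to a later time, and
augmentation costs a null set. The first of these is why `PathStrategy` uses pairs of times. -/
lemma exists_measurable_claimFiltration {t t' : ℝ≥0} (h : t < t') {f : Ω → ℝ}
    (hf : Measurable[m.baseFiltration t] f) :
    ∃ g : Ω → ℝ, Measurable[m.claimFiltration t'] g ∧ f =ᵐ[P] g := by
  refine exists_measurable_ae_eq_of_eventuallyMeasurable (hf.mono ?_ le_rfl)
  have h1 : m.baseFiltration t ≤ (m.claimFiltration ⊔ Filtration.const ℝ≥0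
    (MeasurableSpace.generateFrom {A : Set Ω | MeasurableSet A ∧ P A = 0})
    (MeasurableSpace.generateFrom_le fun _ hA => hA.1)) t' := by
    rw [baseFiltration, usualAugmentation, Filtration.rightCont_eq]
    exact iInf₂_le t' h
  refine h1.trans (sup_le le_eventuallyMeasurableSpace ?_)
  refine MeasurableSpace.generateFrom_le fun A hA => ?_
  exact ⟨∅, @MeasurableSet.empty _ (m.claimFiltration t'), ae_eq_empty.2 hA.2⟩

/-- The Doob–Dynkin factorisation, with the claims up to h + s recovered from the past up to h and
the stopped future. -/
lemma exists_functional_of_measurable (h s : ℝ≥0) {g : Ω → ℝ}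
    (hg : Measurable[m.claimFiltration (h + s)] g) :
    ∃ G : (ℝ≥0 → ℝ) × (ℝ≥0 → ℝ) → ℝ, Measurable G ∧
      ∀ ω, g ω = G (m.pastClaims h ω, stopPath s (m.futureClaims h ω)) := by
  have hle : m.claimFiltration (h + s) ≤ MeasurableSpace.comap
      (fun ω => (m.pastClaims h ω, stopPath s (m.futureClaims h ω))) inferInstance := by
    refine iSup₂_le fun r hr => ?_
    rw [← measurable_iff_comap_le]
    have h0 := comap_measurable (m := inferInstance)
      (fun ω => (m.pastClaims h ω, stopPath s (m.futureClaims h ω)))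
    rcases le_total r h with hrh | hrh
    · have : m.totalClaims r = fun ω => m.pastClaims h ω r := by
        ext ω; simp [pastClaims, hrh]
      rw [this]
      exact (measurable_pi_apply r).comp (measurable_fst.comp h0)
    · have : m.totalClaims r = fun ω =>
          m.pastClaims h ω h + stopPath s (m.futureClaims h ω) (r - h) := by
        ext ω
        have h1 : r - h ≤ s := tsub_le_iff_left.2 hr
        simp [pastClaims, stopPath, futureClaims, min_eq_left h1, add_tsub_cancel_of_le hrh]
      rw [this]
      exact ((measurable_pi_apply h).comp (measurable_fst.comp h0)).add
        ((measurable_pi_apply (r - h)).comp (measurable_snd.comp h0))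
  obtain ⟨G, hG, hGg⟩ := (hg.mono hle le_rfl).exists_eq_measurable_comp
  exact ⟨G, hG, fun ω => congrFun hGg ω⟩

/-- Every dividend process is, from a deterministic time `h` on, a functional of the claims up to time `h`
and after time `h`. -/
lemma exists_pathStrategy {L : ℝ≥0 → Ω → ℝ} (hL : IsDividendProcess m.baseFiltration L)
    {B : ℝ≥0 → ℝ} (hB : Monotone B) (hLB : ∀ t ω, L t ω ≤ B t) (h : ℝ≥0) :
    ∃ σ : PathStrategy, ∀ᵐ ω ∂P, ∀ t > 0,
      L (h + t) ω = σ.val (m.pastClaims h ω) (m.futureClaims h ω) t := by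
  have hB0 : ∀ t, 0 ≤ B t := by
    obtain ⟨ω⟩ : Nonempty Ω := nonempty_of_isProbabilityMeasure P
    exact fun t => (hL.nonneg t ω).trans (hLB t ω)
  have hex : ∀ i : RatPair, ∃ G : (ℝ≥0 → ℝ) × (ℝ≥0 → ℝ) → ℝ, Measurable G ∧
      (fun ω => L (h + i.fst) ω) =ᵐ[P]
        fun ω => G (m.pastClaims h ω, stopPath i.snd (m.futureClaims h ω)) := by
    intro i
    have h1 : Measurable[m.baseFiltration (h + i.fst)] (L (h + i.fst)) :=
      (hL.predictable.stronglyAdapted (h + i.fst)).measurable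
    obtain ⟨g, hg, hfg⟩ := m.exists_measurable_claimFiltration
      (add_lt_add_right i.fst_lt_snd h) h1
    obtain ⟨G, hG, hGg⟩ := m.exists_functional_of_measurable h i.snd hg
    exact ⟨G, hG, hfg.trans (Filter.Eventually.of_forall hGg)⟩
  choose G hG hLG using hex
  -- Truncation makes the amounts nonnegative and bounded on every path; on almost all actual paths
  -- it changes nothing, because the process already obeys these bounds.
  let σ : PathStrategy :=
    { amount := fun i x => max 0 (min (G i x) (B (h + i.snd)))
      bound := fun t => B (h + t)
      measurable_amount := fun i => measurable_const.max ((hG i).min measurable_const)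
      bound_mono := fun a b hab => hB (add_le_add_right hab h)
      bound_zero := hB0 _
      nonneg := fun _ _ => le_max_left _ _
      le_bound := fun _ _ => max_le (hB0 _) (min_le_right _ _) }
  refine ⟨σ, ?_⟩
  filter_upwards [ae_all_iff.2 hLG] with ω hω t ht
  have hst : ∀ i : RatPair, σ.stopped i (m.pastClaims h ω, m.futureClaims h ω) = L (h + i.fst) ω := by
    intro i
    have h1 : L (h + i.fst) ω ≤ B (h + i.snd) :=
      (hLB _ _).trans (hB (add_le_add_right i.fst_lt_snd.le h))
    change max 0 (min (G i _) (B (h + i.snd))) = _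
    rw [← hω i, min_eq_left h1, max_eq_right (hL.nonneg _ _)]
  have hval : σ.val (m.pastClaims h ω) (m.futureClaims h ω) t =
      ⨆ i : RatPair, if i.snd < t then L (h + i.fst) ω else 0 := by
    unfold PathStrategy.val supProcess
    simp_rw [hst]
  have hbdd : BddAbove (Set.range fun i : RatPair => if i.snd < t then L (h + i.fst) ω else 0) := by
    refine ⟨L (h + t) ω, ?_⟩
    rintro _ ⟨i, rfl⟩
    dsimp only
    split_ifs with hi
    · exact hL.mono ω (add_le_add_right (i.fst_lt_snd.trans hi).le h)
    · exact hL.nonneg _ _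
  rw [hval]
  refine le_antisymm (le_of_forall_lt fun c hc => ?_) (Real.iSup_le (fun i => ?_) (hL.nonneg _ _))
  -- By left-continuity a level below the value at h + t is already exceeded shortly before, and a
  -- rational pair fits into the remaining gap.
  · have h1 : ∀ᶠ u in nhdsWithin (h + t) (Set.Iic (h + t)), c < L u ω :=
      (hL.leftCont ω (h + t)).eventually (lt_mem_nhds hc)
    have h2 : ∀ᶠ u in nhdsWithin (h + t) (Set.Iio (h + t)), c < L u ω :=
      h1.filter_mono (nhdsWithin_mono _ Set.Iio_subset_Iic_self)
    have hlt : h < h + t := lt_add_of_pos_right h ht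
    obtain ⟨l, hl, hl'⟩ := (mem_nhdsLT_iff_exists_Ioo_subset' hlt).1 h2
    have hl2 : max l h - h < t := by
      rw [tsub_lt_iff_left (le_max_right _ _)]
      exact max_lt hl hlt
    obtain ⟨i, hi1, hi2⟩ := RatPair.exists_between hl2
    have h3 : max l h < h + i.fst := by
      rwa [tsub_lt_iff_left (le_max_right _ _)] at hi1
    have h4 : c < L (h + i.fst) ω :=
      hl' ⟨(le_max_left _ _).trans_lt h3, add_lt_add_right (i.fst_lt_snd.trans hi2) h⟩
    refine h4.trans_le ?_
    have := le_ciSup hbdd i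
    rwa [if_pos hi2] at this
  · split_ifs with hi
    · exact hL.mono ω (add_le_add_right (i.fst_lt_snd.trans hi).le h)
    · exact hL.nonneg _ _

lemma ae_pastClaims_zero : ∀ᵐ ω ∂P, m.pastClaims 0 ω = 0 := by
  filter_upwards [m.ae_isRegularMarks] with ω hω
  ext r
  simp [pastClaims, totalClaims_eq, hω.claimPath_zero]

lemma ae_futureClaims_zero : ∀ᵐ ω ∂P, m.futureClaims 0 ω = m.claims ω := by
  filter_upwards [m.ae_isRegularMarks] with ω hω
  ext r
  simp [futureClaims, claims, totalClaims_eq, hω.claimPath_zero]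

lemma exists_pathStrategy_zero {L : ℝ≥0 → Ω → ℝ} (hL : IsDividendProcess m.baseFiltration L)
    {B : ℝ≥0 → ℝ} (hB : Monotone B) (hLB : ∀ t ω, L t ω ≤ B t) :
    ∃ σ : PathStrategy, ∀ᵐ ω ∂P, ∀ t, L t ω = σ.val 0 (m.claims ω) t := by
  obtain ⟨σ, hσ⟩ := m.exists_pathStrategy hL hB hLB 0
  refine ⟨σ, ?_⟩
  filter_upwards [hσ, m.ae_pastClaims_zero, m.ae_futureClaims_zero] with ω h1 h2 h3 t
  rcases eq_or_ne t 0 with rfl | ht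
  · rw [hL.zero, σ.val_zero]
  · have := h1 t (pos_iff_ne_zero.2 ht)
    rwa [zero_add, h2, h3] at this

lemma measurable_stopPath_claims (s : ℝ≥0) :
    Measurable[m.baseFiltration s] fun ω => stopPath s (m.claims ω) :=
  (@measurable_pi_iff _ _ _ (m.baseFiltration s) _ _).2
    fun _ => m.measurable_totalClaims_base (min_le_right _ _)

lemma measurable_stopPath_futureClaims (h s : ℝ≥0) :
    Measurable[m.baseFiltration (h + s)] fun ω => stopPath s (m.futureClaims h ω) :=
  (@measurable_pi_iff _ _ _ (m.baseFiltration (h + s)) _ _).2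
    fun r => (m.measurable_totalClaims_base (add_le_add_right (min_le_right r s) h)).sub
      (m.measurable_totalClaims_base le_self_add)

lemma isDividendProcess_val (σ : PathStrategy) (p : ℝ≥0 → ℝ) :
    IsDividendProcess m.baseFiltration fun t ω => σ.val p (m.claims ω) t :=
  isDividendProcess_supProcess (s := RatPair.snd) (ξ := fun i ω => σ.stopped i (p, m.claims ω))
    σ.bound_mono σ.bound_zero (fun i _ => σ.stopped_le i _) (fun i _ => σ.stopped_nonneg i _)
    fun i => (σ.measurable_amount i).comp
      (measurable_const.prodMk (m.measurable_stopPath_claims i.snd))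

/-- A strategy that, on the event `D`, starts at the deterministic time `h`. -/
lemma isDividendProcess_restart (σ : PathStrategy) (h : ℝ≥0) {D : Set Ω}
    (hD : MeasurableSet[m.baseFiltration h] D) :
    IsDividendProcess m.baseFiltration
      fun t ω => D.indicator (fun ω => σ.val 0 (m.futureClaims h ω) (t - h)) ω := by
  classical
  have := isDividendProcess_supProcess (𝓕 := m.baseFiltration) (s := fun i : RatPair => h + i.snd)
    (ξ := fun i ω => D.indicator (fun ω => σ.stopped i (0, m.futureClaims h ω)) ω)
    σ.bound_mono σ.bound_zero
    (fun i ω => by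
      refine le_trans ?_ (σ.bound_mono (le_add_self : i.snd ≤ h + i.snd))
      refine Set.indicator_apply_le' (fun _ => σ.stopped_le i _) (fun _ => ?_)
      exact σ.bound_zero.trans (σ.bound_mono zero_le))
    (fun i ω => Set.indicator_nonneg (fun _ _ => σ.stopped_nonneg i _) ω)
    (fun i => by
      refine Measurable.indicator ?_ (m.baseFiltration.mono le_self_add _ hD)
      exact (σ.measurable_amount i).comp
        (measurable_const.prodMk (m.measurable_stopPath_futureClaims h i.snd)))
  convert this using 1
  ext t ω
  by_cases hω : ω ∈ D
  · simp only [Set.indicator_of_mem hω, PathStrategy.val, supProcess]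
    congr 1
    ext i
    simp only [lt_tsub_iff_left]
  · simp [Set.indicator_of_notMem hω, supProcess]

end TwoBranchModel

/-! ### Payoffs as functionals of paths -/

/-- The first time at which the path `v` is negative. -/
def ruinOf (v : ℝ≥0 → ℝ) : ℝ≥0∞ := ⨅ (t : ℝ≥0) (_ : v t < 0), (t : ℝ≥0∞)

/-- The first rational time at which the path `v` is negative. -/
def ruinOfRat (v : ℝ≥0 → ℝ) : ℝ≥0∞ := ⨅ (t : ℚ≥0) (_ : v t < 0), ((t : ℝ≥0) : ℝ≥0∞)

lemma ruinOf_le {v : ℝ≥0 → ℝ} {t : ℝ≥0} (h : v t < 0) : ruinOf v ≤ t := iInf₂_le t h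

lemma nonneg_of_lt_ruinOf {v : ℝ≥0 → ℝ} {t : ℝ≥0} (h : (t : ℝ≥0∞) < ruinOf v) : 0 ≤ v t :=
  not_lt.1 fun hv => (ruinOf_le hv).not_gt h

lemma le_ruinOf {v : ℝ≥0 → ℝ} {T : ℝ≥0∞} (h : ∀ t, v t < 0 → T ≤ t) : T ≤ ruinOf v :=
  le_iInf₂ h

/-- A path that is constant on a right neighbourhood of every time. -/
def IsRightConst (f : ℝ≥0 → ℝ) : Prop := ∀ t, ∃ t' > t, ∀ s, t ≤ s → s < t' → f s = f t

/-- Negativity that persists for a while is seen at a rational time. The rational version is a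
countable infimum and hence measurable in the path. -/
lemma ruinOf_eq_ruinOfRat {v : ℝ≥0 → ℝ}
    (hv : ∀ t, v t < 0 → ∃ t' > t, ∀ s, t ≤ s → s < t' → v s < 0) : ruinOf v = ruinOfRat v := by
  refine le_antisymm (le_iInf₂ fun t ht => ruinOf_le ht) (le_ruinOf fun t ht => ?_)
  obtain ⟨t', htt', h⟩ := hv t ht
  refine le_of_forall_gt_imp_ge_of_dense fun c hc => ?_
  have hlt : (t : ℝ≥0∞) < min c t' := lt_min hc (by exact_mod_cast htt')
  obtain ⟨d, hd⟩ : ∃ d : ℝ≥0, (d : ℝ≥0∞) = min c t' :=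
    ⟨(min c t').toNNReal, ENNReal.coe_toNNReal (ne_top_of_le_ne_top ENNReal.coe_ne_top (min_le_right _ _))⟩
  rw [← hd, ENNReal.coe_lt_coe] at hlt
  obtain ⟨u, hu1, hu2⟩ := exists_nnrat_between hlt
  have hdt' : d ≤ t' := by
    rw [← ENNReal.coe_le_coe, hd]; exact min_le_right _ _
  refine (iInf₂_le u (h u hu1.le (hu2.trans_le hdt'))).trans ?_
  calc ((u : ℝ≥0) : ℝ≥0∞) ≤ d := by exact_mod_cast hu2.le
    _ ≤ c := by rw [hd]; exact min_le_left _ _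

/-- The expected value of the cumulative reward `R`, stopped at `T` and at an independent
exponential time. -/
def reward (q : ℝ) (R : ℝ≥0 → ℝ) (T : ℝ≥0∞) : ℝ≥0∞ :=
  ∫⁻ u, ENNReal.ofReal (R (stopAt T u)) ∂(expTime q)

lemma reward_mono {q : ℝ} {R R' : ℝ≥0 → ℝ} {T T' : ℝ≥0∞}
    (h : ∀ u, R (stopAt T u) ≤ R' (stopAt T' u)) : reward q R T ≤ reward q R' T' :=
  lintegral_mono fun u => ENNReal.ofReal_le_ofReal (h u)

lemma reward_linear {q : ℝ} (hq : 0 < q) {r : ℝ} (hr : 0 ≤ r) :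
    ∫⁻ u, ENNReal.ofReal (r * (u : ℝ≥0)) ∂(expTime q) = ENNReal.ofReal (r / q) := by
  have := isProbabilityMeasure_expMeasure hq
  have h := lintegral_discounted_rate hq hr ⊤
  simp only [stopAt, le_top, inf_of_le_left, ENNReal.toNNReal_coe] at h
  rw [← h]
  have h1 : expMeasure q Set.univ = 1 := measure_univ
  rw [expMeasure_eq_withDensity, withDensity_apply _ .univ, Measure.restrict_univ] at h1
  have hset : timesBefore ⊤ = Set.Ici 0 := by
    ext s; simp [timesBefore]
  rw [hset]
  calc ∫⁻ s in Set.Ici (0 : ℝ), ENNReal.ofReal (Real.exp (-q * s) * r)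
      = ∫⁻ s in Set.Ici (0 : ℝ), ENNReal.ofReal (r / q) * ENNReal.ofReal (q * Real.exp (-q * s)) := by
        refine lintegral_congr fun s => ?_
        rw [← ENNReal.ofReal_mul (by positivity)]
        congr 1
        field_simp
    _ = ENNReal.ofReal (r / q) := by
        rw [lintegral_const_mul _ (by fun_prop), h1, mul_one]

lemma reward_add_const {q : ℝ} (hq : 0 < q) {R : ℝ≥0 → ℝ} (hR : Monotone R) (hR0 : 0 ≤ R 0)
    {c : ℝ} (hc : 0 ≤ c) (T : ℝ≥0∞) :
    reward q (fun t => c + R t) T = ENNReal.ofReal c + reward q R T := by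
  have := isProbabilityMeasure_expTime hq
  unfold reward
  have h : ∀ u, ENNReal.ofReal (c + R (stopAt T u)) = ENNReal.ofReal c + ENNReal.ofReal (R (stopAt T u)) :=
    fun u => ENNReal.ofReal_add hc (hR0.trans (hR zero_le))
  simp_rw [h]
  rw [lintegral_add_left measurable_const, lintegral_const, measure_univ, mul_one]

namespace TwoBranchModel

variable {Ω : Type*} [MeasurableSpace Ω] {P : Measure Ω} [IsProbabilityMeasure P]
  (m : TwoBranchModel P)

/-- The marginal reward `1 + b₁ / b₂` of dividends of the second branch. -/
def slope : ℝ := 1 + m.b₁ / m.b₂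

/-- The reward rate `c₁ - (b₁ / b₂) c₂`. -/
def rate : ℝ := m.c₁ - m.b₁ / m.b₂ * m.c₂

lemma ratio_pos : 0 < m.b₁ / m.b₂ := div_pos m.b₁_pos m.b₂_pos

lemma one_lt_slope : 1 < m.slope := by
  have := m.ratio_pos
  unfold slope
  linarith

lemma slope_pos : 0 < m.slope := zero_lt_one.trans m.one_lt_slope

lemma rate_nonneg : 0 ≤ m.rate := by
  have h := m.premium_le
  rw [div_le_div_iff₀ m.b₂_pos m.b₁_pos] at h
  have h2 : m.b₁ / m.b₂ * m.c₂ ≤ m.c₁ := by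
    rw [div_mul_eq_mul_div, div_le_iff₀ m.b₂_pos]
    linarith
  unfold rate
  linarith

lemma rate_add : m.rate + m.slope * m.c₂ = m.c₁ + m.c₂ := by
  unfold rate slope
  ring

/-- The controlled surplus of the second branch for the claim path `f` and the dividends `l`. -/
def level (y : ℝ) (f l : ℝ≥0 → ℝ) (t : ℝ≥0) : ℝ := y + m.c₂ * t - m.b₂ * f t - l t

/-- The one-dimensional payoff for the claim path `f` and the dividends `l`. -/
def pathPayoff (y : ℝ) (f l : ℝ≥0 → ℝ) : ℝ≥0∞ :=
  reward m.q (fun t => m.rate * t + m.slope * l t) (ruinOf (m.level y f l))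

/-- As `pathPayoff`, with ruin observed at rational times. -/
def pathPayoffRat (y : ℝ) (f l : ℝ≥0 → ℝ) : ℝ≥0∞ :=
  reward m.q (fun t => m.rate * t + m.slope * l t) (ruinOfRat (m.level y f l))

/-- A negative level persists to the right: premiums are continuous, claims are locally constant to
the right, and dividends only lower the level. -/
lemma pathPayoff_eq {y : ℝ} {f l : ℝ≥0 → ℝ} (hf : IsRightConst f) (hl : Monotone l) :
    m.pathPayoff y f l = m.pathPayoffRat y f l := by
  unfold pathPayoff pathPayoffRat
  rw [ruinOf_eq_ruinOfRat]
  intro t ht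
  obtain ⟨t', htt', hft⟩ := hf t
  have hc : Continuous fun s : ℝ≥0 => y + m.c₂ * (s : ℝ) - m.b₂ * f t - l t := by fun_prop
  have hev : ∀ᶠ s : ℝ≥0 in nhds t, y + m.c₂ * (s : ℝ) - m.b₂ * f t - l t < 0 :=
    (hc.tendsto t).eventually (gt_mem_nhds (show y + m.c₂ * t - m.b₂ * f t - l t < 0 from ht))
  have hev' : ∀ᶠ s : ℝ≥0 in nhdsWithin t (Set.Ioi t), y + m.c₂ * (s : ℝ) - m.b₂ * f t - l t < 0 :=
    hev.filter_mono nhdsWithin_le_nhds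
  obtain ⟨w, hw, hw'⟩ := (mem_nhdsGT_iff_exists_Ioo_subset' (lt_add_one t)).1 hev'
  refine ⟨min w t', lt_min hw htt', fun s hs hs' => ?_⟩
  rcases hs.eq_or_lt with rfl | hs1
  · exact ht
  · have h1 : y + m.c₂ * (s : ℝ) - m.b₂ * f t - l t < 0 := hw' ⟨hs1, hs'.trans_le (min_le_left _ _)⟩
    have h2 := hl hs
    unfold level
    rw [hft s hs (hs'.trans_le (min_le_right _ _))]
    linarith

lemma measurable_pathPayoffRat {α : Type*} [MeasurableSpace α] {y : α → ℝ} {f l : α → ℝ≥0 → ℝ}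
    (hy : Measurable y) (hf : ∀ t, Measurable fun a => f a t)
    (hl : Measurable fun x : α × ℝ≥0 => l x.1 x.2) :
    Measurable fun a => m.pathPayoffRat (y a) (f a) (l a) := by
  have := isProbabilityMeasure_expTime m.q_pos
  have hT : Measurable fun a => ruinOfRat (m.level (y a) (f a) (l a)) := by
    refine Measurable.iInf fun t : ℚ≥0 => ?_
    have h1 : MeasurableSet {a | m.level (y a) (f a) (l a) (t : ℝ≥0) < 0} := by
      refine measurableSet_lt ?_ measurable_const
      exact ((hy.add_const _).sub ((hf (t : ℝ≥0)).const_mul m.b₂)).sub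
        (hl.comp (measurable_id.prodMk measurable_const))
    classical
    have h2 : (fun a => ⨅ (_ : m.level (y a) (f a) (l a) (t : ℝ≥0) < 0), ((t : ℝ≥0) : ℝ≥0∞)) =
        fun a => if m.level (y a) (f a) (l a) (t : ℝ≥0) < 0 then ((t : ℝ≥0) : ℝ≥0∞) else ⊤ := by
      ext a
      rw [iInf_eq_if]
    rw [h2]
    exact Measurable.ite h1 measurable_const measurable_const
  have hs : Measurable fun z : α × ℝ≥0 => stopAt (ruinOfRat (m.level (y z.1) (f z.1) (l z.1))) z.2 :=
    measurable_stopAt.comp ((hT.comp measurable_fst).prodMk measurable_snd)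
  unfold pathPayoffRat reward
  refine Measurable.lintegral_prod_right' (f := fun z : α × ℝ≥0 =>
    ENNReal.ofReal (m.rate * stopAt (ruinOfRat (m.level (y z.1) (f z.1) (l z.1))) z.2 +
      m.slope * l z.1 (stopAt (ruinOfRat (m.level (y z.1) (f z.1) (l z.1))) z.2))) ?_
  refine ENNReal.measurable_ofReal.comp (Measurable.add ?_ ?_)
  · exact (measurable_subtype_coe.comp hs).const_mul _
  · exact (hl.comp (measurable_fst.prodMk hs)).const_mul _

lemma ae_isRightConst_claims : ∀ᵐ ω ∂P, IsRightConst (m.claims ω) := by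
  filter_upwards [m.ae_isRegularMarks] with ω hω t
  exact hω.exists_claimPath_eq_right t

lemma ae_isRightConst_futureClaims (h : ℝ≥0) : ∀ᵐ ω ∂P, IsRightConst (m.futureClaims h ω) := by
  filter_upwards [m.ae_isRegularMarks] with ω hω t
  obtain ⟨t', ht', heq⟩ := hω.exists_claimPath_eq_right (h + t)
  have hht' : h ≤ t' := le_self_add.trans ht'.le
  refine ⟨t' - h, lt_tsub_iff_left.2 ht', fun s hs hs' => ?_⟩
  simp only [futureClaims, totalClaims_eq]
  rw [heq (h + s) (add_le_add_right hs h) (lt_tsub_iff_left.1 hs')]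

variable {m}

/-- Not exceeding the surplus before ruin is automatic, since ruin is the infimum of the times at
which the controlled surplus is negative. -/
lemma isAdmissible₂_iff {y : ℝ} {L : ℝ≥0 → Ω → ℝ} :
    m.IsAdmissible₂ y L ↔ IsDividendProcess m.baseFiltration L := by
  refine ⟨fun h => m.filtration₂_eq y ▸ h.dividend, fun h => ⟨(m.filtration₂_eq y).symm ▸ h, ?_⟩⟩
  refine Filter.Eventually.of_forall fun ω t ht => ?_
  have := nonneg_of_lt_ruinOf (v := fun t => m.surplus₂ y t ω - L t ω) ht
  linarith

lemma isAdmissible_iff {x : ℝ × ℝ} {L₁ L₂ : ℝ≥0 → Ω → ℝ} :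
    m.IsAdmissible x L₁ L₂ ↔
      IsDividendProcess m.baseFiltration L₁ ∧ IsDividendProcess m.baseFiltration L₂ := by
  refine ⟨fun h => ⟨m.filtration_eq x ▸ h.dividend₁, m.filtration_eq x ▸ h.dividend₂⟩,
    fun h => ⟨(m.filtration_eq x).symm ▸ h.1, (m.filtration_eq x).symm ▸ h.2, ?_⟩⟩
  refine Filter.Eventually.of_forall fun ω t ht => ?_
  constructor
  · by_contra hn
    refine absurd ht (not_lt.2 (iInf₂_le t (Or.inl ?_)))
    linarith
  · by_contra hn
    refine absurd ht (not_lt.2 (iInf₂_le t (Or.inr ?_)))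
    linarith

lemma payoff₂_eq {L : ℝ≥0 → Ω → ℝ} (hL : IsDividendProcess m.baseFiltration L) (y : ℝ) :
    m.payoff₂ y L = ∫⁻ ω, m.pathPayoff y (m.claims ω) (fun t => L t ω) ∂P := by
  refine lintegral_congr fun ω => ?_
  change _ = reward _ _ (m.ruinTime₂ y L ω)
  have hr : ∀ u : ℝ≥0, 0 ≤ m.rate * (u : ℝ) := fun u => mul_nonneg m.rate_nonneg u.coe_nonneg
  rw [discountedDividends_eq m.q_pos (hL.mono ω) (hL.leftCont ω) (hL.zero ω)]
  change (∫⁻ s in timesBefore _, ENNReal.ofReal (Real.exp (-m.q * s) * m.rate)) +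
    ENNReal.ofReal m.slope * _ = _
  have hmeas : Measurable fun u => stopAt (m.ruinTime₂ y L ω) u :=
    measurable_stopAt.comp (measurable_const.prodMk measurable_id)
  rw [lintegral_discounted_rate m.q_pos m.rate_nonneg, ← lintegral_const_mul, ← lintegral_add_left]
  · refine lintegral_congr fun u => ?_
    rw [← ENNReal.ofReal_mul m.slope_pos.le, ENNReal.ofReal_add (hr _)
      (mul_nonneg m.slope_pos.le (hL.nonneg _ _))]
  · exact ENNReal.measurable_ofReal.comp ((measurable_subtype_coe.comp hmeas).const_mul _)
  · exact ENNReal.measurable_ofReal.comp ((hL.mono ω).measurable.comp hmeas)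

lemma payoff_eq {L₁ L₂ : ℝ≥0 → Ω → ℝ} (h₁ : IsDividendProcess m.baseFiltration L₁)
    (h₂ : IsDividendProcess m.baseFiltration L₂) (x : ℝ × ℝ) :
    m.payoff x L₁ L₂ = ∫⁻ ω, reward m.q (fun t => L₁ t ω + L₂ t ω) (m.ruinTime x L₁ L₂ ω) ∂P := by
  refine lintegral_congr fun ω => ?_
  rw [discountedDividends_eq m.q_pos (h₁.mono ω) (h₁.leftCont ω) (h₁.zero ω),
    discountedDividends_eq m.q_pos (h₂.mono ω) (h₂.leftCont ω) (h₂.zero ω)]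
  have hmeas : Measurable fun u => stopAt (m.ruinTime x L₁ L₂ ω) u :=
    measurable_stopAt.comp (measurable_const.prodMk measurable_id)
  rw [← lintegral_add_left]
  · refine lintegral_congr fun u => ?_
    rw [ENNReal.ofReal_add (h₁.nonneg _ _) (h₂.nonneg _ _)]
  · exact ENNReal.measurable_ofReal.comp ((h₁.mono ω).measurable.comp hmeas)

/-- A left-continuous path stays below a continuous path up to the first time at which it would
exceed it. -/
lemma le_of_le_of_forall_lt {l v : ℝ≥0 → ℝ} (hlc : ∀ t, ContinuousWithinAt l (Set.Iic t) t)
    (hv : Continuous v) (h0 : l 0 ≤ v 0) {T : ℝ≥0∞} (h : ∀ t : ℝ≥0, (t : ℝ≥0∞) < T → l t ≤ v t)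
    {t : ℝ≥0} (ht : (t : ℝ≥0∞) ≤ T) : l t ≤ v t := by
  rcases eq_or_ne t 0 with rfl | ht0
  · exact h0
  have hne : (nhdsWithin t (Set.Iio t)).NeBot := nhdsLT_neBot_of_exists_lt ⟨0, pos_iff_ne_zero.2 ht0⟩
  refine le_of_tendsto_of_tendsto ((hlc t).mono_left (nhdsWithin_mono _ Set.Iio_subset_Iic_self))
    (hv.continuousAt.tendsto.mono_left nhdsWithin_le_nhds) ?_
  filter_upwards [self_mem_nhdsWithin] with s hs
  exact h s (lt_of_lt_of_le (by exact_mod_cast hs) ht)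

lemma le_of_le_ruinOf_level {y : ℝ} (hy : 0 ≤ y) {f l : ℝ≥0 → ℝ} (hf : ∀ t, 0 ≤ f t)
    (hlc : ∀ t, ContinuousWithinAt l (Set.Iic t) t) (h0 : l 0 = 0) {t : ℝ≥0}
    (ht : (t : ℝ≥0∞) ≤ ruinOf (m.level y f l)) : l t ≤ y + m.c₂ * t := by
  refine le_of_le_of_forall_lt (v := fun t => y + m.c₂ * t) hlc (by fun_prop) (by simpa [h0]) (fun s hs => ?_) ht
  have h1 := nonneg_of_lt_ruinOf hs
  have h2 := mul_nonneg m.b₂_pos.le (hf s)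
  simp only [level] at h1
  linarith

/-- Up to ruin, and at ruin by left-continuity, dividends cannot exceed the initial surplus plus
premiums; the rate and the weighted premium rate add up to c₁ + c₂. -/
lemma pathPayoff_le {y : ℝ} (hy : 0 ≤ y) {f l : ℝ≥0 → ℝ} (hf : ∀ t, 0 ≤ f t)
    (hlc : ∀ t, ContinuousWithinAt l (Set.Iic t) t) (h0 : l 0 = 0) :
    m.pathPayoff y f l ≤ ENNReal.ofReal (m.slope * y + (m.c₁ + m.c₂) / m.q) := by
  have := isProbabilityMeasure_expTime m.q_pos
  have hc : 0 ≤ m.c₁ + m.c₂ := (add_pos m.c₁_pos m.c₂_pos).le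
  have hsy : 0 ≤ m.slope * y := mul_nonneg m.slope_pos.le hy
  calc m.pathPayoff y f l
      ≤ ∫⁻ u, (ENNReal.ofReal (m.slope * y) + ENNReal.ofReal ((m.c₁ + m.c₂) * (u : ℝ≥0)))
          ∂(expTime m.q) := by
        refine lintegral_mono fun u => ?_
        rw [← ENNReal.ofReal_add hsy (mul_nonneg hc u.coe_nonneg)]
        refine ENNReal.ofReal_le_ofReal ?_
        set s := stopAt (ruinOf (m.level y f l)) u
        have h1 : l s ≤ y + m.c₂ * s := le_of_le_ruinOf_level hy hf hlc h0 (stopAt_le_right _ _)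
        have h2 : (s : ℝ) ≤ u := by exact_mod_cast stopAt_le_left (ruinOf (m.level y f l)) u
        have h3 := mul_le_mul_of_nonneg_left h1 m.slope_pos.le
        have h4 := mul_le_mul_of_nonneg_left h2 hc
        have h5 := m.rate_add
        nlinarith
    _ = ENNReal.ofReal (m.slope * y + (m.c₁ + m.c₂) / m.q) := by
        rw [lintegral_add_left measurable_const, lintegral_const, measure_univ, mul_one,
          reward_linear m.q_pos hc, ENNReal.ofReal_add hsy (div_nonneg hc m.q_pos.le)]

variable (m) in
/-- The value function of the one-dimensional problem, with values in `[0, ∞]`. -/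
def valueSup (y : ℝ) : ℝ≥0∞ := ⨆ (L : ℝ≥0 → Ω → ℝ) (_ : m.IsAdmissible₂ y L), m.payoff₂ y L

lemma payoff₂_le_valueSup {L : ℝ≥0 → Ω → ℝ} (hL : IsDividendProcess m.baseFiltration L) (y : ℝ) :
    m.payoff₂ y L ≤ m.valueSup y :=
  le_iSup₂ (f := fun (L : ℝ≥0 → Ω → ℝ) (_ : m.IsAdmissible₂ y L) => m.payoff₂ y L) L
    (isAdmissible₂_iff.2 hL)

variable (m) in
lemma ae_claims_nonneg : ∀ᵐ ω ∂P, ∀ t, 0 ≤ m.claims ω t := by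
  filter_upwards [m.ae_isRegularMarks] with ω hω t
  exact hω.claimPath_nonneg t

lemma valueSup_le {y : ℝ} (hy : 0 ≤ y) :
    m.valueSup y ≤ ENNReal.ofReal (m.slope * y + (m.c₁ + m.c₂) / m.q) := by
  refine iSup₂_le fun L hL => ?_
  rw [isAdmissible₂_iff] at hL
  rw [payoff₂_eq hL]
  refine (lintegral_mono_ae ?_).trans_eq (by rw [lintegral_const, measure_univ, mul_one])
  filter_upwards [m.ae_claims_nonneg] with ω hω
  exact pathPayoff_le hy hω (hL.leftCont ω) (hL.zero ω)

lemma valueSup_ne_top {y : ℝ} (hy : 0 ≤ y) : m.valueSup y ≠ ⊤ :=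
  ne_top_of_le_ne_top ENNReal.ofReal_ne_top (valueSup_le hy)

lemma value₂_nonneg (y : ℝ) : 0 ≤ m.value₂ y := ENNReal.toReal_nonneg

/-- Near-optimal strategies can be chosen as functionals of the claim path, which never pay more than
the initial surplus and the premiums. -/
lemma exists_pathStrategy_lt {y : ℝ} (hy : 0 ≤ y) {a : ℝ≥0∞} (ha : a < m.valueSup y) :
    ∃ σ : PathStrategy, a < m.payoff₂ y (fun t ω => σ.val 0 (m.claims ω) t) ∧
      ∀ᵐ ω ∂P, ∀ t, σ.val 0 (m.claims ω) t ≤ y + m.c₂ * t := by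
  obtain ⟨L, hL⟩ := lt_iSup_iff.1 ha
  obtain ⟨hL, hLa⟩ := lt_iSup_iff.1 hL
  rw [isAdmissible₂_iff] at hL
  set v : ℝ≥0 → ℝ := fun t => y + m.c₂ * t
  have hv : Monotone v := fun s t hst => by
    have : m.c₂ * (s : ℝ) ≤ m.c₂ * t := mul_le_mul_of_nonneg_left (by exact_mod_cast hst) m.c₂_pos.le
    simp only [v]
    linarith
  have hvc : Continuous v := by fun_prop
  -- Capping by initial surplus and premiums does not alter the dividends up to ruin and can only
  -- postpone ruin, so the payoff does not drop.
  have hL' := hL.min_path hv hvc (by simpa [v] using hy)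
  obtain ⟨σ, hσ⟩ := m.exists_pathStrategy_zero hL' hv (fun t ω => min_le_right _ _)
  refine ⟨σ, hLa.trans_le ?_, hσ.mono fun ω h t => (h t).symm.trans_le (min_le_right _ _)⟩
  rw [payoff₂_eq hL, payoff₂_eq (m.isDividendProcess_val σ 0)]
  refine lintegral_mono_ae ?_
  filter_upwards [hσ, m.ae_claims_nonneg] with ω h1 h2
  have hfun : σ.val 0 (m.claims ω) = fun t => min (L t ω) (v t) := funext fun t => (h1 t).symm
  change _ ≤ m.pathPayoff y (m.claims ω) (σ.val 0 (m.claims ω))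
  rw [hfun]
  have hru : ruinOf (m.level y (m.claims ω) fun t => L t ω) ≤
      ruinOf (m.level y (m.claims ω) fun t => min (L t ω) (v t)) := by
    refine le_ruinOf fun t ht => ruinOf_le ?_
    have := min_le_left (L t ω) (v t)
    simp only [level] at ht ⊢
    linarith
  refine reward_mono fun u => ?_
  have h3 := le_of_le_ruinOf_level (m := m) hy h2 (hL.leftCont ω) (hL.zero ω) (stopAt_le_right _ u)
  have h4 : stopAt _ u ≤ stopAt _ u := stopAt_mono_left hru u
  have h5 := (hL'.mono ω) h4
  have h6 : min (L (stopAt (ruinOf (m.level y (m.claims ω) fun t => L t ω)) u) ω) (v _) = _ :=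
    min_eq_left h3
  simp only at h5
  rw [h6] at h5
  have h7 := mul_le_mul_of_nonneg_left h5 m.slope_pos.le
  have h8 := mul_le_mul_of_nonneg_left (NNReal.coe_le_coe.2 h4) m.rate_nonneg
  linarith

end TwoBranchModel

/-! ### Splitting rewards and paths at a fixed time -/

lemma ruinOf_eq_add {v : ℝ≥0 → ℝ} {h : ℝ≥0} (hh : (h : ℝ≥0∞) ≤ ruinOf v) :
    ruinOf v = h + ruinOf fun t => v (h + t) := by
  refine le_antisymm ?_ (le_ruinOf fun t ht => ?_)
  · rw [← tsub_le_iff_left]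
    refine le_ruinOf fun t ht => ?_
    rw [tsub_le_iff_left]
    exact_mod_cast ruinOf_le ht
  · have hht : h ≤ t := by exact_mod_cast hh.trans (ruinOf_le ht)
    calc (h : ℝ≥0∞) + ruinOf (fun t => v (h + t)) ≤ h + (t - h : ℝ≥0) := by
          gcongr
          exact ruinOf_le (by rwa [add_tsub_cancel_of_le hht])
      _ = t := by
          rw [← ENNReal.coe_add, add_tsub_cancel_of_le hht]

lemma stopAt_add {h u : ℝ≥0} (hu : h ≤ u) (T : ℝ≥0∞) :
    stopAt (h + T) u = h + stopAt T (u - h) := by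
  rw [← ENNReal.coe_inj, ENNReal.coe_add, coe_stopAt, coe_stopAt, ← min_add_add_left,
    ← ENNReal.coe_add, add_tsub_cancel_of_le hu]

lemma measurable_reward_integrand {R : ℝ≥0 → ℝ} (hR : Monotone R) (T : ℝ≥0∞) :
    Measurable fun u => ENNReal.ofReal (R (stopAt T u)) :=
  ENNReal.measurable_ofReal.comp (hR.measurable.comp
    (measurable_stopAt.comp (measurable_const.prodMk measurable_id)))

/-- If the clock rings before h, the reward is at most R h; otherwise the remaining clock is again
exponential. -/
lemma reward_add_le {q : ℝ} (hq : 0 < q) {R : ℝ≥0 → ℝ} (hR : Monotone R) (hR0 : 0 ≤ R 0)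
    (h : ℝ≥0) (T : ℝ≥0∞) :
    reward q R (h + T) ≤ ENNReal.ofReal (R h) +
      ENNReal.ofReal (Real.exp (-q * h)) * reward q (fun t => R (h + t) - R h) T := by
  have := isProbabilityMeasure_expTime hq
  have hm : Measurable fun u => ENNReal.ofReal (R (h + stopAt T u) - R h) :=
    measurable_reward_integrand (R := fun t => R (h + t) - R h)
      (fun a b hab => sub_le_sub_right (hR (add_le_add_right hab h)) _) T
  unfold reward
  rw [← lintegral_expTime_memoryless h hm, ← lintegral_indicator measurableSet_Ioi]
  calc ∫⁻ u, ENNReal.ofReal (R (stopAt (h + T) u)) ∂(expTime q)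
      ≤ ∫⁻ u, (ENNReal.ofReal (R h) + (Set.Ioi h).indicator
          (fun u => ENNReal.ofReal (R (h + stopAt T (u - h)) - R h)) u) ∂(expTime q) := by
        refine lintegral_mono fun u => ?_
        rcases le_or_gt u h with hu | hu
        · exact (ENNReal.ofReal_le_ofReal (hR ((stopAt_le_left _ _).trans hu))).trans le_self_add
        · rw [Set.indicator_of_mem (Set.mem_Ioi.2 hu), ← ENNReal.ofReal_add (hR0.trans (hR zero_le))
            (sub_nonneg.2 (hR le_self_add)), stopAt_add hu.le]
          exact ENNReal.ofReal_le_ofReal (by linarith)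
    _ = _ := by rw [lintegral_add_left measurable_const, lintegral_const, measure_univ, mul_one]

lemma le_reward_add {q : ℝ} {R : ℝ≥0 → ℝ} (hR : Monotone R) (h : ℝ≥0) (T : ℝ≥0∞) :
    ENNReal.ofReal (Real.exp (-q * h)) * reward q (fun t => R (h + t)) T ≤ reward q R (h + T) := by
  have hm : Measurable fun u => ENNReal.ofReal (R (h + stopAt T u)) :=
    measurable_reward_integrand (R := fun t => R (h + t)) (fun a b hab => hR (add_le_add_right hab h)) T
  unfold reward
  rw [← lintegral_expTime_memoryless h hm]
  refine le_trans (setLIntegral_mono (measurable_reward_integrand hR _) fun u hu => ?_)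
    (setLIntegral_le_lintegral (Set.Ioi h) _)
  rw [stopAt_add (le_of_lt hu)]

namespace TwoBranchModel

variable {Ω : Type*} [MeasurableSpace Ω] {P : Measure Ω} [IsProbabilityMeasure P]
  (m : TwoBranchModel P)

lemma monotone_gain {l : ℝ≥0 → ℝ} (hl : Monotone l) :
    Monotone fun t : ℝ≥0 => m.rate * t + m.slope * l t := fun _ _ hab =>
  add_le_add (mul_le_mul_of_nonneg_left (NNReal.coe_le_coe.2 hab) m.rate_nonneg)
    (mul_le_mul_of_nonneg_left (hl hab) m.slope_pos.le)

lemma level_add (y : ℝ) (f l : ℝ≥0 → ℝ) (h t : ℝ≥0) :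
    m.level y f l (h + t) = m.level (y + m.c₂ * h - m.b₂ * f h - l h) (fun t => f (h + t) - f h)
      (fun t => l (h + t) - l h) t := by
  simp only [level, NNReal.coe_add]
  ring

lemma ruinOf_level_add {y : ℝ} {f l : ℝ≥0 → ℝ} {h : ℝ≥0}
    (hh : (h : ℝ≥0∞) ≤ ruinOf (m.level y f l)) :
    ruinOf (m.level y f l) = h + ruinOf (m.level (y + m.c₂ * h - m.b₂ * f h - l h)
      (fun t => f (h + t) - f h) (fun t => l (h + t) - l h)) := by
  rw [ruinOf_eq_add hh]
  simp_rw [m.level_add]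

/-- The payoff is at most the undiscounted gain up to time `h`, plus the payoff afterwards. -/
lemma pathPayoff_le_add {y : ℝ} {f l : ℝ≥0 → ℝ} (hl : Monotone l) (hl0 : l 0 = 0) (h : ℝ≥0) :
    m.pathPayoff y f l ≤
      ENNReal.ofReal (m.rate * h + m.slope * l (stopAt (ruinOf (m.level y f l)) h)) +
      ENNReal.ofReal (Real.exp (-m.q * h)) * m.pathPayoff (y + m.c₂ * h - m.b₂ * f h - l h)
        (fun t => f (h + t) - f h) (fun t => l (h + t) - l h) := by
  have := isProbabilityMeasure_expTime m.q_pos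
  have hR := m.monotone_gain hl
  rcases le_total (h : ℝ≥0∞) (ruinOf (m.level y f l)) with hh | hh
  · rw [stopAt_of_le hh]
    unfold pathPayoff
    rw [m.ruinOf_level_add hh]
    refine (reward_add_le m.q_pos hR (by simp [hl0]) h _).trans_eq ?_
    congr 3
    ext t
    push_cast
    ring
  -- Ruin before h: the whole payoff is earned by then, and the continuation term is dropped.
  · refine le_trans ?_ le_self_add
    refine (lintegral_mono fun u => ENNReal.ofReal_le_ofReal ?_).trans_eq
      (by rw [lintegral_const, measure_univ, mul_one])
    have h1 : stopAt (ruinOf (m.level y f l)) u ≤ stopAt (ruinOf (m.level y f l)) h := by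
      rw [← ENNReal.coe_le_coe, coe_stopAt _ h, min_eq_right hh]
      exact stopAt_le_right _ _
    have h2 := hR h1
    have h3 : m.rate * (stopAt (ruinOf (m.level y f l)) h : ℝ) ≤ m.rate * h :=
      mul_le_mul_of_nonneg_left (NNReal.coe_le_coe.2 (stopAt_le_left _ _)) m.rate_nonneg
    simp only at h2
    linarith

lemma le_pathPayoff_of_le_ruinOf {y : ℝ} {f l : ℝ≥0 → ℝ} (hl : Monotone l) (hl0 : l 0 = 0) {h : ℝ≥0}
    (hh : (h : ℝ≥0∞) ≤ ruinOf (m.level y f l)) :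
    ENNReal.ofReal (Real.exp (-m.q * h)) * m.pathPayoff (y + m.c₂ * h - m.b₂ * f h - l h)
        (fun t => f (h + t) - f h) (fun t => l (h + t) - l h) ≤ m.pathPayoff y f l := by
  unfold pathPayoff
  rw [m.ruinOf_level_add hh]
  refine le_trans ?_ (le_reward_add (m.monotone_gain hl) h _)
  gcongr
  refine reward_mono fun u => ?_
  have h1 : 0 ≤ l h := hl0 ▸ hl zero_le
  have h2 := mul_nonneg m.slope_pos.le h1
  have h3 := mul_nonneg m.rate_nonneg h.coe_nonneg
  push_cast
  linarith

/-! ### Consequences of the Markov property -/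

/-- The payoff of a strategy restarted at time `h` on an event of the past. -/
lemma setLIntegral_restart (h : ℝ≥0) {D : Set (ℝ≥0 → ℝ)} (hD : MeasurableSet D) (σ : PathStrategy)
    (y : ℝ) :
    ∫⁻ ω in m.pastClaims h ⁻¹' D, m.pathPayoff y (m.futureClaims h ω) (σ.val 0 (m.futureClaims h ω)) ∂P =
      P (m.pastClaims h ⁻¹' D) * m.payoff₂ y (fun t ω => σ.val 0 (m.claims ω) t) := by
  have hF : Measurable fun x : (ℝ≥0 → ℝ) × (ℝ≥0 → ℝ) => m.pathPayoffRat y x.2 (σ.val 0 x.2) :=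
    m.measurable_pathPayoffRat measurable_const
      (fun t => (measurable_pi_apply t).comp measurable_snd)
      (σ.measurable_val.comp ((measurable_const.prodMk (measurable_snd.comp measurable_fst)).prodMk
        measurable_snd))
  have hF' := hF.indicator (hD.prod (MeasurableSet.univ (α := ℝ≥0 → ℝ)))
  have hDm : MeasurableSet (m.pastClaims h ⁻¹' D) := m.measurable_pastClaims h hD
  have hpay : m.payoff₂ y (fun t ω => σ.val 0 (m.claims ω) t) =
      ∫⁻ ω, m.pathPayoffRat y (m.claims ω) (σ.val 0 (m.claims ω)) ∂P := by
    rw [payoff₂_eq (m.isDividendProcess_val σ 0)]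
    refine lintegral_congr_ae ?_
    filter_upwards [m.ae_isRightConst_claims] with ω hω
    exact m.pathPayoff_eq hω (σ.val_mono _ _)
  have hind : ∀ (p f : ℝ≥0 → ℝ), (D ×ˢ Set.univ).indicator
      (fun x : (ℝ≥0 → ℝ) × (ℝ≥0 → ℝ) => m.pathPayoffRat y x.2 (σ.val 0 x.2)) (p, f) =
      D.indicator (fun _ => m.pathPayoffRat y f (σ.val 0 f)) p := by
    intro p f
    by_cases hp : p ∈ D <;> simp [hp]
  calc _ = ∫⁻ ω in m.pastClaims h ⁻¹' D,
        m.pathPayoffRat y (m.futureClaims h ω) (σ.val 0 (m.futureClaims h ω)) ∂P := by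
        refine lintegral_congr_ae (ae_restrict_of_ae ?_)
        filter_upwards [m.ae_isRightConst_futureClaims h] with ω hω
        exact m.pathPayoff_eq hω (σ.val_mono _ _)
    _ = ∫⁻ ω, (D ×ˢ Set.univ).indicator
        (fun x : (ℝ≥0 → ℝ) × (ℝ≥0 → ℝ) => m.pathPayoffRat y x.2 (σ.val 0 x.2))
          (m.pastClaims h ω, m.futureClaims h ω) ∂P := by
        rw [← lintegral_indicator hDm]
        refine lintegral_congr fun ω => ?_
        rw [hind]
        rfl
    _ = ∫⁻ ω, (m.pastClaims h ⁻¹' D).indicator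
        (fun _ => m.payoff₂ y (fun t ω => σ.val 0 (m.claims ω) t)) ω ∂P := by
        rw [m.lintegral_past_future h hF']
        refine lintegral_congr fun ω => ?_
        simp_rw [hind]
        by_cases hp : m.pastClaims h ω ∈ D
        · have hp' : ω ∈ m.pastClaims h ⁻¹' D := hp
          simp only [Set.indicator_of_mem hp, Set.indicator_of_mem hp', hpay]
        · have hp' : ω ∉ m.pastClaims h ⁻¹' D := hp
          simp only [Set.indicator_of_notMem hp, Set.indicator_of_notMem hp', lintegral_zero]
    _ = _ := by
        rw [lintegral_indicator hDm, setLIntegral_const, mul_comm]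

/-- The upper half of the dynamic programming principle at a fixed time. -/
lemma payoff₂_le_dynamic (σ : PathStrategy) (y : ℝ) (h : ℝ≥0) :
    m.payoff₂ y (fun t ω => σ.val 0 (m.claims ω) t) ≤
      ∫⁻ ω, (ENNReal.ofReal (m.rate * h + m.slope * σ.val 0 (m.claims ω)
          (stopAt (ruinOf (m.level y (m.claims ω) (σ.val 0 (m.claims ω)))) h)) +
        ENNReal.ofReal (Real.exp (-m.q * h)) *
          m.valueSup (y + m.c₂ * h - m.b₂ * m.claims ω h - σ.val 0 (m.claims ω) h)) ∂P := by
  have hL := m.isDividendProcess_val σ 0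
  obtain ⟨σ', hσ'⟩ := m.exists_pathStrategy hL σ.bound_mono (fun t ω => σ.val_le _ _ _) h
  set Y : (ℝ≥0 → ℝ) → ℝ := fun p => y + m.c₂ * h - m.b₂ * p h - σ.val 0 p h
  -- The dividends paid after h. The maximum with 0 keeps them nonnegative for every combination of
  -- a past with an independent future, whereas the unmodified difference is only known to be
  -- nonnegative along actual paths.
  set l : (ℝ≥0 → ℝ) × (ℝ≥0 → ℝ) → ℝ≥0 → ℝ := fun x t =>
    max (σ'.val x.1 x.2 t - σ.val 0 x.1 h) 0
  have hlm : ∀ x, Monotone (l x) := fun x s t hst =>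
    max_le_max_right _ (sub_le_sub_right (σ'.val_mono _ _ hst) _)
  have hvm : Measurable fun p : ℝ≥0 → ℝ => σ.val 0 p h :=
    σ.measurable_val.comp ((measurable_const.prodMk measurable_id).prodMk measurable_const)
  have hF : Measurable fun x : (ℝ≥0 → ℝ) × (ℝ≥0 → ℝ) => m.pathPayoffRat (Y x.1) x.2 (l x) := by
    refine m.measurable_pathPayoffRat ?_ (fun t => (measurable_pi_apply t).comp measurable_snd) ?_
    · have h1 : Measurable Y := ((measurable_pi_apply h).const_mul m.b₂ |>.const_sub _).sub hvm
      exact h1.comp measurable_fst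
    · exact (σ'.measurable_val.sub (hvm.comp (measurable_fst.comp measurable_fst))).max measurable_const
  have hpast : ∀ ω, σ.val 0 (m.pastClaims h ω) h = σ.val 0 (m.claims ω) h := fun ω =>
    σ.val_congr fun r hr => by simp [pastClaims, claims, hr.le]
  have hY : ∀ ω, Y (m.pastClaims h ω) =
      y + m.c₂ * h - m.b₂ * m.claims ω h - σ.val 0 (m.claims ω) h := fun ω => by
    simp only [Y, hpast]
    simp [pastClaims, claims]
  have hkey : ∀ᵐ ω ∂P, m.pathPayoff y (m.claims ω) (σ.val 0 (m.claims ω)) ≤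
      ENNReal.ofReal (m.rate * h + m.slope * σ.val 0 (m.claims ω)
          (stopAt (ruinOf (m.level y (m.claims ω) (σ.val 0 (m.claims ω)))) h)) +
        ENNReal.ofReal (Real.exp (-m.q * h)) *
          m.pathPayoffRat (Y (m.pastClaims h ω)) (m.futureClaims h ω)
            (l (m.pastClaims h ω, m.futureClaims h ω)) := by
    filter_upwards [hσ', m.ae_isRightConst_futureClaims h] with ω h1 h2
    have hl : l (m.pastClaims h ω, m.futureClaims h ω) =
        fun t => σ.val 0 (m.claims ω) (h + t) - σ.val 0 (m.claims ω) h := by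
      ext t
      simp only [l, hpast]
      rcases eq_or_ne t 0 with rfl | ht
      · rw [σ'.val_zero, add_zero, sub_self, max_eq_right]
        linarith [σ.val_nonneg 0 (m.claims ω) h]
      · rw [← h1 t (pos_iff_ne_zero.2 ht), max_eq_left]
        linarith [σ.val_mono 0 (m.claims ω) (le_self_add : h ≤ h + t)]
    rw [← m.pathPayoff_eq h2 (hlm _), hl, hY]
    exact m.pathPayoff_le_add (σ.val_mono _ _) (σ.val_zero _ _) h
  rw [payoff₂_eq hL]
  refine (lintegral_mono_ae hkey).trans ?_
  have hm1 : Measurable fun ω => ENNReal.ofReal (Real.exp (-m.q * h)) *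
          m.pathPayoffRat (Y (m.pastClaims h ω)) (m.futureClaims h ω)
            (l (m.pastClaims h ω, m.futureClaims h ω)) :=
    (hF.comp ((m.measurable_pastClaims h).prodMk (m.measurable_futureClaims h))).const_mul _
  rw [lintegral_add_right _ hm1, lintegral_const_mul' _ _ ENNReal.ofReal_ne_top,
    m.lintegral_past_future h hF, ← lintegral_const_mul' _ _ ENNReal.ofReal_ne_top]
  -- Superadditivity of the integral needs no measurability, which is not yet available for
  -- `valueSup` at this stage.
  refine le_trans ?_ (le_lintegral_add _ _)
  gcongr with ω
  rw [← hY]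
  -- With the past frozen, the continuation is an admissible strategy of the problem restarted at
  -- the current level.
  have hdiv : IsDividendProcess m.baseFiltration fun t ω' => l (m.pastClaims h ω, m.claims ω') t :=
    (m.isDividendProcess_val σ' (m.pastClaims h ω)).sub_const_pos (σ.val_nonneg _ _ _)
  refine le_trans (le_of_eq ?_) (payoff₂_le_valueSup hdiv _)
  rw [payoff₂_eq hdiv]
  refine lintegral_congr_ae ?_
  filter_upwards [m.ae_isRightConst_claims] with ω' hω'
  exact (m.pathPayoff_eq hω' (hlm _)).symm

end TwoBranchModel

/-- The exponential clock is almost surely positive, so the value at time 0 plays no role. This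
allows a lump sum at time 0, visible only at positive times, to be treated as a constant. -/
lemma reward_congr_pos {q : ℝ} (hq : 0 < q) {R R' : ℝ≥0 → ℝ} {T : ℝ≥0∞} (hT : 0 < T)
    (h : ∀ t : ℝ≥0, 0 < t → (t : ℝ≥0∞) ≤ T → R t = R' t) : reward q R T = reward q R' T := by
  have := isProbabilityMeasure_expTime hq
  have h0 : ∀ᵐ u ∂(expTime q), u ∈ Set.Ioi (0 : ℝ≥0) := by
    rw [Filter.eventually_mem_set, mem_ae_iff_prob_eq_one measurableSet_Ioi,
      expTime_Ioi hq]
    simp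
  refine lintegral_congr_ae ?_
  filter_upwards [h0] with u hu
  rw [h _ ?_ (stopAt_le_right T u)]
  rw [← ENNReal.coe_pos, coe_stopAt]
  exact lt_min (by exact_mod_cast hu) hT

namespace TwoBranchModel

variable {Ω : Type*} [MeasurableSpace Ω] {P : Measure Ω} [IsProbabilityMeasure P]
  (m : TwoBranchModel P)

/-! ### Probabilities of few claims -/

lemma prob_lt_wait (i : ℕ) (h : ℝ≥0) : P {ω | (h : ℝ) < m.wait i ω} = ENNReal.ofReal (Real.exp (-m.lam * h)) := by
  have h1 : P {ω | (h : ℝ) < m.wait i ω} = (P.map (m.wait i)) (Set.Ioi (h : ℝ)) := by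
    rw [Measure.map_apply (m.measurable_wait i) measurableSet_Ioi]; rfl
  rw [h1, (m.law_wait i).map_eq, expMeasure_Ioi m.lam_pos h.coe_nonneg]

lemma prob_wait_le (i : ℕ) (h : ℝ≥0) : P {ω | m.wait i ω ≤ h} = ENNReal.ofReal (1 - Real.exp (-m.lam * h)) := by
  have h1 : {ω | m.wait i ω ≤ h} = {ω | (h : ℝ) < m.wait i ω}ᶜ := by
    ext ω; simp
  rw [h1, prob_compl_eq_one_sub (measurableSet_lt measurable_const (m.measurable_wait i)),
    m.prob_lt_wait, ENNReal.ofReal_sub _ (Real.exp_nonneg _), ENNReal.ofReal_one]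

lemma prob_two_waits_le (h : ℝ≥0) :
    P ({ω | m.wait 0 ω ≤ h} ∩ {ω | m.wait 1 ω ≤ h}) = ENNReal.ofReal ((1 - Real.exp (-m.lam * h)) ^ 2) := by
  have hi : IndepFun (m.wait 0) (m.wait 1) P :=
    m.indep.indepFun (i := Sum.inl 0) (j := Sum.inl 1) (by simp)
  have := hi.measure_inter_preimage_eq_mul (Set.Iic (h : ℝ)) (Set.Iic (h : ℝ)) measurableSet_Iic measurableSet_Iic
  have hnn : 0 ≤ 1 - Real.exp (-m.lam * h) := by
    rw [sub_nonneg, Real.exp_le_one_iff]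
    have := mul_nonneg m.lam_pos.le h.coe_nonneg
    linarith
  rw [sq, ENNReal.ofReal_mul hnn]
  refine this.trans (congr_arg₂ _ (m.prob_wait_le 0 h) (m.prob_wait_le 1 h))

lemma setLIntegral_claim (h : ℝ≥0) {f : ℝ → ℝ≥0∞} (hf : Measurable f) :
    ∫⁻ ω in {ω | m.wait 0 ω ≤ h}, f (m.claim 0 ω) ∂P =
      ENNReal.ofReal (1 - Real.exp (-m.lam * h)) * ∫⁻ α, f α ∂m.G := by
  have hi : IndepFun (m.wait 0) (m.claim 0) P :=
    m.indep.indepFun (i := Sum.inl 0) (j := Sum.inr 0) (by simp)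
  have hA : MeasurableSet {ω | m.wait 0 ω ≤ h} := measurableSet_le (m.measurable_wait 0) measurable_const
  have hg : Measurable ((Set.Iic (h : ℝ)).indicator (1 : ℝ → ℝ≥0∞)) := measurable_one.indicator measurableSet_Iic
  have h1 := lintegral_mul_eq_lintegral_mul_lintegral_of_indepFun (μ := P)
    (hg.comp (m.measurable_wait 0)) (hf.comp (m.measurable_claim 0)) (hi.comp hg hf)
  rw [← lintegral_indicator hA]
  rw [← (m.law_claim 0).map_eq, lintegral_map hf (m.measurable_claim 0), ← m.prob_wait_le 0 h,
    ← lintegral_indicator_one hA]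
  refine Eq.trans (lintegral_congr fun ω => ?_) (h1.trans rfl)
  by_cases hω : m.wait 0 ω ≤ h <;> simp [Set.indicator, hω]

variable {m}

/-! ### Growth and regularity of the one-dimensional value function -/

lemma valueSup_of_neg {y : ℝ} (hy : y < 0) : m.valueSup y = 0 := by
  refine le_antisymm (iSup₂_le fun L hL => ?_) zero_le
  rw [isAdmissible₂_iff] at hL
  rw [payoff₂_eq hL]
  refine (lintegral_mono_ae ?_).trans_eq lintegral_zero
  filter_upwards [m.ae_isRegularMarks] with ω hω
  have hT : ruinOf (m.level y (m.claims ω) fun t => L t ω) ≤ 0 :=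
    ruinOf_le (t := 0) (by simp [level, hL.zero, claims, totalClaims_eq, hω.claimPath_zero, hy])
  refine (lintegral_mono fun u => ?_).trans_eq lintegral_zero
  have h0 : stopAt (ruinOf (m.level y (m.claims ω) fun t => L t ω)) u = 0 := by
    have := (stopAt_le_right _ u).trans hT
    exact_mod_cast le_antisymm this zero_le
  rw [h0]
  simp [hL.zero]

lemma value₂_of_neg {y : ℝ} (hy : y < 0) : m.value₂ y = 0 := by
  change (m.valueSup y).toReal = 0
  simp [valueSup_of_neg hy]

lemma valueSup_lt_top (y : ℝ) : m.valueSup y ≠ ⊤ := by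
  rcases lt_or_ge y 0 with hy | hy
  · simp [valueSup_of_neg hy]
  · exact valueSup_ne_top hy

lemma valueSup_eq (y : ℝ) : m.valueSup y = ENNReal.ofReal (m.value₂ y) :=
  (ENNReal.ofReal_toReal (valueSup_lt_top y)).symm

/-- Dividends that never exceed initial surplus and premiums do not ruin before the first claim. -/
lemma ruinOf_level_pos {y : ℝ} {e : ℕ ⊕ ℕ → ℝ} (he : IsRegularMarks e) {l : ℝ≥0 → ℝ}
    (hl : ∀ t, l t ≤ y + m.c₂ * t) : 0 < ruinOf (m.level y (claimPath e) l) := by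
  set w : ℝ≥0 := ⟨e (Sum.inl 0), (he.wait_pos 0).le⟩
  have hw : 0 < w := he.wait_pos 0
  refine lt_of_lt_of_le (ENNReal.coe_pos.2 hw) (le_ruinOf fun t ht => ?_)
  by_contra hlt
  have hlt' : (t : ℝ) < e (Sum.inl 0) := by
    have := ENNReal.coe_lt_coe.1 (not_le.1 hlt)
    exact_mod_cast this
  have := hl t
  simp only [level, he.claimPath_of_lt hlt', mul_zero] at ht
  linarith

/-- The strategy that never pays dividends. -/
def _root_.PathStrategy.none : PathStrategy where
  amount := 0
  bound := 0
  measurable_amount _ := measurable_const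
  bound_mono := monotone_const
  bound_zero := le_rfl
  nonneg _ _ := le_rfl
  le_bound _ _ := le_rfl

lemma exists_near_optimal {y : ℝ} (hy : 0 ≤ y) {ε : ℝ} (hε : 0 < ε) :
    ∃ σ : PathStrategy, ENNReal.ofReal (m.value₂ y - ε) ≤ m.payoff₂ y (fun t ω => σ.val 0 (m.claims ω) t) ∧
      ∀ᵐ ω ∂P, ∀ t, σ.val 0 (m.claims ω) t ≤ y + m.c₂ * t := by
  rcases le_or_gt (m.value₂ y - ε) 0 with h | h
  · refine ⟨PathStrategy.none, by simp [ENNReal.ofReal_of_nonpos h], Filter.Eventually.of_forall fun ω t => ?_⟩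
    refine (PathStrategy.val_le _ _ _ _).trans ?_
    exact add_nonneg hy (mul_nonneg m.c₂_pos.le t.coe_nonneg)
  · obtain ⟨σ, h1, h2⟩ := exists_pathStrategy_lt (m := m) hy (a := ENNReal.ofReal (m.value₂ y - ε)) (by
      rw [valueSup_eq]
      exact (ENNReal.ofReal_lt_ofReal_iff (by linarith)).2 (by linarith))
    exact ⟨σ, h1.le, h2⟩

lemma le_value₂ {L : ℝ≥0 → Ω → ℝ} (hL : IsDividendProcess m.baseFiltration L) {y a : ℝ}
    (ha : ENNReal.ofReal a ≤ m.payoff₂ y L) : a ≤ m.value₂ y := by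
  have := ha.trans (payoff₂_le_valueSup hL y)
  rw [valueSup_eq] at this
  exact (ENNReal.ofReal_le_ofReal_iff (value₂_nonneg _)).1 this

/-- A surplus can be paid out at once. -/
lemma value₂_add_le {y δ : ℝ} (hy : 0 ≤ y) (hδ : 0 ≤ δ) :
    m.value₂ y + m.slope * δ ≤ m.value₂ (y + δ) := by
  refine le_of_forall_pos_sub_le fun ε hε => ?_
  obtain ⟨σ, hσ, hσy⟩ := exists_near_optimal (m := m) hy hε
  have hL := (IsDividendProcess.lump (𝓕 := m.baseFiltration) (s := 0) (κ := fun _ => δ) (fun _ => hδ)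
    (C := δ) (fun _ => le_rfl) (@measurable_const _ _ _ (m.baseFiltration 0) _)).add
      (m.isDividendProcess_val σ 0)
  refine le_value₂ hL ?_
  have hkδ : 0 ≤ m.slope * δ := mul_nonneg m.slope_pos.le hδ
  have := isProbabilityMeasure_expTime m.q_pos
  calc ENNReal.ofReal (m.value₂ y + m.slope * δ - ε)
      ≤ ENNReal.ofReal (m.slope * δ) + ENNReal.ofReal (m.value₂ y - ε) := by
        refine le_trans (ENNReal.ofReal_le_ofReal ?_) ENNReal.ofReal_add_le
        linarith
    _ ≤ ENNReal.ofReal (m.slope * δ) + m.payoff₂ y (fun t ω => σ.val 0 (m.claims ω) t) := by gcongr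
    _ = ∫⁻ ω, (ENNReal.ofReal (m.slope * δ) +
          m.pathPayoff y (m.claims ω) (fun t => σ.val 0 (m.claims ω) t)) ∂P := by
        rw [payoff₂_eq (m.isDividendProcess_val σ 0), lintegral_add_left measurable_const,
          lintegral_const, measure_univ, mul_one]
    _ ≤ _ := by
        rw [payoff₂_eq hL]
        refine lintegral_mono_ae ?_
        filter_upwards [hσy, m.ae_isRegularMarks] with ω h1 h2
        have hT := ruinOf_level_pos (m := m) h2 h1
        have hru : ruinOf (m.level (y + δ) (m.claims ω)
            fun t => (if 0 < t then δ else 0) + σ.val 0 (m.claims ω) t) =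
            ruinOf (m.level y (m.claims ω) fun t => σ.val 0 (m.claims ω) t) := by
          unfold ruinOf
          refine iInf_congr fun t => iInf_congr_Prop ?_ fun _ => rfl
          rcases eq_or_ne t 0 with rfl | ht
          · have hc : m.claims ω 0 = 0 := h2.claimPath_zero
            simp only [level, hc, σ.val_zero]
            constructor <;> intro h <;> simp at h <;> linarith
          · simp only [level, if_pos (pos_iff_ne_zero.2 ht)]
            constructor <;> intro h <;> linarith
        unfold pathPayoff
        rw [hru, ← reward_add_const m.q_pos (m.monotone_gain (σ.val_mono _ _)) (by simp [σ.val_zero]) hkδ]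
        refine (reward_congr_pos m.q_pos hT fun t ht _ => ?_).le
        simp only [if_pos ht]
        ring

lemma value₂_mono : Monotone m.value₂ := by
  intro a b hab
  rcases lt_or_ge a 0 with ha | ha
  · rw [value₂_of_neg ha]
    exact value₂_nonneg _
  · have h1 := value₂_add_le (m := m) ha (sub_nonneg.2 hab)
    have h2 := mul_nonneg m.slope_pos.le (sub_nonneg.2 hab)
    rw [add_sub_cancel] at h1
    linarith

lemma value₂_le {y : ℝ} (hy : 0 ≤ y) : m.value₂ y ≤ m.slope * y + (m.c₁ + m.c₂) / m.q := by
  have h := valueSup_le (m := m) hy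
  rw [valueSup_eq] at h
  refine (ENNReal.ofReal_le_ofReal_iff ?_).1 h
  exact add_nonneg (mul_nonneg m.slope_pos.le hy) (div_nonneg (add_pos m.c₁_pos m.c₂_pos).le m.q_pos.le)

lemma preimage_pastClaims (h : ℝ≥0) (s : Set ℝ) :
    {ω | m.totalClaims h ω ∈ s} = m.pastClaims h ⁻¹' {p | p h ∈ s} := by
  ext ω
  simp [pastClaims]

/-- Waiting until the time `h` without claims. -/
lemma exp_mul_value₂_le {y : ℝ} (hy : 0 ≤ y) (h : ℝ≥0) :
    Real.exp (-(m.lam + m.q) * h) * m.value₂ (y + m.c₂ * h) ≤ m.value₂ y := by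
  have hch := mul_nonneg m.c₂_pos.le h.coe_nonneg
  refine le_of_forall_pos_sub_le fun ε hε => ?_
  obtain ⟨σ, hσ, -⟩ := exists_near_optimal (m := m) (add_nonneg hy hch) hε
  -- The event is formulated through the total claims, so that it is observable at time h; it
  -- contains almost surely the event that the first waiting time exceeds h.
  set D : Set Ω := {ω | m.totalClaims h ω ∈ ({0} : Set ℝ)}
  have hD : MeasurableSet[m.baseFiltration h] D :=
    m.measurable_totalClaims_base le_rfl (measurableSet_singleton 0)
  have hL := m.isDividendProcess_restart σ h hD
  refine le_value₂ hL ?_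
  have hPD : ENNReal.ofReal (Real.exp (-m.lam * h)) ≤ P D := by
    rw [← m.prob_lt_wait 0]
    refine measure_mono_ae ?_
    filter_upwards [m.ae_isRegularMarks] with ω hω hωh
    exact hω.claimPath_of_lt hωh
  have hpath : ∀ᵐ ω ∂P, D.indicator (fun ω => ENNReal.ofReal (Real.exp (-m.q * h)) *
      m.pathPayoff (y + m.c₂ * h) (m.futureClaims h ω) (σ.val 0 (m.futureClaims h ω))) ω ≤
      m.pathPayoff y (m.claims ω)
        (fun t => D.indicator (fun ω => σ.val 0 (m.futureClaims h ω) (t - h)) ω) := by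
    filter_upwards [m.ae_isRegularMarks] with ω hω
    by_cases hωD : ω ∈ D
    · have hc0 : m.claims ω h = 0 := hωD
      simp only [Set.indicator_of_mem hωD]
      have hτ : (h : ℝ≥0∞) ≤
          ruinOf (m.level y (m.claims ω) fun t => σ.val 0 (m.futureClaims h ω) (t - h)) := by
        refine le_ruinOf fun t ht => ?_
        by_contra hlt
        have hlt' : t < h := ENNReal.coe_lt_coe.1 (not_le.1 hlt)
        have h1 : m.claims ω t ≤ m.claims ω h := hω.claimPath_mono hlt'.le
        simp only [level, tsub_eq_zero_of_le hlt'.le, σ.val_zero] at ht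
        have h2 : m.b₂ * m.claims ω t ≤ 0 := mul_nonpos_of_nonneg_of_nonpos m.b₂_pos.le (by linarith)
        have h3 := mul_nonneg m.c₂_pos.le t.coe_nonneg
        linarith
      refine le_trans (le_of_eq ?_) (m.le_pathPayoff_of_le_ruinOf
        (fun a b hab => σ.val_mono _ _ (tsub_le_tsub_right hab h)) (by simp [σ.val_zero]) hτ)
      rw [show (fun t => m.claims ω (h + t) - m.claims ω h) = m.futureClaims h ω from rfl]
      simp only [hc0, tsub_self, σ.val_zero, add_tsub_cancel_left, mul_zero, sub_zero]
    · simp [Set.indicator_of_notMem hωD]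
  have hDm : MeasurableSet D := m.baseFiltration.le h _ hD
  have hD0 : D = m.pastClaims h ⁻¹' {p | p h ∈ ({0} : Set ℝ)} := preimage_pastClaims h _
  rw [payoff₂_eq hL]
  refine le_trans ?_ (lintegral_mono_ae hpath)
  have hD1 : MeasurableSet {p : ℝ≥0 → ℝ | p h ∈ ({0} : Set ℝ)} :=
    (measurable_pi_apply h) (measurableSet_singleton 0)
  rw [lintegral_indicator hDm, lintegral_const_mul' _ _ ENNReal.ofReal_ne_top, hD0,
    m.setLIntegral_restart h hD1, ← hD0]
  calc ENNReal.ofReal (Real.exp (-(m.lam + m.q) * h) * m.value₂ (y + m.c₂ * h) - ε)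
      ≤ ENNReal.ofReal (Real.exp (-m.q * h) * (Real.exp (-m.lam * h) * (m.value₂ (y + m.c₂ * h) - ε))) := by
        refine ENNReal.ofReal_le_ofReal ?_
        have h1 : Real.exp (-(m.lam + m.q) * h) = Real.exp (-m.q * h) * Real.exp (-m.lam * h) := by
          rw [← Real.exp_add]; congr 1; ring
        have h2 : Real.exp (-(m.lam + m.q) * h) ≤ 1 := by
          rw [Real.exp_le_one_iff]
          have := mul_nonneg (add_pos m.lam_pos m.q_pos).le h.coe_nonneg
          linarith
        rw [← mul_assoc, ← h1, mul_sub]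
        nlinarith
    _ ≤ _ := by
        rw [ENNReal.ofReal_mul (Real.exp_nonneg _), ENNReal.ofReal_mul (Real.exp_nonneg _)]
        gcongr

/-- Premiums raise the surplus from a to b within time (b - a)/c₂. Waiting for this loses at most
the probability of a claim and the discount, estimated by e^{-x} ≥ 1 - x. -/
lemma value₂_sub_le {a b : ℝ} (ha : 0 ≤ a) (hab : a ≤ b) :
    m.value₂ b - m.value₂ a ≤ (m.lam + m.q) / m.c₂ * m.value₂ b * (b - a) := by
  have hh : 0 ≤ (b - a) / m.c₂ := div_nonneg (sub_nonneg.2 hab) m.c₂_pos.le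
  have h := exp_mul_value₂_le (m := m) ha ⟨(b - a) / m.c₂, hh⟩
  change Real.exp (-(m.lam + m.q) * ((b - a) / m.c₂)) *
    m.value₂ (a + m.c₂ * ((b - a) / m.c₂)) ≤ m.value₂ a at h
  rw [mul_div_cancel₀ _ m.c₂_pos.ne', add_sub_cancel] at h
  have h1 := Real.add_one_le_exp (-(m.lam + m.q) * ((b - a) / m.c₂))
  have h2 := mul_le_mul_of_nonneg_right h1 (value₂_nonneg (m := m) b)
  have h3 : (m.lam + m.q) / m.c₂ * m.value₂ b * (b - a) =
    (m.lam + m.q) * ((b - a) / m.c₂) * m.value₂ b := by ring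
  rw [h3]
  linarith

lemma lipschitzOnWith_value₂ (R : ℝ) :
    LipschitzOnWith ((m.lam + m.q) / m.c₂ * m.value₂ R).toNNReal m.value₂ (Set.Icc 0 R) := by
  refine LipschitzOnWith.of_le_add_mul' _ fun a ha b hb => ?_
  have hc : 0 ≤ (m.lam + m.q) / m.c₂ := div_nonneg (add_pos m.lam_pos m.q_pos).le m.c₂_pos.le
  have h2 : 0 ≤ (m.lam + m.q) / m.c₂ * m.value₂ R * dist a b :=
    mul_nonneg (mul_nonneg hc (value₂_nonneg _)) dist_nonneg
  rcases le_total a b with hab | hab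
  · have := value₂_mono (m := m) hab
    linarith
  · have h3 := value₂_sub_le (m := m) hb.1 hab
    have h4 := mul_le_mul_of_nonneg_right (mul_le_mul_of_nonneg_left (value₂_mono (m := m) ha.2) hc)
      (sub_nonneg.2 hab)
    rw [Real.dist_eq, abs_of_nonneg (sub_nonneg.2 hab)]
    linarith

lemma continuousOn_value₂ : ContinuousOn m.value₂ (Set.Ici 0) := by
  intro y hy
  refine ((lipschitzOnWith_value₂ (y + 1)).continuousOn y ⟨hy, by linarith⟩).mono_of_mem_nhdsWithin ?_
  exact mem_nhdsWithin.2 ⟨Set.Iio (y + 1), isOpen_Iio, by simp, fun z hz => ⟨hz.2, (Set.mem_Iio.1 hz.1).le⟩⟩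

/-! ### The value after a claim and the continuity of Λ -/

variable (m) in
/-- The expected value after one claim at the level `z`. -/
def claimValue (z : ℝ) : ℝ := ∫ α, m.value₂ (z - m.b₂ * α) ∂m.G

/-- W vanishes at negative levels, so the claims that cause ruin may be included in the integral. -/
lemma premiumOperator_eq (y : ℝ) : m.premiumOperator y =
    m.c₁ + m.c₂ - (m.lam + m.q) * m.value₂ y + m.lam * m.claimValue y := by
  unfold premiumOperator claimValue
  rw [setIntegral_eq_integral_of_ae_compl_eq_zero]
  filter_upwards [m.G_nonneg] with α hα hα'
  refine value₂_of_neg ?_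
  have : y / m.b₂ < α := by
    by_contra h
    exact hα' ⟨hα, not_lt.1 h⟩
  rw [div_lt_iff₀ m.b₂_pos] at this
  linarith

lemma measurable_value₂ : Measurable m.value₂ := value₂_mono.measurable

lemma integrable_claimValue (z : ℝ) : Integrable (fun α => m.value₂ (z - m.b₂ * α)) m.G := by
  refine Integrable.of_bound (C := m.value₂ z)
    (measurable_value₂.comp (measurable_const.sub (measurable_id.const_mul _))).aestronglyMeasurable ?_
  filter_upwards [m.G_nonneg] with α hα
  rw [Real.norm_of_nonneg (value₂_nonneg _)]
  exact value₂_mono (by linarith [mul_nonneg m.b₂_pos.le hα])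

lemma claimValue_nonneg (z : ℝ) : 0 ≤ m.claimValue z := integral_nonneg fun _ => value₂_nonneg _

lemma ofReal_claimValue (z : ℝ) :
    ENNReal.ofReal (m.claimValue z) = ∫⁻ α, m.valueSup (z - m.b₂ * α) ∂m.G := by
  rw [claimValue, ofReal_integral_eq_lintegral_ofReal (integrable_claimValue z)
    (Filter.Eventually.of_forall fun _ => value₂_nonneg _)]
  simp_rw [← valueSup_eq]

lemma continuousAt_value₂ {z : ℝ} (hz : z ≠ 0) : ContinuousAt m.value₂ z := by
  rcases hz.lt_or_gt with h | h
  · refine (continuousAt_const (y := (0 : ℝ))).congr ?_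
    filter_upwards [gt_mem_nhds h] with x hx using (value₂_of_neg hx).symm
  · exact continuousOn_value₂.continuousAt (Ici_mem_nhds h)

/-- W may jump at 0, but only one claim size leads from z exactly to 0, and an absolutely continuous
law gives it no mass. Dominated convergence applies. -/
lemma continuous_claimValue : Continuous m.claimValue := by
  refine continuous_iff_continuousAt.2 fun z => ?_
  have hmeas : ∀ x, AEStronglyMeasurable (fun α => m.value₂ (x - m.b₂ * α)) m.G := fun x =>
    (integrable_claimValue x).aestronglyMeasurable
  refine continuousAt_of_dominated (bound := fun _ => m.value₂ (z + 1)) (Filter.Eventually.of_forall hmeas)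
    ?_ (integrable_const _) ?_
  · filter_upwards [gt_mem_nhds (lt_add_one z)] with x hx
    filter_upwards [m.G_nonneg] with α hα
    rw [Real.norm_of_nonneg (value₂_nonneg _)]
    exact value₂_mono (by linarith [mul_nonneg m.b₂_pos.le hα])
  · have hne : ∀ᵐ α ∂m.G, α ≠ z / m.b₂ := by
      rw [ae_iff]
      simpa using m.G_absCont (Real.volume_singleton (a := z / m.b₂))
    filter_upwards [hne] with α hα
    have : z - m.b₂ * α ≠ 0 := fun h => hα (by field_simp [m.b₂_pos.ne']; linarith)
    exact (continuousAt_value₂ this).comp (f := fun x => x - m.b₂ * α) (by fun_prop)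

lemma continuousOn_premiumOperator : ContinuousOn m.premiumOperator (Set.Ici 0) := by
  have : m.premiumOperator = fun y => m.c₁ + m.c₂ - (m.lam + m.q) * m.value₂ y + m.lam * m.claimValue y :=
    funext premiumOperator_eq
  rw [this]
  exact (continuousOn_const.sub (continuousOn_const.mul continuousOn_value₂)).add
    (continuousOn_const.mul continuous_claimValue.continuousOn)

end TwoBranchModel

namespace TwoBranchModel

variable {Ω : Type*} [MeasurableSpace Ω] {P : Measure Ω} [IsProbabilityMeasure P]
  (m : TwoBranchModel P)

/-! ### The half line problem in terms of the one-dimensional problem -/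

/-- The second coordinate of the point of the half line to which the surplus `x` is brought. -/
def base (x : ℝ × ℝ) : ℝ := min x.2 (m.b₂ / m.b₁ * x.1)

variable {m}

lemma ratio_mul : m.b₁ / m.b₂ * (m.b₂ / m.b₁) = 1 := by
  have := m.b₁_pos.ne'
  have := m.b₂_pos.ne'
  field_simp

lemma ratio_mul_b₂ : m.b₁ / m.b₂ * m.b₂ = m.b₁ := div_mul_cancel₀ _ m.b₂_pos.ne'

lemma base_nonneg {x : ℝ × ℝ} (hx : x ∈ closedQuadrant) : 0 ≤ m.base x :=
  le_min hx.2 (mul_nonneg (div_pos m.b₂_pos m.b₁_pos).le hx.1)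

lemma ratio_mul_base_le (x : ℝ × ℝ) : m.b₁ / m.b₂ * m.base x ≤ x.1 := by
  have h := mul_le_mul_of_nonneg_left (min_le_right x.2 (m.b₂ / m.b₁ * x.1)) m.ratio_pos.le
  rwa [← mul_assoc, ratio_mul, one_mul] at h

lemma base_le (x : ℝ × ℝ) : m.base x ≤ x.2 := min_le_left _ _

lemma base_of_le {x : ℝ × ℝ} (h : m.b₂ / m.b₁ * x.1 ≤ x.2) : m.base x = m.b₂ / m.b₁ * x.1 := min_eq_right h

lemma ruinTime_eq (x : ℝ × ℝ) (L₁ L₂ : ℝ≥0 → Ω → ℝ) (ω : Ω) : m.ruinTime x L₁ L₂ ω =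
    ⨅ (t : ℝ≥0) (_ : x.1 + m.c₁ * t - m.b₁ * m.claims ω t - L₁ t ω < 0 ∨
      x.2 + m.c₂ * t - m.b₂ * m.claims ω t - L₂ t ω < 0), (t : ℝ≥0∞) := rfl

/-- Membership in 𝓜 expresses the first dividends through the second: L₁ = x₁ - κx₂ + rate·t + κL₂.
Total dividends are thus an initial lump sum plus the gain of the one-dimensional problem for L₂
without its initial payment. -/
lemma IsHalfLineStrategy.payoff_le {x : ℝ × ℝ} (hx : x ∈ closedQuadrant) {L₁ L₂ : ℝ≥0 → Ω → ℝ}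
    (hL : m.IsHalfLineStrategy x L₁ L₂) :
    m.payoff x L₁ L₂ ≤
      ENNReal.ofReal (x.1 + x.2 - m.slope * m.base x) + m.valueSup (m.base x) := by
  obtain ⟨h₁, h₂⟩ := isAdmissible_iff.1 hL.admissible
  have hℓ₂ : 0 ≤ x.2 - m.base x := sub_nonneg.2 (base_le (m := m) x)
  have hℓ : 0 ≤ x.1 + x.2 - m.slope * m.base x := by
    have := ratio_mul_base_le (m := m) x
    unfold slope
    linarith
  have hL' := h₂.sub_const_pos hℓ₂
  have := isProbabilityMeasure_expTime m.q_pos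
  rw [payoff_eq h₁ h₂]
  have hpath : ∀ᵐ ω ∂P, reward m.q (fun t => L₁ t ω + L₂ t ω) (m.ruinTime x L₁ L₂ ω) ≤
      ENNReal.ofReal (x.1 + x.2 - m.slope * m.base x) +
        m.pathPayoff (m.base x) (m.claims ω) (fun t => max (L₂ t ω - (x.2 - m.base x)) 0) := by
    filter_upwards [hL.initial_payment, hL.mem_halfLine, m.ae_isRegularMarks] with ω hi hm hω
    have hc0 : m.claims ω 0 = 0 := hω.claimPath_zero
    have hge : ∀ t : ℝ≥0, 0 < t → x.2 - m.base x ≤ L₂ t ω := fun t ht => by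
      unfold base
      rcases min_cases x.2 (m.b₂ / m.b₁ * x.1) with ⟨h, -⟩ | ⟨h, -⟩ <;> rw [h]
      · simpa using h₂.nonneg t ω
      · exact (hi t ht).2
    have hT : m.ruinTime x L₁ L₂ ω ≤ ruinOf (m.level (m.base x) (m.claims ω)
        fun t => max (L₂ t ω - (x.2 - m.base x)) 0) := by
      refine le_ruinOf fun t ht => ?_
      rcases eq_or_ne t 0 with rfl | ht0
      · simp only [level, hc0, h₂.zero] at ht
        rw [max_eq_right (by linarith)] at ht
        simp at ht
        linarith [base_nonneg (m := m) hx]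
      · have hge' := hge t (pos_iff_ne_zero.2 ht0)
        refine iInf₂_le t (Or.inr ?_)
        simp only [level] at ht
        rw [max_eq_left (by linarith)] at ht
        change x.2 + m.c₂ * t - m.b₂ * m.claims ω t - L₂ t ω < 0
        linarith
    have hsum : ∀ t : ℝ≥0, 0 < t → (t : ℝ≥0∞) ≤ m.ruinTime x L₁ L₂ ω → L₁ t ω + L₂ t ω =
        (x.1 + x.2 - m.slope * m.base x) + (m.rate * t + m.slope * max (L₂ t ω - (x.2 - m.base x)) 0) := by
      intro t ht htT
      have hlt : ∀ s : ℝ≥0, 0 < s → (s : ℝ≥0∞) < m.ruinTime x L₁ L₂ ω →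
          L₁ s ω = x.1 - m.b₁ / m.b₂ * x.2 + m.rate * s + m.b₁ / m.b₂ * L₂ s ω := by
        intro s hs hsT
        have h := (hm s hs hsT).2.2
        change x.2 + m.c₂ * s - m.b₂ * m.claims ω s - L₂ s ω =
          m.b₂ / m.b₁ * (x.1 + m.c₁ * s - m.b₁ * m.claims ω s - L₁ s ω) at h
        have h' := congrArg (fun z => m.b₁ / m.b₂ * z) h
        rw [← mul_assoc (m.b₁ / m.b₂) (m.b₂ / m.b₁), ratio_mul, one_mul] at h'
        have hb := ratio_mul_b₂ (m := m)
        have hb' : m.b₁ / m.b₂ * (m.b₂ * m.claims ω s) = m.b₁ * m.claims ω s := by rw [← mul_assoc, hb]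
        unfold rate
        linarith
      -- The relation is extended from the times before ruin to the ruin time itself by left limits.
      have heq : L₁ t ω = x.1 - m.b₁ / m.b₂ * x.2 + m.rate * t + m.b₁ / m.b₂ * L₂ t ω := by
        have hne : (nhdsWithin t (Set.Iio t)).NeBot := nhdsLT_neBot_of_exists_lt ⟨0, ht⟩
        have hl₁ := (h₁.leftCont ω t).mono_left (nhdsWithin_mono t Set.Iio_subset_Iic_self)
        have hl₂ := (h₂.leftCont ω t).mono_left (nhdsWithin_mono t Set.Iio_subset_Iic_self)
        have hid : Filter.Tendsto (fun s : ℝ≥0 => (s : ℝ)) (nhdsWithin t (Set.Iio t)) (nhds (t : ℝ)) :=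
          (NNReal.continuous_coe.tendsto t).mono_left nhdsWithin_le_nhds
        refine tendsto_nhds_unique_of_eventuallyEq hl₁
          (((hid.const_mul m.rate).const_add _).add (hl₂.const_mul _)) ?_
        have hpos : ∀ᶠ s in nhdsWithin t (Set.Iio t), 0 < s := mem_nhdsWithin_of_mem_nhds (lt_mem_nhds ht)
        filter_upwards [self_mem_nhdsWithin, hpos] with s hs hs0
        exact hlt s hs0 (lt_of_lt_of_le (by exact_mod_cast hs) htT)
      rw [max_eq_left (by linarith [hge t ht]), heq]
      unfold slope
      ring
    unfold pathPayoff
    rw [← reward_add_const m.q_pos (m.monotone_gain (hL'.mono ω)) (by simp [hL'.zero ω]) hℓ]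
    refine reward_mono fun u => ?_
    have hmono := stopAt_mono_left hT u
    have h4 := m.monotone_gain (hL'.mono ω) hmono
    have h5 := m.monotone_gain (hL'.mono ω) (zero_le (a := stopAt (ruinOf (m.level (m.base x) (m.claims ω)
        fun t => max (L₂ t ω - (x.2 - m.base x)) 0)) u))
    simp only [hL'.zero ω, NNReal.coe_zero, mul_zero, add_zero] at h4 h5
    rcases eq_or_ne (stopAt (m.ruinTime x L₁ L₂ ω) u) 0 with h0 | h0
    · rw [h0, h₁.zero, h₂.zero]
      linarith
    · rw [hsum _ (pos_iff_ne_zero.2 h0) (stopAt_le_right _ _)]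
      linarith
  refine (lintegral_mono_ae hpath).trans ?_
  rw [lintegral_add_left measurable_const, lintegral_const, measure_univ, mul_one, ← payoff₂_eq hL']
  gcongr
  exact payoff₂_le_valueSup hL' _

/-- A near-optimal one-dimensional strategy becomes a half line strategy if the first branch pays κ
times the same dividends and its excess premiums. The first surplus is then κ times the second, so
both are ruined together. -/
lemma exists_halfLineStrategy {x : ℝ × ℝ} (hx : x ∈ closedQuadrant) {ε : ℝ} (hε : 0 < ε) :
    ∃ L₁ L₂, m.IsHalfLineStrategy x L₁ L₂ ∧
      ENNReal.ofReal (x.1 + x.2 - m.slope * m.base x + m.value₂ (m.base x) - ε) ≤ m.payoff x L₁ L₂ := by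
  obtain ⟨σ, hσ, hσy⟩ := exists_near_optimal (m := m) (base_nonneg (m := m) hx) hε
  have hκ := m.ratio_pos
  have hℓ₂ : 0 ≤ x.2 - m.base x := sub_nonneg.2 (base_le (m := m) x)
  have hℓ₁ : 0 ≤ x.1 - m.b₁ / m.b₂ * m.base x := sub_nonneg.2 (ratio_mul_base_le (m := m) x)
  have hℓ : 0 ≤ x.1 + x.2 - m.slope * m.base x := by
    unfold slope
    linarith
  have hlump : ∀ {δ : ℝ}, 0 ≤ δ → IsDividendProcess m.baseFiltration
      fun (t : ℝ≥0) (_ : Ω) => if 0 < t then δ else 0 := fun {δ} hδ =>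
    IsDividendProcess.lump (s := 0) (κ := fun _ => δ) (fun _ => hδ) (C := δ) (fun _ => le_rfl)
      (@measurable_const _ _ _ (m.baseFiltration 0) _)
  have hv := m.isDividendProcess_val σ 0
  have hid : IsDividendProcess m.baseFiltration fun (t : ℝ≥0) (_ : Ω) => m.rate * (t : ℝ) :=
    IsDividendProcess.of_path (v := fun t : ℝ≥0 => m.rate * (t : ℝ))
      (fun a b hab => mul_le_mul_of_nonneg_left (NNReal.coe_le_coe.2 hab) m.rate_nonneg)
      (fun t => Continuous.continuousWithinAt (by fun_prop)) (by simp)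
  have h₁ := ((hlump hℓ₁).add hid).add (hv.const_mul hκ.le)
  have h₂ := (hlump hℓ₂).add hv
  set L₁ : ℝ≥0 → Ω → ℝ := fun t ω => (if 0 < t then x.1 - m.b₁ / m.b₂ * m.base x else 0) +
    m.rate * (t : ℝ) + m.b₁ / m.b₂ * σ.val 0 (m.claims ω) t
  set L₂ : ℝ≥0 → Ω → ℝ := fun t ω => (if 0 < t then x.2 - m.base x else 0) + σ.val 0 (m.claims ω) t
  have hs₂ : ∀ ω (t : ℝ≥0), 0 < t → x.2 + m.c₂ * t - m.b₂ * m.claims ω t - L₂ t ω =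
      m.level (m.base x) (m.claims ω) (σ.val 0 (m.claims ω)) t := by
    intro ω t ht
    simp only [L₂, if_pos ht, level]
    ring
  have hs₁ : ∀ ω (t : ℝ≥0), 0 < t → x.1 + m.c₁ * t - m.b₁ * m.claims ω t - L₁ t ω =
      m.b₁ / m.b₂ * m.level (m.base x) (m.claims ω) (σ.val 0 (m.claims ω)) t := by
    intro ω t ht
    simp only [L₁, if_pos ht, level, rate]
    have hb' : m.b₁ / m.b₂ * (m.b₂ * m.claims ω t) = m.b₁ * m.claims ω t := by
      rw [← mul_assoc, ratio_mul_b₂]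
    linarith
  have hT : ∀ ω, IsRegularMarks (m.marks ω) → m.ruinTime x L₁ L₂ ω =
      ruinOf (m.level (m.base x) (m.claims ω) (σ.val 0 (m.claims ω))) := by
    intro ω hω
    have hc0 : m.claims ω 0 = 0 := hω.claimPath_zero
    rw [ruinTime_eq]
    unfold ruinOf
    refine iInf_congr fun t => iInf_congr_Prop ?_ fun _ => rfl
    rcases eq_or_ne t 0 with rfl | ht
    · rw [h₁.zero ω, h₂.zero ω, hc0]
      simp only [level, hc0, σ.val_zero]
      simp only [NNReal.coe_zero, mul_zero, add_zero, sub_zero]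
      refine ⟨fun h => ?_, fun h => absurd h (not_lt.2 (base_nonneg hx))⟩
      rcases h with h | h
      · exact absurd h (not_lt.2 hx.1)
      · exact absurd h (not_lt.2 hx.2)
    · have ht := pos_iff_ne_zero.2 ht
      rw [hs₁ ω t ht, hs₂ ω t ht]
      refine ⟨fun h => h.elim (fun h => ?_) id, Or.inr⟩
      exact not_le.1 fun h' => h.not_ge (mul_nonneg hκ.le h')
  refine ⟨L₁, L₂, ⟨isAdmissible_iff.2 ⟨h₁, h₂⟩, ?_, ?_⟩, ?_⟩
  · refine Filter.Eventually.of_forall fun ω t ht => ?_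
    have hvn := σ.val_nonneg 0 (m.claims ω) t
    simp only [L₁, L₂, if_pos ht]
    constructor
    · have h1 := mul_le_mul_of_nonneg_left (base_le (m := m) x) hκ.le
      have h2 := mul_nonneg m.rate_nonneg t.coe_nonneg
      have h3 := mul_nonneg hκ.le hvn
      linarith
    · have h1 : m.base x ≤ m.b₂ / m.b₁ * x.1 := min_le_right _ _
      linarith
  · filter_upwards [m.ae_isRegularMarks] with ω hω t ht htT
    have hlev : 0 ≤ m.level (m.base x) (m.claims ω) (σ.val 0 (m.claims ω)) t := by
      rw [hT ω hω] at htT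
      exact nonneg_of_lt_ruinOf htT
    change (x.1 + m.c₁ * t - m.b₁ * m.claims ω t - L₁ t ω,
      x.2 + m.c₂ * t - m.b₂ * m.claims ω t - L₂ t ω) ∈ m.halfLine
    rw [hs₁ ω t ht, hs₂ ω t ht]
    refine ⟨mul_nonneg hκ.le hlev, hlev, ?_⟩
    rw [← mul_assoc, mul_comm (m.b₂ / m.b₁), ratio_mul, one_mul]
  · have := isProbabilityMeasure_expTime m.q_pos
    calc ENNReal.ofReal (x.1 + x.2 - m.slope * m.base x + m.value₂ (m.base x) - ε)
        ≤ ENNReal.ofReal (x.1 + x.2 - m.slope * m.base x) + ENNReal.ofReal (m.value₂ (m.base x) - ε) := by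
          refine le_trans (ENNReal.ofReal_le_ofReal ?_) ENNReal.ofReal_add_le
          linarith
      _ ≤ ENNReal.ofReal (x.1 + x.2 - m.slope * m.base x) +
          m.payoff₂ (m.base x) (fun t ω => σ.val 0 (m.claims ω) t) := by gcongr
      _ = ∫⁻ ω, (ENNReal.ofReal (x.1 + x.2 - m.slope * m.base x) +
          m.pathPayoff (m.base x) (m.claims ω) (fun t => σ.val 0 (m.claims ω) t)) ∂P := by
          rw [payoff₂_eq hv, lintegral_add_left measurable_const, lintegral_const, measure_univ, mul_one]
      _ = m.payoff x L₁ L₂ := by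
          rw [payoff_eq h₁ h₂]
          refine lintegral_congr_ae ?_
          filter_upwards [hσy, m.ae_isRegularMarks] with ω h1 h2
          rw [hT ω h2]
          unfold pathPayoff
          rw [← reward_add_const m.q_pos (m.monotone_gain (σ.val_mono _ _)) (by simp [σ.val_zero]) hℓ]
          refine reward_congr_pos m.q_pos (ruinOf_level_pos h2 h1) fun t ht _ => ?_
          simp only [L₁, L₂, if_pos ht, slope]
          ring

/-- The half line value in terms of the one-dimensional value function. -/
lemma halfLineValue_eq {x : ℝ × ℝ} (hx : x ∈ closedQuadrant) :
    m.halfLineValue x = x.1 + x.2 - m.slope * m.base x + m.value₂ (m.base x) := by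
  have hℓ : 0 ≤ x.1 + x.2 - m.slope * m.base x := by
    have := ratio_mul_base_le (m := m) x
    have := base_le (m := m) x
    unfold slope
    linarith
  set A := ⨆ (L : (ℝ≥0 → Ω → ℝ) × (ℝ≥0 → Ω → ℝ)) (_ : m.IsHalfLineStrategy x L.1 L.2), m.payoff x L.1 L.2
  have hA : A ≤ ENNReal.ofReal (x.1 + x.2 - m.slope * m.base x + m.value₂ (m.base x)) := by
    refine iSup₂_le fun L hL => ?_
    rw [ENNReal.ofReal_add hℓ (value₂_nonneg _), ← valueSup_eq]
    exact hL.payoff_le hx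
  have hAtop : A ≠ ⊤ := ne_top_of_le_ne_top ENNReal.ofReal_ne_top hA
  change A.toReal = _
  refine le_antisymm (ENNReal.toReal_le_of_le_ofReal (add_nonneg hℓ (value₂_nonneg _)) hA) ?_
  refine le_of_forall_pos_sub_le fun ε hε => ?_
  obtain ⟨L₁, L₂, hL, hp⟩ := exists_halfLineStrategy (m := m) hx hε
  refine (ENNReal.ofReal_le_iff_le_toReal hAtop).1 (hp.trans ?_)
  exact le_iSup₂ (f := fun (L : (ℝ≥0 → Ω → ℝ) × (ℝ≥0 → Ω → ℝ)) (_ : m.IsHalfLineStrategy x L.1 L.2) =>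
    m.payoff x L.1 L.2) (L₁, L₂) hL

/-! ### Local Lipschitz continuity of Ṽ and finiteness of V -/

lemma openQuadrant_subset_closedQuadrant : openQuadrant ⊆ closedQuadrant :=
  fun _ hx => ⟨hx.1.le, hx.2.le⟩

variable (m) in
lemma locallyLipschitzOn_halfLineValue : LocallyLipschitzOn openQuadrant m.halfLineValue := by
  have hbase : LipschitzWith (max 1 ‖m.b₂ / m.b₁‖₊) m.base := by
    have h1 : LipschitzWith 1 (Prod.snd : ℝ × ℝ → ℝ) := LipschitzWith.prod_snd
    have h2 : LipschitzWith (‖m.b₂ / m.b₁‖₊ * 1) fun x : ℝ × ℝ => m.b₂ / m.b₁ * x.1 :=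
      (lipschitzWith_smul (m.b₂ / m.b₁)).comp LipschitzWith.prod_fst
    rw [mul_one] at h2
    exact h1.min h2
  have hlin : LipschitzWith (1 + 1 + ‖m.slope‖₊ * max 1 ‖m.b₂ / m.b₁‖₊)
      fun x : ℝ × ℝ => x.1 + x.2 - m.slope * m.base x :=
    (LipschitzWith.prod_fst.add LipschitzWith.prod_snd).sub ((lipschitzWith_smul m.slope).comp hbase)
  have hW : LocallyLipschitzOn openQuadrant fun x => m.value₂ (m.base x) := by
    intro x hx
    refine ⟨_, openQuadrant ∩ {x' | x'.2 < x.2 + 1}, Filter.inter_mem self_mem_nhdsWithin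
      (mem_nhdsWithin_of_mem_nhds ((isOpen_lt continuous_snd continuous_const).mem_nhds
        (show x.2 < x.2 + 1 by linarith))),
      (lipschitzOnWith_value₂ (x.2 + 1)).comp hbase.lipschitzOnWith fun x' hx' => ?_⟩
    exact ⟨base_nonneg (openQuadrant_subset_closedQuadrant hx'.1), (base_le x').trans (le_of_lt hx'.2)⟩
  have hsum := (hlin.locallyLipschitz.locallyLipschitzOn (s := openQuadrant)).add hW
  intro x hx
  obtain ⟨K, t, ht, hK⟩ := hsum hx
  refine ⟨K, t ∩ openQuadrant, Filter.inter_mem ht self_mem_nhdsWithin, fun a ha b hb => ?_⟩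
  rw [halfLineValue_eq (openQuadrant_subset_closedQuadrant ha.2),
    halfLineValue_eq (openQuadrant_subset_closedQuadrant hb.2)]
  exact hK ha.1 hb.1

lemma payoff_le {x : ℝ × ℝ} (hx : x ∈ closedQuadrant) {L₁ L₂ : ℝ≥0 → Ω → ℝ}
    (h₁ : IsDividendProcess m.baseFiltration L₁) (h₂ : IsDividendProcess m.baseFiltration L₂) :
    m.payoff x L₁ L₂ ≤ ENNReal.ofReal (x.1 + x.2) + ENNReal.ofReal ((m.c₁ + m.c₂) / m.q) := by
  have := isProbabilityMeasure_expTime m.q_pos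
  have hc : 0 ≤ m.c₁ + m.c₂ := (add_pos m.c₁_pos m.c₂_pos).le
  rw [payoff_eq h₁ h₂]
  refine (lintegral_mono_ae (g := fun _ => ENNReal.ofReal (x.1 + x.2) +
    ENNReal.ofReal ((m.c₁ + m.c₂) / m.q)) ?_).trans_eq (by rw [lintegral_const, measure_univ, mul_one])
  filter_upwards [m.ae_claims_nonneg] with ω hω
  rw [← reward_linear m.q_pos hc]
  calc _ ≤ ∫⁻ u, (ENNReal.ofReal (x.1 + x.2) + ENNReal.ofReal ((m.c₁ + m.c₂) * (u : ℝ≥0))) ∂(expTime m.q) := by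
        refine lintegral_mono fun u => ?_
        rw [← ENNReal.ofReal_add (add_nonneg hx.1 hx.2) (mul_nonneg hc u.coe_nonneg)]
        refine ENNReal.ofReal_le_ofReal ?_
        set T := m.ruinTime x L₁ L₂ ω with hTdef
        have hnr : ∀ s : ℝ≥0, (s : ℝ≥0∞) < T → 0 ≤ x.1 + m.c₁ * s - m.b₁ * m.claims ω s - L₁ s ω ∧
            0 ≤ x.2 + m.c₂ * s - m.b₂ * m.claims ω s - L₂ s ω := by
          intro s hs
          by_contra hcon
          rw [not_and_or, not_le, not_le] at hcon
          exact absurd hs (not_lt.2 (iInf₂_le s hcon))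
        have hle := stopAt_le_right T u
        have e₁ : L₁ (stopAt T u) ω ≤ x.1 + m.c₁ * stopAt T u :=
          le_of_le_of_forall_lt (v := fun t => x.1 + m.c₁ * t) (h₁.leftCont ω) (by fun_prop)
            (by simpa [h₁.zero ω] using hx.1) (fun s hs => by
              have h1 := (hnr s hs).1
              have h2 := mul_nonneg m.b₁_pos.le (hω s)
              linarith) hle
        have e₂ : L₂ (stopAt T u) ω ≤ x.2 + m.c₂ * stopAt T u :=
          le_of_le_of_forall_lt (v := fun t => x.2 + m.c₂ * t) (h₂.leftCont ω) (by fun_prop)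
            (by simpa [h₂.zero ω] using hx.2) (fun s hs => by
              have h1 := (hnr s hs).2
              have h2 := mul_nonneg m.b₂_pos.le (hω s)
              linarith) hle
        have e₃ := mul_le_mul_of_nonneg_left (NNReal.coe_le_coe.2 (stopAt_le_left T u)) hc
        linarith
    _ = _ := by rw [lintegral_add_left measurable_const, lintegral_const, measure_univ, mul_one]

/-- Every admissible strategy bounds the optimal value from below. -/
lemma le_optimalValue {x : ℝ × ℝ} (hx : x ∈ closedQuadrant) {L₁ L₂ : ℝ≥0 → Ω → ℝ}
    (h₁ : IsDividendProcess m.baseFiltration L₁) (h₂ : IsDividendProcess m.baseFiltration L₂) {a : ℝ}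
    (ha : ENNReal.ofReal a ≤ m.payoff x L₁ L₂) : a ≤ m.optimalValue x := by
  refine (ENNReal.ofReal_le_iff_le_toReal ?_).1 (ha.trans (le_iSup₂ (f := fun
    (L : (ℝ≥0 → Ω → ℝ) × (ℝ≥0 → Ω → ℝ)) (_ : m.IsAdmissible x L.1 L.2) => m.payoff x L.1 L.2)
      (L₁, L₂) (isAdmissible_iff.2 ⟨h₁, h₂⟩)))
  refine ne_top_of_le_ne_top (ENNReal.add_ne_top.2 ⟨ENNReal.ofReal_ne_top, ENNReal.ofReal_ne_top⟩)
    (iSup₂_le fun L hL => payoff_le hx (isAdmissible_iff.1 hL).1 (isAdmissible_iff.1 hL).2)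

end TwoBranchModel

/-! ### Touching functions from below -/

/-- If a continuous function grows faster than with slope `M`, then it is touched from below by a
smooth function with slope greater than `M`. -/
lemma exists_touching_below {f : ℝ → ℝ} {a b M : ℝ} (hab : a < b) (hf : ContinuousOn f (Set.Icc a b))
    (h : M * (b - a) < f b - f a) :
    ∃ z₀ ∈ Set.Ioo a b, ∃ T : ℝ → ℝ, ∃ p, M < p ∧ ContDiff ℝ 1 T ∧ HasDerivAt T p z₀ ∧ T z₀ = f z₀ ∧
      ∀ z ∈ Set.Icc a b, T z ≤ f z := by
  -- Subtracting the line of slope M reduces to a function that vanishes at a and is positive at b.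
  -- It remains to touch it from below by a strictly increasing function.
  set F : ℝ → ℝ := fun z => f z - f a - M * (z - a)
  set K := F b
  have hK : 0 < K := by simp only [K, F]; linarith
  have hFc : ContinuousOn F (Set.Icc a b) := by
    refine (hf.sub continuousOn_const).sub (Continuous.continuousOn (by fun_prop))
  have hFa : F a = 0 := by simp [F]
  obtain ⟨z₁, hz₁, hFz₁⟩ : ∃ z₁ ∈ Set.Ioo a b, F z₁ < K / 2 := by
    have hnb : (nhdsWithin a (Set.Ioo a b)).NeBot := by
      rw [nhdsWithin_Ioo_eq_nhdsGT hab]; infer_instance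
    have h1 := (hFc a ⟨le_rfl, hab.le⟩).mono Set.Ioo_subset_Icc_self
    have h2 : ∀ᶠ z in nhdsWithin a (Set.Ioo a b), F z < K / 2 :=
      h1.eventually (gt_mem_nhds (by rw [hFa]; linarith))
    obtain ⟨z, hz⟩ := (h2.and self_mem_nhdsWithin).exists
    exact ⟨z, hz.2, hz.1⟩
  have hza : 0 < z₁ - a := sub_pos.2 hz₁.1
  set N := 1 / (z₁ - a)
  have hN : 0 < N := by positivity
  -- H increases from -K at a and stays negative. Hence F - H equals K at a and exceeds K at b,
  -- while at z₁ it is less than K/2 + K/e < K. The minimum is interior, and the touching function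
  -- has slope M + H' > M there.
  set H : ℝ → ℝ := fun z => -K * Real.exp (-N * (z - a))
  have hH' : ∀ z, HasDerivAt H (K * N * Real.exp (-N * (z - a))) z := by
    intro z
    have h1 : HasDerivAt (fun z => -N * (z - a)) (-N) z := by
      simpa using ((hasDerivAt_id z).sub_const a).const_mul (-N)
    exact (h1.exp.const_mul (-K)).congr_deriv (by ring)
  have hHc : ContDiff ℝ 1 H := by
    simp only [H]
    fun_prop
  obtain ⟨z₀, hz₀, hmin⟩ := isCompact_Icc.exists_isMinOn (Set.nonempty_Icc.2 hab.le)
    (hFc.sub hHc.continuous.continuousOn)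
  have hval : F z₀ - H z₀ < K := by
    have h0 : F z₀ - H z₀ ≤ F z₁ - H z₁ := hmin (Set.Ioo_subset_Icc_self hz₁)
    have hNz : -N * (z₁ - a) = -1 := by simp only [N]; field_simp
    have he : Real.exp (-1) < 1 / 2 := by
      have := Real.exp_one_gt_d9
      rw [Real.exp_neg, inv_eq_one_div]
      exact one_div_lt_one_div_of_lt (by norm_num) (by linarith)
    have hHz : H z₁ = -K * Real.exp (-1) := by simp only [H, hNz]
    rw [hHz] at h0
    nlinarith
  have hne_a : z₀ ≠ a := by
    rintro rfl
    simp [H, hFa] at hval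
  have hne_b : z₀ ≠ b := by
    rintro rfl
    have : 0 < K * Real.exp (-N * (z₀ - a)) := by positivity
    simp only [H] at hval
    linarith
  refine ⟨z₀, ⟨lt_of_le_of_ne hz₀.1 hne_a.symm, lt_of_le_of_ne hz₀.2 hne_b⟩,
    fun z => f z₀ + M * (z - z₀) + (H z - H z₀), M + K * N * Real.exp (-N * (z₀ - a)), ?_, ?_, ?_, ?_, ?_⟩
  · have : 0 < K * N * Real.exp (-N * (z₀ - a)) := by positivity
    linarith
  · fun_prop
  · have h1 : HasDerivAt (fun z => f z₀ + M * (z - z₀)) M z₀ := by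
      simpa using (((hasDerivAt_id z₀).sub_const z₀).const_mul M).const_add (f z₀)
    exact h1.add ((hH' z₀).sub_const _)
  · simp
  · intro z hz
    have h1 : F z₀ - H z₀ ≤ F z - H z := hmin hz
    simp only [F] at h1
    linarith

/-- A smooth minorant of `w` that is `ε`-close to `w` on `[0, z₀]` and agrees near `z₀` with a given
function touching `w` from below. -/
lemma exists_smooth_minorant {w : ℝ → ℝ} (hw : ContinuousOn w (Set.Ici 0)) (hmono : Monotone w)
    {a b z₀ K ε : ℝ} (ha : 0 < a) (hz₀ : z₀ ∈ Set.Ioo a b) (hK : 0 ≤ K)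
    (hlip : ∀ x y, 0 ≤ x → x ≤ y → y ≤ z₀ → w y - w x ≤ K * (y - x)) {T : ℝ → ℝ} (hT : ContDiff ℝ 1 T)
    (hTw : ∀ z ∈ Set.Icc a b, T z ≤ w z) (hT₀ : T z₀ = w z₀) (hε : 0 < ε) :
    ∃ g : ℝ → ℝ, ContDiff ℝ 1 g ∧ (∀ z, 0 ≤ z → g z ≤ w z) ∧
      (∀ z, 0 ≤ z → z ≤ z₀ → w z - ε ≤ g z) ∧ g =ᶠ[nhds z₀] T := by
  -- The function w need not be continuous at 0 from the left, so it is continued by its value at 0.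
  set w₀ : ℝ → ℝ := fun s => w (max s 0)
  have hw₀ : Continuous w₀ := by
    refine continuousOn_univ.1 (hw.comp (Continuous.continuousOn (by fun_prop)) fun s _ => ?_)
    exact le_max_right s 0
  have hw₀m : Monotone w₀ := fun s t hst => hmono (max_le_max_right _ hst)
  set F : ℝ → ℝ := fun x => ∫ s in (0 : ℝ)..x, w₀ s
  have hF : ∀ x, HasDerivAt F (w₀ x) x := fun x =>
    intervalIntegral.integral_hasDerivAt_right (hw₀.intervalIntegrable _ _)
      (hw₀.stronglyMeasurableAtFilter _ _) hw₀.continuousAt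
  have hFc : ContDiff ℝ 1 F := by
    rw [contDiff_one_iff_deriv]
    refine ⟨fun x => (hF x).differentiableAt, ?_⟩
    rwa [show deriv F = w₀ from funext fun x => (hF x).deriv]
  set δ := ε / (K + 1)
  have hδ : 0 < δ := by positivity
  have hKδ : K * δ ≤ ε := by
    have : (K + 1) * δ = ε := by simp only [δ]; field_simp
    nlinarith
  -- The mean of w₀ over [z - δ, z]. It is C¹, and monotonicity places it between w₀ (z - δ) and w₀
  -- z, so it is a minorant with error at most Kδ ≤ ε.
  set A : ℝ → ℝ := fun z => δ⁻¹ * (F z - F (z - δ))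
  have hA : ContDiff ℝ 1 A := by
    simp only [A]
    exact contDiff_const.mul (hFc.sub (hFc.comp (contDiff_id.sub contDiff_const)))
  have hFsub : ∀ z, F z - F (z - δ) = ∫ s in (z - δ)..z, w₀ s := fun z =>
    intervalIntegral.integral_interval_sub_left (hw₀.intervalIntegrable _ _) (hw₀.intervalIntegrable _ _)
  have hAle : ∀ z, A z ≤ w₀ z := by
    intro z
    have h1 : ∫ s in (z - δ)..z, w₀ s ≤ ∫ _ in (z - δ)..z, w₀ z :=
      intervalIntegral.integral_mono_on (by linarith) (hw₀.intervalIntegrable _ _)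
        (by simp) fun s hs => hw₀m hs.2
    rw [intervalIntegral.integral_const, sub_sub_cancel, smul_eq_mul] at h1
    simp only [A]
    rw [hFsub, inv_mul_le_iff₀ hδ]
    exact h1
  have hleA : ∀ z, w₀ (z - δ) ≤ A z := by
    intro z
    have h1 : ∫ _ in (z - δ)..z, w₀ (z - δ) ≤ ∫ s in (z - δ)..z, w₀ s :=
      intervalIntegral.integral_mono_on (by linarith) (by simp) (hw₀.intervalIntegrable _ _)
        fun s hs => hw₀m hs.1
    rw [intervalIntegral.integral_const, sub_sub_cancel, smul_eq_mul] at h1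
    simp only [A]
    rw [hFsub, le_inv_mul_iff₀ hδ]
    exact h1
  have hz₀0 : 0 < z₀ := ha.trans hz₀.1
  have hnear : ∀ᶠ z in nhds z₀, w z - ε ≤ T z := by
    have hc : ContinuousAt (fun z => T z - w z) z₀ :=
      hT.continuous.continuousAt.sub (hw.continuousAt (Ici_mem_nhds hz₀0))
    have : ∀ᶠ z in nhds z₀, -ε < T z - w z := hc.eventually (lt_mem_nhds (show -ε < T z₀ - w z₀ by linarith))
    filter_upwards [this] with z hz
    linarith
  obtain ⟨ρ, hρ, hball⟩ := Metric.eventually_nhds_iff_ball.1 (hnear.and (Ioo_mem_nhds hz₀.1 hz₀.2))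
  -- T and the mean are both ε-close minorants on the ball (to the left of z₀, where closeness is
  -- claimed), so their convex combination is one too; it equals T near z₀ and the mean outside the
  -- ball.
  let χ : ContDiffBump z₀ := ⟨ρ / 2, ρ, by positivity, by linarith⟩
  have hχ0 : ∀ z, z ∉ Metric.ball z₀ ρ → χ z = 0 := fun z hz => by
    refine χ.zero_of_le_dist ?_
    exact not_lt.1 hz
  refine ⟨fun z => χ z * T z + (1 - χ z) * A z, ?_, ?_, ?_, ?_⟩
  · exact (χ.contDiff.mul hT).add ((contDiff_const.sub χ.contDiff).mul hA)
  · intro z hz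
    have hw₀z : w₀ z = w z := by simp [w₀, hz]
    have h1 := hAle z
    rw [hw₀z] at h1
    by_cases hb : z ∈ Metric.ball z₀ ρ
    · have h2 := hTw z (Set.Ioo_subset_Icc_self (hball z hb).2)
      have h3 := χ.nonneg (x := z)
      have h4 := χ.le_one (x := z)
      nlinarith
    · simp only [hχ0 z hb]
      linarith
  · intro z hz hzz
    have h1 : w z - ε ≤ A z := by
      refine le_trans ?_ (hleA z)
      have h2 := hlip (max (z - δ) 0) z (le_max_right _ _) (max_le (by linarith) hz) hzz
      have h3 : z - max (z - δ) 0 ≤ δ := by linarith [le_max_left (z - δ) 0]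
      have h4 := mul_le_mul_of_nonneg_left h3 hK
      simp only [w₀]
      linarith
    by_cases hb : z ∈ Metric.ball z₀ ρ
    · have h2 := (hball z hb).1
      have h3 := χ.nonneg (x := z)
      have h4 := χ.le_one (x := z)
      nlinarith
    · simp only [hχ0 z hb]
      linarith
  · filter_upwards [χ.eventuallyEq_one] with z hz
    have : χ z = 1 := hz
    simp [this]

/-! ### The growth bound from the supersolution property -/

namespace TwoBranchModel

variable {Ω : Type*} [MeasurableSpace Ω] {P : Measure Ω} [IsProbabilityMeasure P]
  (m : TwoBranchModel P)

/-- The premium rate of the first branch in units of the second coordinate on the half line. -/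
def fastRate : ℝ := m.c₁ * (m.b₂ / m.b₁)

lemma fastRate_pos : 0 < m.fastRate := mul_pos m.c₁_pos (div_pos m.b₂_pos m.b₁_pos)

variable {m}

lemma fastRate_mul_ratio : m.fastRate * (m.b₁ / m.b₂) = m.c₁ := by
  unfold fastRate
  rw [mul_assoc, mul_comm (m.b₂ / m.b₁), ratio_mul, mul_one]

lemma halfLineValue_of_le {x : ℝ × ℝ} (hx : x ∈ closedQuadrant) (h : m.b₂ / m.b₁ * x.1 ≤ x.2) :
    m.halfLineValue x = x.2 - m.b₂ / m.b₁ * x.1 + m.value₂ (m.b₂ / m.b₁ * x.1) := by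
  rw [halfLineValue_eq hx, base_of_le h]
  have : m.slope * (m.b₂ / m.b₁ * x.1) = m.b₂ / m.b₁ * x.1 + x.1 := by
    unfold slope
    rw [add_mul, one_mul, ← mul_assoc, ratio_mul, one_mul]
  linarith

lemma halfLineValue_of_ge {x : ℝ × ℝ} (hx : x ∈ closedQuadrant) (h : x.2 ≤ m.b₂ / m.b₁ * x.1) :
    m.halfLineValue x = x.1 - m.b₁ / m.b₂ * x.2 + m.value₂ x.2 := by
  rw [halfLineValue_eq hx, base, min_eq_left h]
  unfold slope
  ring

/-- The supersolution property above the half line bounds the slopes of smooth functions that touch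
the one-dimensional value function from below. -/
lemma slope_le_of_supersolution
    (hV : ∀ x ∈ openQuadrant, m.IsViscositySupersolutionAt m.halfLineValue x)
    {a b z₀ p : ℝ} (ha : 0 < a) (hz₀ : z₀ ∈ Set.Ioo a b) {T : ℝ → ℝ} (hT : ContDiff ℝ 1 T)
    (hp : HasDerivAt T p z₀) (hT₀ : T z₀ = m.value₂ z₀) (hTw : ∀ z ∈ Set.Icc a b, T z ≤ m.value₂ z) :
    m.fastRate * (p - m.slope) + m.premiumOperator z₀ ≤ 0 := by
  have hz : 0 < z₀ := ha.trans hz₀.1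
  have hβ : 0 < m.b₂ / m.b₁ := div_pos m.b₂_pos m.b₁_pos
  have hκ := m.ratio_pos
  have hql : 0 < m.q + m.lam := add_pos m.q_pos m.lam_pos
  refine le_of_forall_pos_le_add fun η hη => ?_
  rw [zero_add]
  -- The height above 𝓜 and the accuracy ε of the minorant each cost η/2 in the final inequality.
  set d := η / (2 * (m.q + m.lam))
  have hd : 0 < d := by positivity
  set ε := η / (2 * m.lam)
  have hε : 0 < ε := div_pos hη (mul_pos two_pos m.lam_pos)
  obtain ⟨g, hgc, hgw, hwg, hgT⟩ := exists_smooth_minorant continuousOn_value₂ value₂_mono ha hz₀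
    (K := (m.lam + m.q) / m.c₂ * m.value₂ z₀)
    (mul_nonneg (div_nonneg (add_pos m.lam_pos m.q_pos).le m.c₂_pos.le) (value₂_nonneg _))
    (fun x y hx hxy hy => (value₂_sub_le hx hxy).trans (by
      have h1 := value₂_mono (m := m) hy
      have h2 := div_nonneg (add_pos m.lam_pos m.q_pos).le m.c₂_pos.le
      exact mul_le_mul_of_nonneg_right (mul_le_mul_of_nonneg_left h1 h2) (sub_nonneg.2 hxy)))
    hT hTw hT₀ hε
  set C := (m.c₁ + m.c₂) / m.q
  have hC : 0 ≤ C := div_nonneg (add_pos m.c₁_pos m.c₂_pos).le m.q_pos.le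
  -- This is the formula for Ṽ above 𝓜 with the minorant g in place of W. The last term vanishes
  -- from height d/2 upwards and equals C on and below 𝓜. There W(s) ≤ (1 + κ)s + C gives φ ≤ x₁ +
  -- x₂ ≤ Ṽ.
  set φ : ℝ × ℝ → ℝ := fun x => x.2 - m.b₂ / m.b₁ * x.1 + g (m.b₂ / m.b₁ * x.1) -
    C * Real.smoothTransition ((m.b₂ / m.b₁ * x.1 - x.2) / (d / 2) + 1)
  have hφc : ContDiff ℝ 1 φ := by
    have h1 : ContDiff ℝ 1 fun x : ℝ × ℝ => m.b₂ / m.b₁ * x.1 := by fun_prop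
    have h2 : ContDiff ℝ 1 fun x : ℝ × ℝ => (m.b₂ / m.b₁ * x.1 - x.2) / (d / 2) + 1 := by fun_prop
    exact ((contDiff_snd.sub h1).add (hgc.comp h1)).sub
      (contDiff_const.mul (Real.smoothTransition.contDiff.comp h2))
  have hφ_eq : ∀ x : ℝ × ℝ, m.b₂ / m.b₁ * x.1 + d / 2 ≤ x.2 →
      φ x = x.2 - m.b₂ / m.b₁ * x.1 + g (m.b₂ / m.b₁ * x.1) := by
    intro x hx
    have : Real.smoothTransition ((m.b₂ / m.b₁ * x.1 - x.2) / (d / 2) + 1) = 0 := by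
      refine Real.smoothTransition.zero_of_nonpos ?_
      have : (m.b₂ / m.b₁ * x.1 - x.2) / (d / 2) ≤ -1 := by
        rw [div_le_iff₀ (by positivity)]
        linarith
      linarith
    simp only [φ, this]
    ring
  set x₀ : ℝ × ℝ := (m.b₁ / m.b₂ * z₀, z₀ + d)
  have hx₀s : m.b₂ / m.b₁ * x₀.1 = z₀ := by
    simp only [x₀]
    rw [← mul_assoc, mul_comm (m.b₂ / m.b₁), ratio_mul, one_mul]
  have hx₀ : x₀ ∈ openQuadrant := ⟨mul_pos hκ hz, add_pos hz hd⟩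
  have hg₀ : g z₀ = m.value₂ z₀ := hgT.eq_of_nhds.trans hT₀
  have hle : ∀ x ∈ closedQuadrant, φ x ≤ m.halfLineValue x := by
    intro x hx
    have hs : 0 ≤ m.b₂ / m.b₁ * x.1 := mul_nonneg hβ.le hx.1
    have hgs := hgw _ hs
    rcases le_total (m.b₂ / m.b₁ * x.1) x.2 with h | h
    · rw [halfLineValue_of_le hx h]
      have := mul_nonneg hC (Real.smoothTransition.nonneg ((m.b₂ / m.b₁ * x.1 - x.2) / (d / 2) + 1))
      simp only [φ]
      linarith
    · rw [halfLineValue_of_ge hx h]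
      have h1 : Real.smoothTransition ((m.b₂ / m.b₁ * x.1 - x.2) / (d / 2) + 1) = 1 := by
        refine Real.smoothTransition.one_of_one_le ?_
        have : 0 ≤ (m.b₂ / m.b₁ * x.1 - x.2) / (d / 2) := div_nonneg (by linarith) (by positivity)
        linarith
      have h2 := value₂_le (m := m) hs
      have h3 := value₂_add_le (m := m) le_rfl hx.2
      rw [zero_add] at h3
      have h4 := value₂_nonneg (m := m) 0
      have h5 : m.slope * (m.b₂ / m.b₁ * x.1) = m.b₂ / m.b₁ * x.1 + x.1 := by
        unfold slope
        rw [add_mul, one_mul, ← mul_assoc, ratio_mul, one_mul]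
      have h6 : m.slope * x.2 = x.2 + m.b₁ / m.b₂ * x.2 := by unfold slope; ring
      simp only [φ, h1]
      linarith
  have hφx₀ : φ x₀ = d + m.value₂ z₀ := by
    rw [hφ_eq x₀ (by rw [hx₀s]; simp only [x₀]; linarith), hx₀s, hg₀]
    simp only [x₀]
    ring
  have heq : φ x₀ = m.halfLineValue x₀ := by
    rw [halfLineValue_of_le (openQuadrant_subset_closedQuadrant hx₀)
      (by rw [hx₀s]; simp only [x₀]; linarith), hx₀s, hφx₀]
    simp only [x₀]
    ring
  have hjb := (hV x₀ hx₀).2 φ hφc.contDiffOn heq (fun x hx => by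
    have := hle x hx
    simp only [Set.mem_ofPred_eq, heq]
    linarith)
  have hL : m.operatorL φ x₀ ≤ 0 := (le_max_left _ _).trans hjb
  have hp₁ : partial₁ φ x₀ = m.b₂ / m.b₁ * (p - 1) := by
    have hg' : HasDerivAt g p (m.b₂ / m.b₁ * x₀.1) := by
      rw [hx₀s]
      exact hp.congr_of_eventuallyEq hgT
    have h1 : HasDerivAt (fun s : ℝ => m.b₂ / m.b₁ * s) (m.b₂ / m.b₁) x₀.1 := by
      simpa using (hasDerivAt_id x₀.1).const_mul (m.b₂ / m.b₁)
    have h2 : HasDerivAt (fun s => x₀.2 - m.b₂ / m.b₁ * s + g (m.b₂ / m.b₁ * s))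
        (m.b₂ / m.b₁ * (p - 1)) x₀.1 := by
      exact ((h1.const_sub x₀.2).add (hg'.comp x₀.1 h1)).congr_deriv (by ring)
    refine (h2.congr_of_eventuallyEq ?_).deriv
    have hev : ∀ᶠ s in nhds x₀.1, m.b₂ / m.b₁ * s + d / 2 < x₀.2 := by
      have hc : Continuous fun s : ℝ => m.b₂ / m.b₁ * s + d / 2 := by fun_prop
      exact (hc.tendsto x₀.1).eventually (gt_mem_nhds (by rw [hx₀s]; simp only [x₀]; linarith))
    filter_upwards [hev] with s hs
    exact hφ_eq (s, x₀.2) hs.le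
  have hp₂ : partial₂ φ x₀ = 1 := by
    have h2 : HasDerivAt (fun s => s - m.b₂ / m.b₁ * x₀.1 + g (m.b₂ / m.b₁ * x₀.1)) 1 x₀.2 :=
      ((hasDerivAt_id x₀.2).sub_const _).add_const _
    refine (h2.congr_of_eventuallyEq ?_).deriv
    filter_upwards [lt_mem_nhds (show m.b₂ / m.b₁ * x₀.1 + d / 2 < x₀.2 by
      rw [hx₀s]; simp only [x₀]; linarith)] with s hs
    exact hφ_eq (x₀.1, s) hs.le
  have hb₂ := m.b₂_pos
  have hset : min (x₀.1 / m.b₁) (x₀.2 / m.b₂) = z₀ / m.b₂ := by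
    have h1 : x₀.1 / m.b₁ = z₀ / m.b₂ := by
      simp only [x₀]
      have := m.b₁_pos.ne'
      have := m.b₂_pos.ne'
      field_simp
    rw [h1, min_eq_left]
    exact div_le_div_of_nonneg_right (by simp only [x₀]; linarith) m.b₂_pos.le
  -- Claims move the surplus parallel to 𝓜 and preserve the height d, so the correction term stays
  -- zero along the whole integral.
  have hint : ∀ α, φ (x₀.1 - m.b₁ * α, x₀.2 - m.b₂ * α) = d + g (z₀ - m.b₂ * α) := by
    intro α
    have h1 : m.b₂ / m.b₁ * (x₀.1 - m.b₁ * α) = z₀ - m.b₂ * α := by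
      rw [mul_sub, hx₀s, ← mul_assoc, div_mul_cancel₀ _ m.b₁_pos.ne']
    rw [hφ_eq _ (by simp only [h1]; simp only [x₀]; linarith)]
    simp only [h1]
    simp only [x₀]
    ring
  have hnl : m.lam * (m.claimValue z₀ - ε) ≤ m.nonlocalTerm φ x₀ := by
    unfold nonlocalTerm
    rw [hset]
    refine mul_le_mul_of_nonneg_left ?_ m.lam_pos.le
    simp_rw [hint]
    have hcv : m.claimValue z₀ = ∫ α in Set.Icc 0 (z₀ / m.b₂), m.value₂ (z₀ - m.b₂ * α) ∂m.G := by
      have := premiumOperator_eq (m := m) z₀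
      unfold premiumOperator at this
      have hlam := m.lam_pos
      nlinarith
    have hconst : ∫ _ in Set.Icc 0 (z₀ / m.b₂), ε ∂m.G ≤ ε := by
      rw [setIntegral_const, smul_eq_mul]
      exact mul_le_of_le_one_left hε.le measureReal_le_one
    have hI1 : IntegrableOn (fun α => m.value₂ (z₀ - m.b₂ * α)) (Set.Icc 0 (z₀ / m.b₂)) m.G :=
      (integrable_claimValue z₀).integrableOn
    have hI2 : IntegrableOn (fun _ => ε) (Set.Icc 0 (z₀ / m.b₂)) m.G := (integrable_const ε).integrableOn
    have hI3 : IntegrableOn (fun α => d + g (z₀ - m.b₂ * α)) (Set.Icc 0 (z₀ / m.b₂)) m.G := by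
      have : Continuous fun α => d + g (z₀ - m.b₂ * α) := continuous_const.add
        (hgc.continuous.comp (by fun_prop))
      exact this.continuousOn.integrableOn_compact isCompact_Icc
    calc m.claimValue z₀ - ε ≤ ∫ α in Set.Icc 0 (z₀ / m.b₂), (m.value₂ (z₀ - m.b₂ * α) - ε) ∂m.G := by
          rw [integral_sub hI1 hI2, ← hcv]
          linarith
      _ ≤ _ := by
          refine setIntegral_mono_on (hI1.sub hI2) hI3 measurableSet_Icc fun α hα => ?_
          have h1 : m.b₂ * α ≤ z₀ := by
            have := hα.2
            rw [le_div_iff₀ hb₂] at this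
            linarith
          have h2 := mul_nonneg hb₂.le hα.1
          have := hwg (z₀ - m.b₂ * α) (by linarith) (by linarith)
          linarith
  have hΛ := premiumOperator_eq (m := m) z₀
  unfold operatorL at hL
  rw [hp₁, hp₂, hφx₀] at hL
  have e1 : m.lam * ε = η / 2 := by
    simp only [ε]
    have := m.lam_pos.ne'
    field_simp
  have e2 : (m.q + m.lam) * d = η / 2 := by
    simp only [d]
    field_simp
  have e3 : m.c₁ * (m.b₂ / m.b₁ * (p - 1)) = m.fastRate * (p - m.slope) + m.c₁ := by
    have := fastRate_mul_ratio (m := m)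
    unfold slope
    rw [← mul_assoc, ← fastRate]
    linarith
  rw [e3] at hL
  linarith

/-- The one-dimensional value function grows at most as fast as on a half line with the premium rate
`fastRate`. -/
lemma value₂_sub_le_of_supersolution
    (hV : ∀ x ∈ openQuadrant, m.IsViscositySupersolutionAt m.halfLineValue x)
    {a b M : ℝ} (ha : 0 < a) (hab : a < b)
    (hM : ∀ z ∈ Set.Icc a b, m.slope - m.premiumOperator z / m.fastRate ≤ M) :
    m.value₂ b - m.value₂ a ≤ M * (b - a) := by
  by_contra! hcon
  obtain ⟨z₀, hz₀, T, p, hMp, hT, hp, hT₀, hTw⟩ := exists_touching_below hab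
    (continuousOn_value₂.mono fun z hz => ha.le.trans hz.1) hcon
  have h1 := slope_le_of_supersolution hV ha hz₀ hT hp hT₀ hTw
  have h2 := hM z₀ (Set.Ioo_subset_Icc_self hz₀)
  have h3 : m.premiumOperator z₀ / m.fastRate ≤ m.slope - p := by
    rw [div_le_iff₀ m.fastRate_pos]
    linarith
  linarith

end TwoBranchModel

namespace TwoBranchModel

variable {Ω : Type*} [MeasurableSpace Ω] {P : Measure Ω} [IsProbabilityMeasure P]
  (m : TwoBranchModel P)

variable {m}

/-! ### A strategy that leaves the half line -/

lemma c₂_le_fastRate : m.c₂ ≤ m.fastRate := by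
  have h := m.rate_nonneg
  have h2 := mul_le_mul_of_nonneg_left (sub_nonneg.1 h) (div_pos m.b₂_pos m.b₁_pos).le
  rw [← mul_assoc, mul_comm (m.b₂ / m.b₁) (m.b₁ / m.b₂), ratio_mul, one_mul] at h2
  unfold fastRate
  linarith

/-- Waiting until the time `h` off the half line, and then following, on disjoint events of the past,
strategies for the half line with the initial surpluses `y j`. -/
lemma sum_mul_value₂_le_optimalValue {z : ℝ} (hz : 0 ≤ z) (h : ℝ≥0) {ι : Type*} (J : Finset ι)
    {B : ι → Set ℝ} (hB : ∀ j, MeasurableSet (B j)) (hdisj : Pairwise (Function.onFun Disjoint B))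
    {y : ι → ℝ} (hy : ∀ j, 0 ≤ y j)
    (hBy : ∀ j, ∀ s ∈ B j, 0 ≤ s ∧ m.b₂ * s ≤ z ∧ y j + m.b₂ * s ≤ z + m.fastRate * h) :
    Real.exp (-m.q * h) * ∑ j ∈ J, P.real {ω | m.totalClaims h ω ∈ B j} * m.value₂ (y j) ≤
      m.optimalValue (m.b₁ / m.b₂ * z, z + (m.fastRate - m.c₂) * h) := by
  classical
  have hκ := m.ratio_pos
  have hc := sub_nonneg.2 (c₂_le_fastRate (m := m))
  have hch := mul_nonneg hc h.coe_nonneg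
  have hfh := mul_nonneg m.fastRate_pos.le h.coe_nonneg
  -- The starting point is chosen so that, with no payments until h, the surplus lies on 𝓜 at that
  -- time: the second coordinate gains c₂h and the first gains c₁h = κ·f·h, so that without claims
  -- both reach the point of level z + fh.
  set x : ℝ × ℝ := (m.b₁ / m.b₂ * z, z + (m.fastRate - m.c₂) * h)
  have hx : x ∈ closedQuadrant := ⟨mul_nonneg hκ.le hz, add_nonneg hz hch⟩
  set D : ι → Set Ω := fun j => {ω | m.totalClaims h ω ∈ B j}
  have hDF : ∀ j, MeasurableSet[m.baseFiltration h] (D j) := fun j =>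
    m.measurable_totalClaims_base le_rfl (hB j)
  have hDm : ∀ j, MeasurableSet (D j) := fun j => m.baseFiltration.le h _ (hDF j)
  have hDdisj : Pairwise (Function.onFun Disjoint D) := fun i j hij =>
    (hdisj hij).preimage (m.totalClaims h)
  refine le_of_forall_pos_sub_le fun ε hε => ?_
  -- One near-optimal strategy for each level; using a finite sum of them avoids a measurable
  -- selection over all levels.
  choose σ hσ _ using fun j => exists_near_optimal (m := m) (hy j) hε
  -- The lump sum at time h that lowers the level on 𝓜 to the prescribed y j.
  set ξ : ι → Ω → ℝ := fun j => (D j).indicator fun ω => z + m.fastRate * h - m.b₂ * m.totalClaims h ω - y j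
  have hξ0 : ∀ j ω, 0 ≤ ξ j ω := fun j ω => Set.indicator_nonneg (fun ω hω => by
    have := (hBy j _ hω).2.2
    linarith) ω
  have hξC : ∀ j ω, ξ j ω ≤ z + m.fastRate * h := fun j ω => by
    refine Set.indicator_apply_le' (fun hω => ?_) fun _ => add_nonneg hz hfh
    have := mul_nonneg m.b₂_pos.le (hBy j _ hω).1
    have := hy j
    linarith
  have hξm : ∀ j, Measurable[m.baseFiltration h] (ξ j) := fun j =>
    (((m.measurable_totalClaims_base le_rfl).const_mul m.b₂).const_sub _ |>.sub_const _).indicator (hDF j)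
  have h₂ := IsDividendProcess.finset_sum J (𝓕 := m.baseFiltration) fun j =>
    (IsDividendProcess.lump (hξ0 j) (hξC j) (hξm j)).add (m.isDividendProcess_restart (σ j) h (hDF j))
  have hid : IsDividendProcess m.baseFiltration fun (t : ℝ≥0) (_ : Ω) => m.rate * ((t - h : ℝ≥0) : ℝ) :=
    IsDividendProcess.of_path (v := fun t : ℝ≥0 => m.rate * ((t - h : ℝ≥0) : ℝ))
      (fun a b hab => mul_le_mul_of_nonneg_left (NNReal.coe_le_coe.2 (tsub_le_tsub_right hab h)) m.rate_nonneg)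
      (fun t => Continuous.continuousWithinAt (by fun_prop)) (by simp)
  have h₁ := hid.add (h₂.const_mul hκ.le)
  set L₂ : ℝ≥0 → Ω → ℝ := fun t ω => ∑ j ∈ J, ((if h < t then ξ j ω else 0) +
    (D j).indicator (fun ω => (σ j).val 0 (m.futureClaims h ω) (t - h)) ω)
  set L₁ : ℝ≥0 → Ω → ℝ := fun t ω => m.rate * ((t - h : ℝ≥0) : ℝ) + m.b₁ / m.b₂ * L₂ t ω
  have hL₂ : ∀ j ∈ J, ∀ ω ∈ D j, ∀ t, L₂ t ω =
      (if h < t then z + m.fastRate * h - m.b₂ * m.totalClaims h ω - y j else 0) +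
        (σ j).val 0 (m.futureClaims h ω) (t - h) := by
    intro j hj ω hω t
    have hne : ∀ i ∈ J, i ≠ j → (if h < t then ξ i ω else 0) +
        (D i).indicator (fun ω => (σ i).val 0 (m.futureClaims h ω) (t - h)) ω = 0 := by
      intro i _ hij
      have hωi : ω ∉ D i := fun hi => Set.disjoint_left.1 (hDdisj hij) hi hω
      simp only [ξ, Set.indicator_of_notMem hωi, ite_self, add_zero]
    simp only [L₂]
    rw [Finset.sum_eq_single j hne fun hj' => absurd hj hj']
    simp only [ξ, Set.indicator_of_mem hω]
  have hpath : ∀ᵐ ω ∂P, ∀ j ∈ J, ω ∈ D j → ENNReal.ofReal (Real.exp (-m.q * h)) *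
      m.pathPayoff (y j) (m.futureClaims h ω) ((σ j).val 0 (m.futureClaims h ω)) ≤
        reward m.q (fun t => L₁ t ω + L₂ t ω) (m.ruinTime x L₁ L₂ ω) := by
    filter_upwards [m.ae_isRegularMarks] with ω hω j hj hωj
    have hBj := hBy j _ hωj
    set σf := (σ j).val 0 (m.futureClaims h ω)
    set T' := ruinOf (m.level (y j) (m.futureClaims h ω) σf)
    have hT : h + T' ≤ m.ruinTime x L₁ L₂ ω := by
      rw [ruinTime_eq]
      refine le_iInf₂ fun s hs => ?_
      rcases le_or_gt s h with hsh | hsh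
      -- There is no ruin up to h: nothing has been paid, and the claims up to h satisfy b₂S ≤ z,
      -- which the initial surplus of either branch covers.
      · exfalso
        have hL0 : L₂ s ω = 0 := by
          rw [hL₂ j hj ω hωj, if_neg (not_lt.2 hsh), tsub_eq_zero_of_le hsh, (σ j).val_zero, add_zero]
        have hL0' : L₁ s ω = 0 := by
          simp only [L₁, hL0, tsub_eq_zero_of_le hsh]
          simp
        have hcl : m.claims ω s ≤ m.totalClaims h ω := hω.claimPath_mono hsh
        have e1 := mul_le_mul_of_nonneg_left hcl m.b₂_pos.le
        have e2 : m.b₁ * m.claims ω s ≤ m.b₁ / m.b₂ * z := by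
          have e0 : m.b₁ * m.claims ω s = m.b₁ / m.b₂ * (m.b₂ * m.claims ω s) := by
            rw [← mul_assoc, ratio_mul_b₂]
          rw [e0]
          exact mul_le_mul_of_nonneg_left (e1.trans hBj.2.1) hκ.le
        have e3 := mul_nonneg m.c₁_pos.le s.coe_nonneg
        have e4 := mul_nonneg m.c₂_pos.le s.coe_nonneg
        rw [hL0, hL0'] at hs
        simp only [x] at hs
        rcases hs with hs | hs <;> linarith [hBj.2.1]
      · obtain ⟨t, rfl⟩ : ∃ t, s = h + t := ⟨s - h, (add_tsub_cancel_of_le hsh.le).symm⟩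
        have ht : 0 < t := by simpa using hsh
        rw [ENNReal.coe_add]
        refine add_le_add_right (ruinOf_le ?_) (h : ℝ≥0∞)
        have hL : L₂ (h + t) ω = z + m.fastRate * h - m.b₂ * m.totalClaims h ω - y j + σf t := by
          rw [hL₂ j hj ω hωj, if_pos hsh, add_tsub_cancel_left]
        have hlev : x.2 + m.c₂ * ((h + t : ℝ≥0) : ℝ) - m.b₂ * m.claims ω (h + t) - L₂ (h + t) ω =
            m.level (y j) (m.futureClaims h ω) σf t := by
          rw [hL]
          simp only [x, level, futureClaims, claims, NNReal.coe_add]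
          ring
        have hlev₁ : x.1 + m.c₁ * ((h + t : ℝ≥0) : ℝ) - m.b₁ * m.claims ω (h + t) - L₁ (h + t) ω =
            m.b₁ / m.b₂ * m.level (y j) (m.futureClaims h ω) σf t := by
          rw [← hlev]
          simp only [L₁, add_tsub_cancel_left]
          have e1 : m.b₁ / m.b₂ * (m.b₂ * m.claims ω (h + t)) = m.b₁ * m.claims ω (h + t) := by
            rw [← mul_assoc, ratio_mul_b₂]
          have e2 := fastRate_mul_ratio (m := m)
          have e3 : m.fastRate * (m.b₁ / m.b₂) * h = m.c₁ * h := by rw [e2]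
          simp only [x, NNReal.coe_add, rate]
          linarith
        rw [hlev, hlev₁] at hs
        rcases hs with hs | hs
        · exact not_le.1 fun h' => hs.not_ge (mul_nonneg hκ.le h')
        · exact hs
    have hmono : Monotone fun t => L₁ t ω + L₂ t ω := (h₁.mono ω).add (h₂.mono ω)
    calc _ ≤ ENNReal.ofReal (Real.exp (-m.q * h)) *
          reward m.q (fun t => L₁ (h + t) ω + L₂ (h + t) ω) T' := by
          gcongr
          refine reward_mono fun u => ?_
          set s := stopAt T' u
          simp only [L₁, add_tsub_cancel_left]
          have hL : σf s ≤ L₂ (h + s) ω := by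
            rw [hL₂ j hj ω hωj, add_tsub_cancel_left]
            refine le_add_of_nonneg_left ?_
            split_ifs
            · linarith [hBj.2.2]
            · exact le_rfl
          have := mul_le_mul_of_nonneg_left hL m.slope_pos.le
          have e : m.slope * L₂ (h + s) ω = L₂ (h + s) ω + m.b₁ / m.b₂ * L₂ (h + s) ω := by
            unfold slope; ring
          linarith
      _ ≤ reward m.q (fun t => L₁ t ω + L₂ t ω) (h + T') := le_reward_add hmono h T'
      _ ≤ _ := reward_mono fun u => hmono (stopAt_mono_left hT u)
  have hsum : ENNReal.ofReal (Real.exp (-m.q * h) *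
      ∑ j ∈ J, P.real (D j) * max (m.value₂ (y j) - ε) 0) ≤ m.payoff x L₁ L₂ := by
    rw [payoff_eq h₁ h₂]
    calc ENNReal.ofReal (Real.exp (-m.q * h) * ∑ j ∈ J, P.real (D j) * max (m.value₂ (y j) - ε) 0)
        = ∑ j ∈ J, ENNReal.ofReal (Real.exp (-m.q * h)) * (P (D j) * ENNReal.ofReal (m.value₂ (y j) - ε)) := by
          rw [ENNReal.ofReal_mul (Real.exp_nonneg _), ENNReal.ofReal_sum_of_nonneg (fun j _ =>
            mul_nonneg measureReal_nonneg (le_max_right _ _)), Finset.mul_sum]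
          refine Finset.sum_congr rfl fun j _ => ?_
          rw [ENNReal.ofReal_mul measureReal_nonneg, ofReal_measureReal]
          congr 2
          rcases le_total (m.value₂ (y j) - ε) 0 with h0 | h0
          · rw [max_eq_right h0, ENNReal.ofReal_zero, ENNReal.ofReal_of_nonpos h0]
          · rw [max_eq_left h0]
      _ ≤ ∑ j ∈ J, ∫⁻ ω in D j, reward m.q (fun t => L₁ t ω + L₂ t ω) (m.ruinTime x L₁ L₂ ω) ∂P := by
          refine Finset.sum_le_sum fun j hj => ?_
          have hD0 : D j = m.pastClaims h ⁻¹' {p | p h ∈ B j} := preimage_pastClaims h _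
          have hD1 : MeasurableSet {p : ℝ≥0 → ℝ | p h ∈ B j} := (measurable_pi_apply h) (hB j)
          calc _ ≤ ENNReal.ofReal (Real.exp (-m.q * h)) *
                (P (D j) * m.payoff₂ (y j) fun t ω => (σ j).val 0 (m.claims ω) t) := by
                gcongr
                exact hσ j
            _ = ∫⁻ ω in D j, ENNReal.ofReal (Real.exp (-m.q * h)) *
                m.pathPayoff (y j) (m.futureClaims h ω) ((σ j).val 0 (m.futureClaims h ω)) ∂P := by
                rw [lintegral_const_mul' _ _ ENNReal.ofReal_ne_top, hD0, m.setLIntegral_restart h hD1]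
            _ ≤ _ := by
                refine lintegral_mono_ae ?_
                filter_upwards [ae_restrict_of_ae hpath, ae_restrict_mem (hDm j)] with ω h1 h2
                exact h1 j hj h2
      _ = ∫⁻ ω in ⋃ j ∈ J, D j, reward m.q (fun t => L₁ t ω + L₂ t ω) (m.ruinTime x L₁ L₂ ω) ∂P :=
          (lintegral_biUnion_finset (hDdisj.set_pairwise _) (fun j _ => hDm j) _).symm
      _ ≤ _ := setLIntegral_le_lintegral _ _
  refine le_trans ?_ (le_optimalValue hx h₁ h₂ hsum)
  have hP1 : ∑ j ∈ J, P.real (D j) ≤ 1 := by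
    rw [← measureReal_biUnion_finset (hDdisj.set_pairwise _) fun j _ => hDm j]
    exact measureReal_le_one
  have hexp : Real.exp (-m.q * h) ≤ 1 := by
    rw [Real.exp_le_one_iff]
    have := mul_nonneg m.q_pos.le h.coe_nonneg
    linarith
  have hle : ∑ j ∈ J, P.real (D j) * m.value₂ (y j) - ε ≤
      ∑ j ∈ J, P.real (D j) * max (m.value₂ (y j) - ε) 0 := by
    calc ∑ j ∈ J, P.real (D j) * m.value₂ (y j) - ε
        ≤ ∑ j ∈ J, P.real (D j) * m.value₂ (y j) - (∑ j ∈ J, P.real (D j)) * ε := by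
          have := mul_le_mul_of_nonneg_right hP1 hε.le
          linarith
      _ = ∑ j ∈ J, P.real (D j) * (m.value₂ (y j) - ε) := by
          rw [Finset.sum_mul, ← Finset.sum_sub_distrib]
          exact Finset.sum_congr rfl fun j _ => by ring
      _ ≤ _ := Finset.sum_le_sum fun j _ => mul_le_mul_of_nonneg_left (le_max_left _ _) measureReal_nonneg
  have h3 := mul_le_mul_of_nonneg_left hle (Real.exp_nonneg (-m.q * h))
  have h4 := mul_le_mul_of_nonneg_right hexp hε.le
  rw [mul_sub] at h3
  linarith

end TwoBranchModel

namespace TwoBranchModel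

variable {Ω : Type*} [MeasurableSpace Ω] {P : Measure Ω} [IsProbabilityMeasure P]
  (m : TwoBranchModel P)

variable {m}

/-! ### The growth bound from optimality -/

lemma exp_le_prob_totalClaims_zero (h : ℝ≥0) :
    Real.exp (-m.lam * h) ≤ P.real {ω | m.totalClaims h ω ∈ ({0} : Set ℝ)} := by
  rw [measureReal_def, ← ENNReal.ofReal_le_iff_le_toReal (measure_ne_top _ _), ← m.prob_lt_wait 0]
  refine measure_mono_ae ?_
  filter_upwards [m.ae_isRegularMarks] with ω hω hωh
  exact hω.claimPath_of_lt hωh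

/-- The event is reduced to a product of independent ones: first waiting time at most h, second
waiting time above h, and first claim in B. Exactly one claim has then occurred by h. -/
lemma le_prob_totalClaims_mem (h : ℝ≥0) {B : Set ℝ} (hB : MeasurableSet B) :
    Real.exp (-m.lam * h) * (1 - Real.exp (-m.lam * h)) * m.G.real B ≤
      P.real {ω | m.totalClaims h ω ∈ B} := by
  have hexp : 0 ≤ 1 - Real.exp (-m.lam * h) := by
    rw [sub_nonneg, Real.exp_le_one_iff]
    have := mul_nonneg m.lam_pos.le h.coe_nonneg
    linarith
  rw [measureReal_def, measureReal_def, ← ENNReal.ofReal_le_iff_le_toReal (measure_ne_top _ _),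
    ENNReal.ofReal_mul (mul_nonneg (Real.exp_nonneg _) hexp), ENNReal.ofReal_mul (Real.exp_nonneg _),
    ENNReal.ofReal_toReal (measure_ne_top _ _)]
  set sets : ℕ ⊕ ℕ → Set ℝ := Sum.elim (fun i => if i = 0 then Set.Iic (h : ℝ) else Set.Ioi (h : ℝ)) fun _ => B
  have hI := m.indep.measure_inter_preimage_eq_mul {Sum.inl 1, Sum.inl 0, Sum.inr 0} (sets := sets) (by
    intro i hi
    rcases i with i | i
    · by_cases h0 : i = 0
      · simp [sets, h0]
      · simp [sets, h0]
    · exact hB)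
  have h1 : P {ω | m.claim 0 ω ∈ B} = m.G B := by
    rw [← (m.law_claim 0).map_eq, Measure.map_apply (m.measurable_claim 0) hB]
    rfl
  have hne1 : (Sum.inl 1 : ℕ ⊕ ℕ) ∉ ({Sum.inl 0, Sum.inr 0} : Finset (ℕ ⊕ ℕ)) := by simp
  have hne2 : (Sum.inl 0 : ℕ ⊕ ℕ) ∉ ({Sum.inr 0} : Finset (ℕ ⊕ ℕ)) := by simp
  rw [Finset.prod_insert hne1, Finset.prod_insert hne2, Finset.prod_singleton] at hI
  have e1 : P (Sum.elim m.wait m.claim (Sum.inl 1) ⁻¹' sets (Sum.inl 1)) =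
      ENNReal.ofReal (Real.exp (-m.lam * h)) := m.prob_lt_wait 1 h
  have e2 : P (Sum.elim m.wait m.claim (Sum.inl 0) ⁻¹' sets (Sum.inl 0)) =
      ENNReal.ofReal (1 - Real.exp (-m.lam * h)) := m.prob_wait_le 0 h
  have e3 : P (Sum.elim m.wait m.claim (Sum.inr 0) ⁻¹' sets (Sum.inr 0)) = m.G B := h1
  rw [e1, e2, e3, ← mul_assoc] at hI
  rw [← hI]
  refine measure_mono_ae ?_
  filter_upwards [m.ae_isRegularMarks] with ω hω hmem
  have hmem' : ∀ i ∈ ({Sum.inl 1, Sum.inl 0, Sum.inr 0} : Finset (ℕ ⊕ ℕ)),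
    m.marks ω i ∈ sets i := fun i hi => Set.mem_iInter₂.1 hmem i hi
  have m1 : (h : ℝ) < m.marks ω (Sum.inl 1) := hmem' (Sum.inl 1) (by simp)
  have m2 : m.marks ω (Sum.inl 0) ≤ h := hmem' (Sum.inl 0) (by simp)
  have m3 : m.marks ω (Sum.inr 0) ∈ B := hmem' (Sum.inr 0) (by simp)
  have : m.totalClaims h ω = m.marks ω (Sum.inr 0) :=
    hω.claimPath_of_mem m2 (by linarith [hω.wait_pos 0])
  change m.totalClaims h ω ∈ B
  rwa [this]

/-- The claim sizes which bring the level `z` into the `j`-th interval of length `d`. -/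
def claimCell (b z d : ℝ) (j : ℕ) : Set ℝ := {s | 0 < s ∧ j * d ≤ z - b * s ∧ z - b * s < (j + 1) * d}

lemma measurableSet_claimCell (b z d : ℝ) (j : ℕ) : MeasurableSet (claimCell b z d j) := by
  have hv : Measurable fun s : ℝ => z - b * s := by fun_prop
  exact (measurableSet_lt measurable_const measurable_id).inter
    ((measurableSet_le (measurable_const (a := (j : ℝ) * d)) hv).inter
      (measurableSet_lt hv (measurable_const (a := ((j : ℝ) + 1) * d))))

lemma disjoint_claimCell {b z d : ℝ} (hd : 0 < d) {i j : ℕ} (hij : i ≠ j) :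
    Disjoint (claimCell b z d i) (claimCell b z d j) := by
  have key : ∀ {i j : ℕ}, i < j → ∀ s, s ∈ claimCell b z d i → s ∉ claimCell b z d j := by
    intro i j hij s hi hj
    have h1 : ((i : ℝ) + 1) * d ≤ j * d := mul_le_mul_of_nonneg_right (by exact_mod_cast hij) hd.le
    linarith [hi.2.2, hj.2.1]
  refine Set.disjoint_left.2 fun s hi hj => ?_
  rcases hij.lt_or_gt with h | h
  · exact key h s hi hj
  · exact key h s hj hi

/-- The level after the claim is rounded down to a multiple of z/(n + 1); the Lipschitz estimate for
W controls the loss. Only finitely many levels remain, as the discretised strategies require. -/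
lemma claimValue_le_sum {z : ℝ} (hz : 0 < z) (n : ℕ) :
    m.claimValue z ≤ ∑ j ∈ Finset.range (n + 1), m.G.real (claimCell m.b₂ z (z / (n + 1)) j) *
      m.value₂ (j * (z / (n + 1))) + (m.lam + m.q) / m.c₂ * m.value₂ z * (z / (n + 1)) := by
  classical
  set d := z / ((n : ℝ) + 1)
  have hd : 0 < d := by positivity
  have hnd : ((n : ℝ) + 1) * d = z := by simp only [d]; field_simp
  have hc : 0 ≤ (m.lam + m.q) / m.c₂ := div_nonneg (add_pos m.lam_pos m.q_pos).le m.c₂_pos.le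
  set η := (m.lam + m.q) / m.c₂ * m.value₂ z * d
  have hη : 0 ≤ η := mul_nonneg (mul_nonneg hc (value₂_nonneg _)) hd.le
  set F : ℝ → ℝ := fun α => ∑ j ∈ Finset.range (n + 1),
    (claimCell m.b₂ z d j).indicator (fun _ => m.value₂ (j * d)) α
  have hF0 : ∀ α, 0 ≤ F α := fun α => Finset.sum_nonneg fun j _ =>
    Set.indicator_nonneg (fun _ _ => value₂_nonneg _) _
  have hFint : ∀ j ∈ Finset.range (n + 1), Integrable
      (fun α => (claimCell m.b₂ z d j).indicator (fun _ => m.value₂ (j * d)) α) m.G := fun j _ =>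
    (integrable_const _).indicator (measurableSet_claimCell _ _ _ _)
  have hle : ∀ᵐ α ∂m.G, m.value₂ (z - m.b₂ * α) ≤ F α + η := by
    filter_upwards [m.G_pos] with α hα
    rcases lt_or_ge (z - m.b₂ * α) 0 with hneg | hnn
    · rw [value₂_of_neg hneg]
      exact add_nonneg (hF0 α) hη
    · set v := z - m.b₂ * α
      have hvz : v < z := by
        have := mul_pos m.b₂_pos hα
        simp only [v]
        linarith
      set j := ⌊v / d⌋₊
      have hj1 : (j : ℝ) * d ≤ v := by
        have := Nat.floor_le (div_nonneg hnn hd.le)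
        rwa [le_div_iff₀ hd] at this
      have hj2 : v < (j + 1) * d := by
        have := Nat.lt_floor_add_one (v / d)
        rwa [div_lt_iff₀ hd] at this
      have hjn : j < n + 1 := by
        rw [Nat.floor_lt (div_nonneg hnn hd.le), div_lt_iff₀ hd]
        push_cast
        linarith
      have hFj : m.value₂ (j * d) ≤ F α := by
        have h1 := Finset.single_le_sum (f := fun j : ℕ =>
          (claimCell m.b₂ z d j).indicator (fun _ => m.value₂ (j * d)) α)
          (fun j _ => Set.indicator_nonneg (fun _ _ => value₂_nonneg _) _) (Finset.mem_range.2 hjn)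
        have hmem : α ∈ claimCell m.b₂ z d j := ⟨hα, hj1, hj2⟩
        simp only [Set.indicator_of_mem hmem] at h1
        exact h1
      have h2 := value₂_sub_le (m := m) (mul_nonneg (Nat.cast_nonneg j) hd.le) hj1
      have h3 : (m.lam + m.q) / m.c₂ * m.value₂ v * (v - j * d) ≤ η := by
        refine mul_le_mul (mul_le_mul_of_nonneg_left (value₂_mono hvz.le) hc) (by linarith)
          (by linarith) (mul_nonneg hc (value₂_nonneg _))
      linarith
  have hint := integral_mono_ae (integrable_claimValue z)
    ((integrable_finsetSum _ hFint).add (integrable_const η)) hle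
  refine (show m.claimValue z ≤ _ from hint).trans_eq ?_
  have e1 : ∫ α, (F α + η) ∂m.G = ∫ α, F α ∂m.G + η := by
    rw [integral_add (integrable_finsetSum _ hFint) (integrable_const η), integral_const, probReal_univ,
      one_smul]
  refine e1.trans ?_
  congr 1
  rw [integral_finsetSum _ hFint]
  refine Finset.sum_congr rfl fun j _ => ?_
  rw [integral_indicator (measurableSet_claimCell _ _ _ _), setIntegral_const, smul_eq_mul]

/-- Without claims by time h one continues on 𝓜 from z + fh; after one claim, from the grid point
below z - b₂α, the premiums earned up to h being paid out. The grid is then refined. -/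
lemma le_optimalValue_dynamic {z : ℝ} (hz : 0 < z) (h : ℝ≥0) :
    Real.exp (-m.q * h) * (Real.exp (-m.lam * h) * m.value₂ (z + m.fastRate * h) +
      Real.exp (-m.lam * h) * (1 - Real.exp (-m.lam * h)) * m.claimValue z) ≤
      m.optimalValue (m.b₁ / m.b₂ * z, z + (m.fastRate - m.c₂) * h) := by
  have hfh := mul_nonneg m.fastRate_pos.le h.coe_nonneg
  set p := Real.exp (-m.lam * h)
  have hp0 : 0 ≤ p := Real.exp_nonneg _
  have hp1 : p ≤ 1 := by
    rw [Real.exp_le_one_iff]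
    have := mul_nonneg m.lam_pos.le h.coe_nonneg
    linarith
  have hpp : 0 ≤ p * (1 - p) := mul_nonneg hp0 (by linarith)
  set C := (m.lam + m.q) / m.c₂ * m.value₂ z
  have hn : ∀ n : ℕ, Real.exp (-m.q * h) * (p * m.value₂ (z + m.fastRate * h) +
      p * (1 - p) * (m.claimValue z - C * (z / (n + 1)))) ≤
      m.optimalValue (m.b₁ / m.b₂ * z, z + (m.fastRate - m.c₂) * h) := by
    intro n
    set d := z / ((n : ℝ) + 1)
    have hd : 0 < d := by positivity
    -- The index `none` stands for no claims, with continuation level z + fh; the other indices are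
    -- the grid cells.
    set B : Option ℕ → Set ℝ := fun j => j.elim {0} (claimCell m.b₂ z d)
    set y : Option ℕ → ℝ := fun j => j.elim (z + m.fastRate * h) fun j => j * d
    have hmain := sum_mul_value₂_le_optimalValue (m := m) hz.le h (Finset.range (n + 1)).insertNone
      (B := B) (y := y) (by
        rintro (_ | j)
        · exact measurableSet_singleton _
        · exact measurableSet_claimCell _ _ _ _) (by
        rintro (_ | i) (_ | j) hij
        · exact absurd rfl hij
        · exact Set.disjoint_left.2 fun s hs hs' => hs'.1.ne' hs
        · exact Set.disjoint_left.2 fun s hs hs' => hs.1.ne' hs'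
        · exact disjoint_claimCell hd fun h => hij (congrArg some h)) (by
        rintro (_ | j)
        · exact add_nonneg hz.le hfh
        · exact mul_nonneg (Nat.cast_nonneg j) hd.le) (by
        rintro (_ | j) s hs
        · have : s = 0 := hs
          simp [this, y, hz.le]
        · have h1 := hs.2.1
          have h2 : 0 ≤ (j : ℝ) * d := mul_nonneg (Nat.cast_nonneg j) hd.le
          refine ⟨hs.1.le, by linarith, ?_⟩
          simp only [y, Option.elim]
          linarith)
    refine le_trans ?_ hmain
    refine mul_le_mul_of_nonneg_left ?_ (Real.exp_nonneg _)
    rw [Finset.sum_insertNone]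
    refine add_le_add (mul_le_mul_of_nonneg_right (exp_le_prob_totalClaims_zero h) (value₂_nonneg _)) ?_
    have h3 := claimValue_le_sum (m := m) hz n
    calc p * (1 - p) * (m.claimValue z - C * d)
        ≤ p * (1 - p) * ∑ j ∈ Finset.range (n + 1), m.G.real (claimCell m.b₂ z d j) * m.value₂ (j * d) :=
          mul_le_mul_of_nonneg_left (by linarith) hpp
      _ = ∑ j ∈ Finset.range (n + 1), p * (1 - p) * m.G.real (claimCell m.b₂ z d j) * m.value₂ (j * d) := by
          rw [Finset.mul_sum]
          exact Finset.sum_congr rfl fun j _ => by ring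
      _ ≤ _ := Finset.sum_le_sum fun j _ => mul_le_mul_of_nonneg_right
          (le_prob_totalClaims_mem h (measurableSet_claimCell _ _ _ _)) (value₂_nonneg _)
  have hlim : Filter.Tendsto (fun n : ℕ => Real.exp (-m.q * h) * (p * m.value₂ (z + m.fastRate * h) +
      p * (1 - p) * (m.claimValue z - C * (z / (n + 1))))) Filter.atTop
      (nhds (Real.exp (-m.q * h) * (p * m.value₂ (z + m.fastRate * h) +
        p * (1 - p) * (m.claimValue z - C * 0)))) := by
    have h0 : Filter.Tendsto (fun n : ℕ => z / ((n : ℝ) + 1)) Filter.atTop (nhds 0) := by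
      have := (tendsto_one_div_add_atTop_nhds_zero_nat (𝕜 := ℝ)).const_mul z
      simpa [div_eq_mul_inv] using this
    exact ((((h0.const_mul C).const_sub _).const_mul _).const_add _).const_mul _
  rw [mul_zero, sub_zero] at hlim
  exact le_of_tendsto' hlim hn

/-- If the half line value is optimal, then the one-dimensional value function grows at most as fast as
on a half line with the premium rate `fastRate`. -/
lemma value₂_sub_le_of_optimal (hV : ∀ x ∈ openQuadrant, m.halfLineValue x = m.optimalValue x)
    {a b M : ℝ} (ha : 0 < a) (hab : a < b)
    (hM : ∀ z ∈ Set.Icc a b, m.slope - m.premiumOperator z / m.fastRate ≤ M) :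
    m.value₂ b - m.value₂ a ≤ M * (b - a) := by
  have hf := m.fastRate_pos
  -- If Ṽ is optimal, its value (f - c₂)h + W(z) at the starting point dominates the value of
  -- waiting; the inequality is solved for W(z + fh).
  have hstep : ∀ z, 0 < z → ∀ h : ℝ≥0, m.value₂ (z + m.fastRate * h) - m.value₂ z ≤
      Real.exp ((m.q + m.lam) * h) * ((m.fastRate - m.c₂) * h + m.value₂ z) -
        (1 - Real.exp (-m.lam * h)) * m.claimValue z - m.value₂ z := by
    intro z hz h
    have hch := mul_nonneg (sub_nonneg.2 (c₂_le_fastRate (m := m))) h.coe_nonneg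
    have hx : (m.b₁ / m.b₂ * z, z + (m.fastRate - m.c₂) * h) ∈ openQuadrant :=
      ⟨mul_pos m.ratio_pos hz, add_pos_of_pos_of_nonneg hz hch⟩
    have h1 := le_optimalValue_dynamic (m := m) hz h
    have hs : m.b₂ / m.b₁ * (m.b₁ / m.b₂ * z) = z := by
      rw [← mul_assoc, mul_comm (m.b₂ / m.b₁), ratio_mul, one_mul]
    rw [← hV _ hx, halfLineValue_of_le (openQuadrant_subset_closedQuadrant hx)
      (by simp only [hs]; linarith)] at h1
    simp only [hs] at h1
    have h2 := mul_le_mul_of_nonneg_left h1 (Real.exp_nonneg ((m.q + m.lam) * h))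
    have e : Real.exp ((m.q + m.lam) * h) * (Real.exp (-m.q * h) * Real.exp (-m.lam * h)) = 1 := by
      rw [← Real.exp_add, ← Real.exp_add, Real.exp_eq_one_iff]
      ring
    have e2 : Real.exp ((m.q + m.lam) * h) * (Real.exp (-m.q * h) *
        (Real.exp (-m.lam * h) * m.value₂ (z + m.fastRate * h) +
        Real.exp (-m.lam * h) * (1 - Real.exp (-m.lam * h)) * m.claimValue z)) =
        (Real.exp ((m.q + m.lam) * h) * (Real.exp (-m.q * h) * Real.exp (-m.lam * h))) *
          (m.value₂ (z + m.fastRate * h) + (1 - Real.exp (-m.lam * h)) * m.claimValue z) := by ring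
    rw [e2, e, one_mul] at h2
    have e3 : z + (m.fastRate - m.c₂) * ↑h - z = (m.fastRate - m.c₂) * h := by ring
    rw [e3] at h2
    linarith
  -- The comparison theorem for right lower derivatives requires a strict inequality of slopes, so M
  -- is enlarged by ε.
  suffices hε : ∀ ε > 0, m.value₂ b ≤ m.value₂ a + (M + ε) * (b - a) by
    have hlim : Filter.Tendsto (fun ε => m.value₂ a + (M + ε) * (b - a)) (nhdsWithin 0 (Set.Ioi 0))
        (nhds (m.value₂ a + (M + 0) * (b - a))) := by
      have hc : Continuous fun ε : ℝ => m.value₂ a + (M + ε) * (b - a) := by fun_prop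
      exact (hc.tendsto 0).mono_left nhdsWithin_le_nhds
    have := ge_of_tendsto hlim (by filter_upwards [self_mem_nhdsWithin] with ε h using hε ε h)
    linarith
  intro ε hε
  have hB : ∀ x, HasDerivAt (fun z => m.value₂ a + (M + ε) * (z - a)) (M + ε) x := fun x => by
    simpa using (((hasDerivAt_id x).sub_const a).const_mul (M + ε)).const_add (m.value₂ a)
  refine image_le_of_liminf_slope_right_lt_deriv_boundary' (f := m.value₂)
    (f' := fun z => m.slope - m.premiumOperator z / m.fastRate)
    (B := fun z => m.value₂ a + (M + ε) * (z - a)) (B' := fun _ => M + ε)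
    (continuousOn_value₂.mono fun z hz => ha.le.trans hz.1) ?_ (by simp)
    (Continuous.continuousOn (by fun_prop)) (fun x _ => (hB x).hasDerivWithinAt)
    (fun x hx _ => by have := hM x (Set.Ico_subset_Icc_self hx); linarith) ⟨hab.le, le_rfl⟩
  intro z hz r hr
  have hz0 : 0 < z := ha.trans_le hz.1
  -- The bound of `hstep` as a function of the endpoint x = z + fh. It vanishes at z, and its
  -- derivative there is the claimed one because c₁/f = κ.
  set ψ : ℝ → ℝ := fun x => Real.exp ((m.q + m.lam) * ((x - z) / m.fastRate)) *
      ((m.fastRate - m.c₂) * ((x - z) / m.fastRate) + m.value₂ z) -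
        (1 - Real.exp (-m.lam * ((x - z) / m.fastRate))) * m.claimValue z - m.value₂ z
  have hψ0 : ψ z = 0 := by simp [ψ]
  have hψ : HasDerivAt ψ (m.slope - m.premiumOperator z / m.fastRate) z := by
    have hu : HasDerivAt (fun x => (x - z) / m.fastRate) (1 / m.fastRate) z :=
      ((hasDerivAt_id z).sub_const z).div_const _
    have h1 := (hu.const_mul (m.q + m.lam)).exp
    have h2 := (hu.const_mul (m.fastRate - m.c₂)).add_const (m.value₂ z)
    have h3 := ((hu.const_mul (-m.lam)).exp.const_sub 1).mul_const (m.claimValue z)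
    refine (((h1.mul h2).sub h3).sub_const (m.value₂ z)).congr_deriv ?_
    rw [premiumOperator_eq]
    have e := fastRate_mul_ratio (m := m)
    have e' : m.slope * m.fastRate = m.fastRate + m.c₁ := by
      unfold slope
      linarith
    simp only [sub_self, zero_div, mul_zero, Real.exp_zero, zero_add]
    field_simp
    linarith
  have hev : ∀ᶠ x in nhdsWithin z (Set.Ioi z), _root_.slope ψ z x < r := by
    have h1 := (hasDerivAt_iff_tendsto_slope.1 hψ).mono_left
      (nhdsWithin_mono z fun x (hx : z < x) => hx.ne')
    exact h1.eventually (gt_mem_nhds hr)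
  refine Filter.Eventually.frequently ?_
  filter_upwards [hev, self_mem_nhdsWithin] with x hx hzx
  refine lt_of_le_of_lt ?_ hx
  have hzx' : 0 < x - z := sub_pos.2 hzx
  rw [slope_def_field, slope_def_field, hψ0]
  refine div_le_div_of_nonneg_right ?_ hzx'.le
  obtain ⟨h, hh⟩ : ∃ h : ℝ≥0, (h : ℝ) = (x - z) / m.fastRate := ⟨⟨_, (div_pos hzx' hf).le⟩, rfl⟩
  have h1 := hstep z hz0 h
  rw [hh, mul_div_cancel₀ _ hf.ne', add_sub_cancel] at h1
  simp only [ψ]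
  linarith

end TwoBranchModel

namespace TwoBranchModel

variable {Ω : Type*} [MeasurableSpace Ω] {P : Measure Ω} [IsProbabilityMeasure P]
  (m : TwoBranchModel P)

variable {m}

/-! ### Short time expansion of the one-dimensional value function -/

/-- For an initial surplus `y` and a strategy whose dividends up to time `h` amount to `ℓ` if there are
no claims, the expected reward splits according to the number of claims up to time `h`. -/
lemma payoff₂_le_of_short_time {y : ℝ} (hy : 0 ≤ y) (h : ℝ≥0) {σ : PathStrategy}
    (hσ : ∀ᵐ ω ∂P, ∀ t, σ.val 0 (m.claims ω) t ≤ y + m.c₂ * t) :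
    m.payoff₂ y (fun t ω => σ.val 0 (m.claims ω) t) ≤
      ENNReal.ofReal (Real.exp (-m.lam * h) * (m.rate * h + m.slope * σ.val 0 0 h +
          Real.exp (-m.q * h) * m.value₂ (y + m.c₂ * h - σ.val 0 0 h)) +
        (1 - Real.exp (-m.lam * h)) * (m.rate * h + m.slope * σ.val 0 0 h + m.claimValue (y + m.c₂ * h)) +
        (1 - Real.exp (-m.lam * h)) ^ 2 *
          (m.rate * h + m.slope * (y + m.c₂ * h) + m.value₂ (y + m.c₂ * h))) := by
  classical
  set p := Real.exp (-m.lam * h)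
  have hp0 : 0 ≤ p := Real.exp_nonneg _
  have hp1 : 0 ≤ 1 - p := by
    rw [sub_nonneg, Real.exp_le_one_iff]
    have := mul_nonneg m.lam_pos.le h.coe_nonneg
    linarith
  have heq : Real.exp (-m.q * h) ≤ 1 := by
    rw [Real.exp_le_one_iff]
    have := mul_nonneg m.q_pos.le h.coe_nonneg
    linarith
  have heq0 := Real.exp_nonneg (-m.q * h)
  set ℓ := σ.val 0 0 h
  have hℓ : 0 ≤ ℓ := σ.val_nonneg _ _ _
  set v := y + m.c₂ * h
  have hv : 0 ≤ v := add_nonneg hy (mul_nonneg m.c₂_pos.le h.coe_nonneg)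
  have hr := mul_nonneg m.rate_nonneg h.coe_nonneg
  have hk := m.slope_pos
  have hkℓ := mul_nonneg hk.le hℓ
  set Φ : Ω → ℝ≥0∞ := fun ω => ENNReal.ofReal (m.rate * h + m.slope * σ.val 0 (m.claims ω)
      (stopAt (ruinOf (m.level y (m.claims ω) (σ.val 0 (m.claims ω)))) h)) +
    ENNReal.ofReal (Real.exp (-m.q * h)) *
      m.valueSup (y + m.c₂ * h - m.b₂ * m.claims ω h - σ.val 0 (m.claims ω) h)
  set A : Set Ω := {ω | m.wait 0 ω ≤ h}
  have hA : MeasurableSet A := measurableSet_le (m.measurable_wait 0) measurable_const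
  set A' : Set Ω := {ω | m.wait 1 ω ≤ h}
  have hA' : MeasurableSet A' := measurableSet_le (m.measurable_wait 1) measurable_const
  have hPA : P A = ENNReal.ofReal (1 - p) := m.prob_wait_le 0 h
  have hPA0 : P Aᶜ = ENNReal.ofReal p := by
    rw [← m.prob_lt_wait 0 h]
    congr 1
    ext ω
    simp [A]
  -- A crude bound for the rare case of two short waiting times; its probability is of order h², so
  -- it does not enter the first order expansion.
  set C := m.rate * h + m.slope * v + m.value₂ v
  have hC : 0 ≤ C := add_nonneg (add_nonneg hr (mul_nonneg hk.le hv)) (value₂_nonneg _)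
  have hval : ∀ ω, IsRegularMarks (m.marks ω) → ∀ t : ℝ≥0, (t : ℝ) ≤ m.wait 0 ω →
      σ.val 0 (m.claims ω) t = σ.val 0 0 t := fun ω hω t ht => σ.val_congr fun r hr => by
    have : (r : ℝ) < m.marks ω (Sum.inl 0) := lt_of_lt_of_le (by exact_mod_cast hr) ht
    exact hω.claimPath_of_lt this
  have hΦ0 : ∀ᵐ ω ∂P, ω ∈ Aᶜ → Φ ω ≤ ENNReal.ofReal (m.rate * h + m.slope * ℓ +
      Real.exp (-m.q * h) * m.value₂ (v - ℓ)) := by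
    filter_upwards [m.ae_isRegularMarks] with ω hω hωA
    have hw : (h : ℝ) < m.wait 0 ω := not_le.1 hωA
    have hS : m.claims ω h = 0 := hω.claimPath_of_lt hw
    have hL := hval ω hω h hw.le
    simp only [Φ, hS, hL, mul_zero, sub_zero]
    rw [valueSup_eq, ← ENNReal.ofReal_mul heq0, ENNReal.ofReal_add (add_nonneg hr hkℓ)
      (mul_nonneg heq0 (value₂_nonneg _))]
    refine add_le_add_left (ENNReal.ofReal_le_ofReal ?_) _
    have := σ.val_mono 0 (m.claims ω) (stopAt_le_left (ruinOf (m.level y (m.claims ω)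
      (σ.val 0 (m.claims ω)))) h)
    rw [hL] at this
    have := mul_le_mul_of_nonneg_left this hk.le
    linarith
  -- If the second waiting time is at most h, the crude bound C is used, whether or not the second
  -- claim arrives by h. Otherwise there is exactly one claim.
  have hΦ1 : ∀ᵐ ω ∂P, ω ∈ A → Φ ω ≤ ENNReal.ofReal (m.rate * h + m.slope * ℓ) +
      m.valueSup (v - m.b₂ * m.claim 0 ω) + A'.indicator (fun _ => ENNReal.ofReal C) ω := by
    filter_upwards [m.ae_isRegularMarks, hσ] with ω hω hσω hωA
    set T := ruinOf (m.level y (m.claims ω) (σ.val 0 (m.claims ω)))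
    set L := σ.val 0 (m.claims ω)
    have hLmono : Monotone L := σ.val_mono _ _
    by_cases hω' : ω ∈ A'
    · rw [Set.indicator_of_mem hω']
      refine le_trans ?_ le_add_self
      have h1 : L (stopAt T h) ≤ v := (hLmono (stopAt_le_left T h)).trans (hσω h)
      have h2 := mul_le_mul_of_nonneg_left h1 hk.le
      have h3 : m.value₂ (y + m.c₂ * h - m.b₂ * m.claims ω h - L h) ≤ m.value₂ v := by
        refine value₂_mono ?_
        have := mul_nonneg m.b₂_pos.le (hω.claimPath_nonneg h)
        have := σ.val_nonneg 0 (m.claims ω) h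
        change y + m.c₂ * h - m.b₂ * claimPath (m.marks ω) h - L h ≤ y + m.c₂ * h
        linarith
      simp only [Φ]
      rw [valueSup_eq, ← ENNReal.ofReal_mul heq0, ← ENNReal.ofReal_add
        (add_nonneg hr (mul_nonneg hk.le (σ.val_nonneg _ _ _))) (mul_nonneg heq0 (value₂_nonneg _))]
      refine ENNReal.ofReal_le_ofReal ?_
      have h4 := mul_le_mul heq h3 (value₂_nonneg _) zero_le_one
      rw [one_mul] at h4
      exact add_le_add (add_le_add le_rfl h2) h4
    · rw [Set.indicator_of_notMem hω', add_zero]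
      have hw0 : m.marks ω (Sum.inl 0) ≤ h := hωA
      have hw1 : (h : ℝ) < m.marks ω (Sum.inl 1) := not_le.1 hω'
      have hwp := hω.wait_pos 0
      have hclaim : ∀ t : ℝ≥0, m.marks ω (Sum.inl 0) ≤ t → t ≤ h → m.claims ω t = m.claim 0 ω :=
        fun t ht hth => hω.claimPath_of_mem ht (by
          have : (t : ℝ) ≤ h := by exact_mod_cast hth
          linarith)
      have hS : m.claims ω h = m.claim 0 ω := hclaim h hw0 le_rfl
      set v' := v - m.b₂ * m.claim 0 ω
      -- Before the claim the dividends follow the path without claims and are at most ℓ; after it,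
      -- being still solvent forces them below v'.
      have hLmax : L (stopAt T h) ≤ max ℓ v' := by
        refine le_of_le_of_forall_lt (v := fun _ => max ℓ v') (σ.val_leftCont _ _) continuous_const
          ?_ (T := stopAt T h) (fun t ht => ?_) le_rfl
        · rw [σ.val_zero]
          exact hℓ.trans (le_max_left _ _)
        · have htT : (t : ℝ≥0∞) < T := ht.trans_le (stopAt_le_right T h)
          have hth : t ≤ h := (ENNReal.coe_lt_coe.1 ht).le.trans (stopAt_le_left T h)
          rcases le_total (t : ℝ) (m.marks ω (Sum.inl 0)) with htw | htw
          · refine le_trans ?_ (le_max_left _ _)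
            change σ.val 0 (m.claims ω) t ≤ ℓ
            rw [hval ω hω t htw]
            exact σ.val_mono _ _ hth
          · refine le_trans ?_ (le_max_right _ _)
            have h1 := nonneg_of_lt_ruinOf htT
            simp only [level, hclaim t htw hth] at h1
            have h2 := mul_le_mul_of_nonneg_left (NNReal.coe_le_coe.2 hth) m.c₂_pos.le
            simp only [v', v]
            linarith
      simp only [Φ, hS]
      rw [valueSup_eq, valueSup_eq, ← ENNReal.ofReal_mul heq0, ← ENNReal.ofReal_add
        (add_nonneg hr (mul_nonneg hk.le (σ.val_nonneg _ _ _))) (mul_nonneg heq0 (value₂_nonneg _)),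
        ← ENNReal.ofReal_add (add_nonneg hr hkℓ) (value₂_nonneg _)]
      refine ENNReal.ofReal_le_ofReal ?_
      change m.rate * h + m.slope * L (stopAt T h) + Real.exp (-m.q * h) * m.value₂ (v' - L h) ≤
        m.rate * h + m.slope * ℓ + m.value₂ v'
      -- If nothing is left at h, the continuation value is 0 and the previous bound suffices.
      -- Otherwise the dividends and the continuation are together worth at most W(v'), since they
      -- could be paid as a lump sum.
      rcases lt_or_ge (v' - L h) 0 with hneg | hnn
      · rw [value₂_of_neg hneg, mul_zero, add_zero]
        have h1 := mul_le_mul_of_nonneg_left hLmax hk.le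
        have h2 : m.slope * max ℓ v' ≤ m.slope * ℓ + m.value₂ v' := by
          rcases le_total v' ℓ with hle | hle
          · rw [max_eq_left hle]
            linarith [value₂_nonneg (m := m) v']
          · rw [max_eq_right hle]
            have h3 := value₂_add_le (m := m) le_rfl (hℓ.trans hle)
            rw [zero_add] at h3
            linarith [value₂_nonneg (m := m) 0]
        linarith
      · have h1 := mul_le_mul_of_nonneg_left (hLmono (stopAt_le_left T h)) hk.le
        have h2 := value₂_add_le (m := m) hnn (σ.val_nonneg 0 (m.claims ω) h)
        rw [sub_add_cancel] at h2
        have h3 := mul_le_mul_of_nonneg_right heq (value₂_nonneg (m := m) (v' - L h))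
        change m.value₂ (v' - L h) + m.slope * L h ≤ m.value₂ v' at h2
        linarith
  have hI0 : ∫⁻ ω in Aᶜ, Φ ω ∂P ≤ ENNReal.ofReal (p * (m.rate * h + m.slope * ℓ +
      Real.exp (-m.q * h) * m.value₂ (v - ℓ))) := by
    refine (lintegral_mono_ae ((ae_restrict_iff' hA.compl).2 hΦ0)).trans_eq ?_
    rw [setLIntegral_const, hPA0, mul_comm, ← ENNReal.ofReal_mul hp0]
  have hI1 : ∫⁻ ω in A, Φ ω ∂P ≤ ENNReal.ofReal ((1 - p) * (m.rate * h + m.slope * ℓ + m.claimValue v) +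
      (1 - p) ^ 2 * C) := by
    refine (lintegral_mono_ae ((ae_restrict_iff' hA).2 hΦ1)).trans_eq ?_
    have hVm : Measurable m.valueSup := by
      have : m.valueSup = fun y => ENNReal.ofReal (m.value₂ y) := funext valueSup_eq
      rw [this]
      exact ENNReal.measurable_ofReal.comp measurable_value₂
    have hfm : Measurable fun α => m.valueSup (v - m.b₂ * α) := hVm.comp (by fun_prop)
    rw [lintegral_add_right _ (measurable_const.indicator hA'), lintegral_add_left measurable_const,
      setLIntegral_const, m.setLIntegral_claim h hfm, ← ofReal_claimValue, lintegral_indicator hA',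
      Measure.restrict_restrict hA', setLIntegral_const, Set.inter_comm, m.prob_two_waits_le, hPA]
    rw [← ENNReal.ofReal_mul (add_nonneg hr hkℓ), ← ENNReal.ofReal_mul hp1, ← ENNReal.ofReal_mul hC,
      ← ENNReal.ofReal_add (mul_nonneg (add_nonneg hr hkℓ) hp1) (mul_nonneg hp1 (claimValue_nonneg _)),
      ← ENNReal.ofReal_add (add_nonneg (mul_nonneg (add_nonneg hr hkℓ) hp1)
        (mul_nonneg hp1 (claimValue_nonneg _))) (mul_nonneg hC (sq_nonneg _))]
    congr 1
    ring
  refine (m.payoff₂_le_dynamic σ y h).trans ?_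
  rw [← lintegral_add_compl Φ hA, add_comm]
  refine (add_le_add hI0 hI1).trans_eq ?_
  rw [← ENNReal.ofReal_add, ← add_assoc]
  · exact mul_nonneg hp0 (add_nonneg (add_nonneg hr hkℓ) (mul_nonneg heq0 (value₂_nonneg _)))
  · exact add_nonneg (mul_nonneg hp1 (add_nonneg (add_nonneg hr hkℓ) (claimValue_nonneg _)))
      (mul_nonneg (sq_nonneg _) hC)

variable (m) in
/-- The upper bound for the expected reward when the dividends before the first claim up to time `h`
are `ℓ`. -/
def shortBound (y h ℓ : ℝ) : ℝ :=
  Real.exp (-m.lam * h) * (m.rate * h + m.slope * ℓ +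
      Real.exp (-m.q * h) * m.value₂ (y + m.c₂ * h - ℓ)) +
    (1 - Real.exp (-m.lam * h)) * (m.rate * h + m.slope * ℓ + m.claimValue (y + m.c₂ * h)) +
    (1 - Real.exp (-m.lam * h)) ^ 2 * (m.rate * h + m.slope * (y + m.c₂ * h) + m.value₂ (y + m.c₂ * h))

/-- Apply the expansion to a strategy within h² of the optimum, an error negligible to first order.
Without claims its dividends up to h are a deterministic number ℓ, the value on the zero path. -/
lemma exists_value₂_le_shortBound {y : ℝ} (hy : 0 ≤ y) {h : ℝ} (hh : 0 < h) :
    ∃ ℓ, 0 ≤ ℓ ∧ ℓ ≤ y + m.c₂ * h ∧ m.value₂ y ≤ h ^ 2 + m.shortBound y h ℓ := by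
  lift h to ℝ≥0 using hh.le
  obtain ⟨σ, hσ, hσy⟩ := exists_near_optimal (m := m) hy (ε := (h : ℝ) ^ 2) (by positivity)
  have hv : 0 ≤ y + m.c₂ * h := add_nonneg hy (mul_nonneg m.c₂_pos.le h.coe_nonneg)
  have hℓ := σ.val_nonneg 0 0 h
  refine ⟨σ.val 0 0 h, hℓ, ?_, ?_⟩
  -- The bound on dividends holds only almost surely; it transfers to the zero path because claims
  -- stay away until h with positive probability.
  · have hpos : P {ω | (h : ℝ) < m.wait 0 ω} ≠ 0 := by
      rw [m.prob_lt_wait]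
      exact (ENNReal.ofReal_pos.2 (Real.exp_pos _)).ne'
    have hfreq : ∃ᶠ ω in ae P, (h : ℝ) < m.wait 0 ω := frequently_ae_iff.2 hpos
    obtain ⟨ω, hw, hσω, hω⟩ := (hfreq.and_eventually (hσy.and m.ae_isRegularMarks)).exists
    refine le_trans (le_of_eq (σ.val_congr fun r hr => ?_)) (hσω h)
    have : (r : ℝ) < m.marks ω (Sum.inl 0) := lt_trans (by exact_mod_cast hr) hw
    exact (hω.claimPath_of_lt this).symm
  · have h1 := hσ.trans (payoff₂_le_of_short_time hy h hσy)
    have hp1 : 0 ≤ 1 - Real.exp (-m.lam * h) := by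
      rw [sub_nonneg, Real.exp_le_one_iff]
      have := mul_nonneg m.lam_pos.le h.coe_nonneg
      linarith
    have hr := mul_nonneg m.rate_nonneg h.coe_nonneg
    have hkℓ := mul_nonneg m.slope_pos.le hℓ
    have hnn : 0 ≤ m.shortBound y h (σ.val 0 0 h) :=
      add_nonneg (add_nonneg
        (mul_nonneg (Real.exp_nonneg _) (add_nonneg (add_nonneg hr hkℓ)
          (mul_nonneg (Real.exp_nonneg _) (value₂_nonneg _))))
        (mul_nonneg hp1 (add_nonneg (add_nonneg hr hkℓ) (claimValue_nonneg _))))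
        (mul_nonneg (sq_nonneg _) (add_nonneg (add_nonneg hr (mul_nonneg m.slope_pos.le hv))
          (value₂_nonneg _)))
    have h2 := (ENNReal.ofReal_le_ofReal_iff hnn).1 h1
    linarith

end TwoBranchModel

namespace TwoBranchModel

variable {Ω : Type*} [MeasurableSpace Ω] {P : Measure Ω} [IsProbabilityMeasure P]
  (m : TwoBranchModel P)

/-! ### Consequences of a growth bound for the one-dimensional value function -/

/-- The growth of the one-dimensional value function is bounded as if premiums came in at the rate
`fastRate` instead of `c₂`. -/
def HasFastGrowthBound : Prop := ∀ a b M : ℝ, 0 < a → a < b →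
  (∀ z ∈ Set.Icc a b, m.slope - m.premiumOperator z / m.fastRate ≤ M) →
    m.value₂ b - m.value₂ a ≤ M * (b - a)

variable {m}

namespace HasFastGrowthBound

lemma of_nonneg (H : m.HasFastGrowthBound) {a b M : ℝ} (ha : 0 ≤ a) (hab : a < b)
    (hM : ∀ z ∈ Set.Icc a b, m.slope - m.premiumOperator z / m.fastRate ≤ M) :
    m.value₂ b - m.value₂ a ≤ M * (b - a) := by
  rcases ha.eq_or_lt with rfl | ha
  · have h1 : Filter.Tendsto m.value₂ (nhdsWithin 0 (Set.Ioi 0)) (nhds (m.value₂ 0)) :=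
      (continuousOn_value₂ 0 (Set.mem_Ici.2 le_rfl)).mono_left (nhdsWithin_mono 0 Set.Ioi_subset_Ici_self)
    have h2 : Filter.Tendsto (fun x : ℝ => x) (nhdsWithin 0 (Set.Ioi 0)) (nhds 0) :=
      Filter.tendsto_id.mono_left nhdsWithin_le_nhds
    refine le_of_tendsto_of_tendsto (h1.const_sub (m.value₂ b)) ((h2.const_sub b).const_mul M) ?_
    filter_upwards [Ioo_mem_nhdsGT hab] with x hx
    exact H x b M hx.1 hx.2 fun z hz => hM z ⟨hx.1.le.trans hz.1, hz.2⟩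
  · exact H a b M ha hab hM

/-- Where Λ > 0, by continuity on a whole interval, the growth bound would force W to grow with
slope below 1 + κ, contradicting the possibility of paying a surplus at once. -/
lemma premiumOperator_nonpos (H : m.HasFastGrowthBound) {z : ℝ} (hz : 0 ≤ z) :
    m.premiumOperator z ≤ 0 := by
  by_contra! hpos
  have hc := continuousOn_premiumOperator (m := m) z hz
  have hev : ∀ᶠ x in nhdsWithin z (Set.Ici 0), m.premiumOperator z / 2 < m.premiumOperator x :=
    hc.eventually (lt_mem_nhds (by linarith))
  obtain ⟨δ, hδ, hball⟩ := Metric.mem_nhdsWithin_iff.1 hev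
  have hf := m.fastRate_pos
  have h1 := H (z + δ / 3) (z + 2 * δ / 3) (m.slope - m.premiumOperator z / 2 / m.fastRate) (by linarith)
    (by linarith) (fun x hx => by
      have hx0 : 0 ≤ x := by linarith [hx.1]
      have hmem : x ∈ Metric.ball z δ ∩ Set.Ici 0 := by
        refine ⟨?_, hx0⟩
        rw [Metric.mem_ball, Real.dist_eq, abs_lt]
        constructor <;> linarith [hx.1, hx.2]
      have := div_le_div_of_nonneg_right (le_of_lt (hball hmem)) hf.le
      linarith)
  have h2 := value₂_add_le (m := m) (y := z + δ / 3) (δ := δ / 3) (by linarith) (by linarith)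
  have e : z + δ / 3 + δ / 3 = z + 2 * δ / 3 := by ring
  have e' : z + 2 * δ / 3 - (z + δ / 3) = δ / 3 := by ring
  rw [e] at h2
  rw [e'] at h1
  have h3 : 0 < m.premiumOperator z / 2 / m.fastRate * (δ / 3) := by positivity
  linarith

/-- If lump sums of size `η` are small compared to the loss from waiting, then at least `η` is paid
immediately. -/
lemma value₂_le_of_lump (H : m.HasFastGrowthBound) {y η : ℝ} (hy : 0 ≤ y)
    (hE : m.premiumOperator y * (1 - m.c₂ / m.fastRate) +
      m.q * (m.value₂ y - m.value₂ (max (y - η) 0)) + m.lam * (m.slope * η) < 0) :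
    η ≤ y ∧ m.value₂ y ≤ m.slope * η + m.value₂ (y - η) := by
  have hf := m.fastRate_pos
  have hc₂ := m.c₂_pos
  have hlam := m.lam_pos
  have hk := m.slope_pos
  set E := m.premiumOperator y * (1 - m.c₂ / m.fastRate) +
      m.q * (m.value₂ y - m.value₂ (max (y - η) 0)) + m.lam * (m.slope * η)
  -- Slack for replacing Λ and the claim value near y by their values at y. It enters the derivative
  -- at h = 0 with weight c₂ + λ and uses up half of the negative quantity E.
  set s := -E / (2 * (m.c₂ + m.lam))
  have hs : 0 < s := div_pos (by linarith) (by linarith)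
  have hsE : (m.c₂ + m.lam) * s = -E / 2 := by
    simp only [s]
    field_simp
  set M := m.slope - m.premiumOperator y / m.fastRate + s
  have hM : m.slope ≤ M := by
    have := div_nonpos_of_nonpos_of_nonneg (H.premiumOperator_nonpos hy) hf.le
    simp only [M]
    linarith
  set W₀ := m.value₂ (max (y - η) 0)
  set I₁ := m.claimValue y + s
  set W₁ := m.value₂ (y + m.c₂)
  have hright : Filter.Tendsto (fun h : ℝ => y + m.c₂ * h) (nhdsWithin 0 (Set.Ioi 0)) (nhds y) := by
    have hc : Continuous fun h : ℝ => y + m.c₂ * h := by fun_prop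
    have := (hc.tendsto 0).mono_left (nhdsWithin_le_nhds (s := Set.Ioi 0))
    simpa using this
  have hpos : ∀ᶠ h : ℝ in nhdsWithin 0 (Set.Ioi 0), 0 < h := self_mem_nhdsWithin
  have ev1 : ∀ᶠ h : ℝ in nhdsWithin 0 (Set.Ioi 0), ∀ x ∈ Set.Icc y (y + m.c₂ * h),
      m.slope - m.premiumOperator x / m.fastRate ≤ M := by
    have hc : ContinuousWithinAt (fun x => m.slope - m.premiumOperator x / m.fastRate) (Set.Ici 0) y :=
      continuousWithinAt_const.sub ((continuousOn_premiumOperator y hy).div_const _)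
    have hev : ∀ᶠ x in nhdsWithin y (Set.Ici 0), m.slope - m.premiumOperator x / m.fastRate < M :=
      hc.eventually (gt_mem_nhds (by simp only [M]; linarith))
    obtain ⟨δ, hδ, hball⟩ := Metric.mem_nhdsWithin_iff.1 hev
    filter_upwards [hright.eventually (gt_mem_nhds (show y < y + δ by linarith))] with h hh x hx
    refine le_of_lt (hball ⟨?_, hy.trans hx.1⟩)
    rw [Metric.mem_ball, Real.dist_eq, abs_lt]
    constructor <;> linarith [hx.1, hx.2]
  have ev2 : ∀ᶠ h : ℝ in nhdsWithin 0 (Set.Ioi 0), m.claimValue (y + m.c₂ * h) < I₁ :=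
    (continuous_claimValue.continuousAt.tendsto.comp hright).eventually
      (gt_mem_nhds (by simp only [I₁]; linarith))
  have ev3 : ∀ᶠ h : ℝ in nhdsWithin 0 (Set.Ioi 0), h < 1 :=
    mem_nhdsWithin_of_mem_nhds (gt_mem_nhds zero_lt_one)
  -- An upper bound, uniform in ℓ ≤ η, for the short time bound minus W(y). It vanishes at h = 0
  -- with derivative E/2 < 0, so for small h dividends ℓ ≤ η are impossible for near-optimal
  -- strategies.
  set ψ : ℝ → ℝ := fun h => h ^ 2 + Real.exp (-m.lam * h) * (m.rate * h + m.value₂ y + M * m.c₂ * h -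
      (1 - Real.exp (-m.q * h)) * W₀) + (1 - Real.exp (-m.lam * h)) * (m.rate * h + m.slope * η + I₁) +
      (1 - Real.exp (-m.lam * h)) ^ 2 * (m.rate * h + m.slope * (y + m.c₂ * h) + W₁) - m.value₂ y
  have hψ0 : ψ 0 = 0 := by simp [ψ]
  have hψ' : HasDerivAt ψ (E / 2) 0 := by
    have hid := hasDerivAt_id (0 : ℝ)
    have hp := (hid.const_mul (-m.lam)).exp
    have hq := (hid.const_mul (-m.q)).exp
    have hr := hid.const_mul m.rate
    have h1 := hp.mul (((hr.add_const (m.value₂ y)).add (hid.const_mul (M * m.c₂))).sub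
      ((hq.const_sub 1).mul_const W₀))
    have h2 := (hp.const_sub 1).mul ((hr.add_const (m.slope * η)).add_const I₁)
    have h3 := ((hp.const_sub 1).pow 2).mul
      ((hr.add (((hid.const_mul m.c₂).const_add y).const_mul m.slope)).add_const W₁)
    have h4 := ((((hid.pow 2).add h1).add h2).add h3).sub_const (m.value₂ y)
    refine h4.congr_deriv ?_
    have hΛ := premiumOperator_eq (m := m) y
    have hrate := m.rate_add
    have hEe : E = m.premiumOperator y - m.premiumOperator y / m.fastRate * m.c₂ +
      m.q * (m.value₂ y - W₀) + m.lam * (m.slope * η) := by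
      simp only [E]
      ring
    have hMc : M * m.c₂ = m.slope * m.c₂ - m.premiumOperator y / m.fastRate * m.c₂ + s * m.c₂ := by
      simp only [M]
      ring
    simp [hMc, I₁]
    linarith
  have ev4 : ∀ᶠ h : ℝ in nhdsWithin 0 (Set.Ioi 0), ψ h < 0 := by
    have h1 := (hasDerivAt_iff_tendsto_slope.1 hψ').mono_left
      (nhdsWithin_mono 0 fun x (hx : (0 : ℝ) < x) => hx.ne')
    filter_upwards [h1.eventually (gt_mem_nhds (show E / 2 < 0 by linarith)), hpos] with h hs hh
    rw [slope_def_field, hψ0, sub_zero, sub_zero] at hs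
    exact neg_of_div_neg_left hs hh.le
  have hfacts : ∀ {h : ℝ}, 0 < h → 0 ≤ 1 - Real.exp (-m.lam * h) ∧ 0 ≤ 1 - Real.exp (-m.q * h) ∧
      0 ≤ m.c₂ * h := fun {h} hh => by
    refine ⟨?_, ?_, (mul_pos hc₂ hh).le⟩
    · rw [sub_nonneg, Real.exp_le_one_iff]
      have := mul_pos hlam hh
      linarith
    · rw [sub_nonneg, Real.exp_le_one_iff]
      have := mul_pos m.q_pos hh
      linarith
  have hlarge : ∀ᶠ h : ℝ in nhdsWithin 0 (Set.Ioi 0), ∃ ℓ, η < ℓ ∧ ℓ ≤ y + m.c₂ * h ∧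
      m.value₂ y ≤ h ^ 2 + m.shortBound y h ℓ := by
    filter_upwards [ev1, ev2, ev3, ev4, hpos] with h h1 h2 h3 h4 hh
    obtain ⟨ℓ, hℓ0, hℓv, hℓ⟩ := exists_value₂_le_shortBound (m := m) hy hh
    refine ⟨ℓ, not_le.1 fun hℓη => ?_, hℓv, hℓ⟩
    obtain ⟨hp, hq, hch⟩ := hfacts hh
    have hW₀ : W₀ ≤ m.value₂ (y + m.c₂ * h - ℓ) :=
      value₂_mono (max_le (by linarith) (by linarith))
    have hW₁ : m.value₂ (y + m.c₂ * h) ≤ W₁ := value₂_mono (by nlinarith)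
    -- If ℓ is less than the premiums, the level has risen and the growth bound controls the gain;
    -- otherwise the part of ℓ beyond the premiums is a lump sum from y. Either way M ≥ 1 + κ makes
    -- the gain at most M times the premiums.
    have hgrow : m.slope * ℓ + m.value₂ (y + m.c₂ * h - ℓ) ≤ m.value₂ y + M * m.c₂ * h := by
      rcases lt_or_ge ℓ (m.c₂ * h) with hlt | hge
      · have h5 := H.of_nonneg hy (b := y + m.c₂ * h - ℓ) (by linarith)
          fun z hz => h1 z ⟨hz.1, hz.2.trans (by linarith)⟩
        have h6 := mul_le_mul_of_nonneg_right hM hℓ0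
        linarith
      · have h5 := value₂_add_le (m := m) (y := y + m.c₂ * h - ℓ) (δ := ℓ - m.c₂ * h) (by linarith)
          (by linarith)
        have h6 := mul_le_mul_of_nonneg_right hM hch
        have e : y + m.c₂ * h - ℓ + (ℓ - m.c₂ * h) = y := by ring
        rw [e] at h5
        linarith
    have hA : Real.exp (-m.lam * h) * (m.rate * h + m.slope * ℓ +
        Real.exp (-m.q * h) * m.value₂ (y + m.c₂ * h - ℓ)) ≤ Real.exp (-m.lam * h) *
        (m.rate * h + m.value₂ y + M * m.c₂ * h - (1 - Real.exp (-m.q * h)) * W₀) := by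
      refine mul_le_mul_of_nonneg_left ?_ (Real.exp_nonneg _)
      have := mul_le_mul_of_nonneg_left hW₀ hq
      linarith
    have hB : (1 - Real.exp (-m.lam * h)) * (m.rate * h + m.slope * ℓ + m.claimValue (y + m.c₂ * h)) ≤
        (1 - Real.exp (-m.lam * h)) * (m.rate * h + m.slope * η + I₁) := by
      refine mul_le_mul_of_nonneg_left ?_ hp
      have := mul_le_mul_of_nonneg_left hℓη hk.le
      linarith
    have hC : (1 - Real.exp (-m.lam * h)) ^ 2 *
        (m.rate * h + m.slope * (y + m.c₂ * h) + m.value₂ (y + m.c₂ * h)) ≤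
        (1 - Real.exp (-m.lam * h)) ^ 2 * (m.rate * h + m.slope * (y + m.c₂ * h) + W₁) :=
      mul_le_mul_of_nonneg_left (by linarith) (sq_nonneg _)
    unfold shortBound at hℓ
    simp only [ψ] at h4
    linarith
  have hηy : η ≤ y := by
    refine ge_of_tendsto hright ?_
    filter_upwards [hlarge] with h ⟨ℓ, h1, h2, _⟩
    linarith
  refine ⟨hηy, ?_⟩
  have hrightI : Filter.Tendsto (fun h : ℝ => y + m.c₂ * h) (nhdsWithin 0 (Set.Ioi 0))
      (nhdsWithin y (Set.Ici 0)) := by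
    refine tendsto_nhdsWithin_iff.2 ⟨hright, ?_⟩
    filter_upwards [hpos] with h hh
    exact add_nonneg hy (mul_pos hc₂ hh).le
  have hrightη : Filter.Tendsto (fun h : ℝ => y + m.c₂ * h - η) (nhdsWithin 0 (Set.Ioi 0))
      (nhdsWithin (y - η) (Set.Ici 0)) := by
    refine tendsto_nhdsWithin_iff.2 ⟨hright.sub_const η, ?_⟩
    filter_upwards [hpos] with h hh
    have := mul_pos hc₂ hh
    exact Set.mem_Ici.2 (by linarith)
  have tW : Filter.Tendsto (fun h : ℝ => m.value₂ (y + m.c₂ * h)) (nhdsWithin 0 (Set.Ioi 0))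
      (nhds (m.value₂ y)) := (continuousOn_value₂ y hy).tendsto.comp hrightI
  have tWη : Filter.Tendsto (fun h : ℝ => m.value₂ (y + m.c₂ * h - η)) (nhdsWithin 0 (Set.Ioi 0))
      (nhds (m.value₂ (y - η))) :=
    (continuousOn_value₂ (y - η) (Set.mem_Ici.2 (by linarith))).tendsto.comp hrightη
  have tI : Filter.Tendsto (fun h : ℝ => m.claimValue (y + m.c₂ * h)) (nhdsWithin 0 (Set.Ioi 0))
      (nhds (m.claimValue y)) := continuous_claimValue.continuousAt.tendsto.comp hright
  have tid : Filter.Tendsto (fun h : ℝ => h) (nhdsWithin 0 (Set.Ioi 0)) (nhds 0) :=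
    Filter.tendsto_id.mono_left nhdsWithin_le_nhds
  have tp : Filter.Tendsto (fun h : ℝ => Real.exp (-m.lam * h)) (nhdsWithin 0 (Set.Ioi 0)) (nhds 1) := by
    have hc : Continuous fun h : ℝ => Real.exp (-m.lam * h) := by fun_prop
    have := (hc.tendsto 0).mono_left (nhdsWithin_le_nhds (s := Set.Ioi 0))
    simpa using this
  -- As h → 0, all terms except the immediate payment η and the value afterwards vanish.
  have tU := (((tid.pow 2).add (tp.mul (((tid.const_mul m.rate).add_const (m.slope * η)).add tWη))).add
    ((tp.const_sub 1).mul (((tid.const_mul m.rate).add (hright.const_mul m.slope)).add tI))).add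
    (((tp.const_sub 1).pow 2).mul (((tid.const_mul m.rate).add (hright.const_mul m.slope)).add tW))
  have hle := ge_of_tendsto tU (b := m.value₂ y) (by
    filter_upwards [hlarge, hpos] with h ⟨ℓ, h1, h2, h3⟩ hh
    obtain ⟨hp, hq, hch⟩ := hfacts hh
    have h4 := value₂_add_le (m := m) (y := y + m.c₂ * h - ℓ) (δ := ℓ - η) (by linarith) (by linarith)
    have e : y + m.c₂ * h - ℓ + (ℓ - η) = y + m.c₂ * h - η := by ring
    rw [e] at h4
    have h5 := mul_le_mul_of_nonneg_left h2 hk.le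
    have hA : Real.exp (-m.lam * h) * (m.rate * h + m.slope * ℓ +
        Real.exp (-m.q * h) * m.value₂ (y + m.c₂ * h - ℓ)) ≤ Real.exp (-m.lam * h) *
        (m.rate * h + m.slope * η + m.value₂ (y + m.c₂ * h - η)) := by
      refine mul_le_mul_of_nonneg_left ?_ (Real.exp_nonneg _)
      have := mul_nonneg hq (value₂_nonneg (m := m) (y + m.c₂ * h - ℓ))
      linarith
    have hB : (1 - Real.exp (-m.lam * h)) * (m.rate * h + m.slope * ℓ + m.claimValue (y + m.c₂ * h)) ≤
        (1 - Real.exp (-m.lam * h)) * (m.rate * h + m.slope * (y + m.c₂ * h) +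
          m.claimValue (y + m.c₂ * h)) :=
      mul_le_mul_of_nonneg_left (by linarith) hp
    unfold shortBound at h3
    linarith)
  simp at hle
  linarith

/-- Outside 𝓐 one has Λ < 0, and c₂ < f makes waiting strictly worse than paying a small lump sum.
Paying at once means that W is affine with slope 1 + κ, which is membership in 𝓑. -/
lemma setC_eq_empty (H : m.HasFastGrowthBound) (hc : m.c₂ < m.fastRate) : m.setC = ∅ := by
  refine Set.eq_empty_iff_forall_notMem.2 fun y hy => ?_
  obtain ⟨hy0, hyAB⟩ := hy
  have hy0 : 0 ≤ y := hy0
  have hΛ : m.premiumOperator y < 0 :=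
    lt_of_le_of_ne (H.premiumOperator_nonpos hy0) fun h => hyAB (Or.inl ⟨hy0, h⟩)
  have hfac : 0 < 1 - m.c₂ / m.fastRate := by
    rw [sub_pos, div_lt_one m.fastRate_pos]
    exact hc
  have hneg : m.premiumOperator y * (1 - m.c₂ / m.fastRate) < 0 := mul_neg_of_neg_of_pos hΛ hfac
  have tid : Filter.Tendsto (fun η : ℝ => η) (nhdsWithin 0 (Set.Ioi 0)) (nhds 0) :=
    Filter.tendsto_id.mono_left nhdsWithin_le_nhds
  have hpos : ∀ᶠ η : ℝ in nhdsWithin 0 (Set.Ioi 0), 0 < η := self_mem_nhdsWithin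
  -- At y = 0 a positive lump sum cannot be paid, so Λ(0) < 0 is contradictory.
  rcases hy0.eq_or_lt with rfl | hypos
  · have t1 := ((tid.const_mul m.slope).const_mul m.lam).const_add
      (m.premiumOperator 0 * (1 - m.c₂ / m.fastRate))
    have ev := t1.eventually (gt_mem_nhds (show _ < (0 : ℝ) by simpa using hneg))
    obtain ⟨η, hη, hη0⟩ := (ev.and hpos).exists
    have h1 := (H.value₂_le_of_lump le_rfl (by
      rw [max_eq_right (by linarith), sub_self, mul_zero, add_zero]
      exact hη)).1
    linarith
  -- The lump sum argument is applied at y + η/2, so that the interval on which W is affine is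
  -- centred at y and yields a two-sided derivative.
  · have tup : Filter.Tendsto (fun η : ℝ => y + η / 2) (nhdsWithin 0 (Set.Ioi 0)) (nhds y) := by
      simpa using (tid.div_const 2).const_add y
    have tdown : Filter.Tendsto (fun η : ℝ => max (y + η / 2 - η) 0) (nhdsWithin 0 (Set.Ioi 0))
        (nhds y) := by
      have := (tup.sub tid).max (tendsto_const_nhds (x := (0 : ℝ)))
      simpa [hy0] using this
    have cW := continuousAt_value₂ (m := m) hypos.ne'
    have cΛ : ContinuousAt m.premiumOperator y :=
      continuousOn_premiumOperator.continuousAt (Ici_mem_nhds hypos)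
    have t1 := (((cΛ.tendsto.comp tup).mul_const (1 - m.c₂ / m.fastRate)).add
      (((cW.tendsto.comp tup).sub (cW.tendsto.comp tdown)).const_mul m.q)).add
      ((tid.const_mul m.slope).const_mul m.lam)
    have ev := t1.eventually (gt_mem_nhds (show _ < (0 : ℝ) by simpa using hneg))
    have ev2 : ∀ᶠ η : ℝ in nhdsWithin 0 (Set.Ioi 0), η < y :=
      mem_nhdsWithin_of_mem_nhds (gt_mem_nhds hypos)
    obtain ⟨η, ⟨hη, hη0⟩, hηy⟩ := ((ev.and hpos).and ev2).exists
    obtain ⟨-, h2⟩ := H.value₂_le_of_lump (y := y + η / 2) (by linarith) hη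
    -- The growth over the whole interval is at most (1 + κ)η, and over each of the two pieces it is
    -- at least 1 + κ times the length, so equality holds throughout.
    have haff : ∀ x ∈ Set.Ioo (y - η / 2) (y + η / 2),
        m.value₂ x = m.value₂ (y - η / 2) + m.slope * (x - (y - η / 2)) := by
      intro x hx
      have h3 := value₂_add_le (m := m) (y := y - η / 2) (δ := x - (y - η / 2)) (by linarith)
        (by linarith [hx.1])
      have h4 := value₂_add_le (m := m) (y := x) (δ := y + η / 2 - x) (by linarith [hx.1])
        (by linarith [hx.2])
      rw [add_sub_cancel] at h3 h4
      have e : y + η / 2 - η = y - η / 2 := by ring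
      rw [e] at h2
      linarith
    refine hyAB (Or.inr ⟨hy0, ?_, hΛ⟩)
    have hd : HasDerivAt (fun x => m.value₂ (y - η / 2) + m.slope * (x - (y - η / 2))) m.slope y := by
      simpa using (((hasDerivAt_id y).sub_const (y - η / 2)).const_mul m.slope).const_add
        (m.value₂ (y - η / 2))
    refine (hd.congr_of_eventuallyEq ?_).hasDerivWithinAt
    filter_upwards [Ioo_mem_nhds (show y - η / 2 < y by linarith) (show y < y + η / 2 by linarith)] with x hx
    exact haff x hx

end HasFastGrowthBound

end TwoBranchModel

/-! ### Conclusion: both properties of Ṽ would imply the excluded growth bound -/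

theorem proposition4p10 {Ω : Type*} [MeasurableSpace Ω] (P : Measure Ω) [IsProbabilityMeasure P]
    (m : TwoBranchModel P) (hc : m.c₂ / m.c₁ < m.b₂ / m.b₁) (hC : m.halfLineC.Nonempty) :
    LocallyLipschitzOn TwoBranchModel.openQuadrant m.halfLineValue ∧
      (∃ x ∈ TwoBranchModel.openQuadrant, ¬ m.IsViscositySolutionAt m.halfLineValue x) ∧
      ∃ x ∈ TwoBranchModel.openQuadrant, m.halfLineValue x ≠ m.optimalValue x := by
  have hfast : m.c₂ < m.fastRate := by
    rw [div_lt_iff₀ m.c₁_pos] at hc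
    unfold TwoBranchModel.fastRate
    linarith
  have key : ¬ m.HasFastGrowthBound := fun H => by
    have := H.setC_eq_empty hfast
    simp [TwoBranchModel.halfLineC, this] at hC
  refine ⟨m.locallyLipschitzOn_halfLineValue, ?_, ?_⟩
  · by_contra! hcon
    exact key fun a b M ha hab hM =>
      TwoBranchModel.value₂_sub_le_of_supersolution (fun x hx => (hcon x hx).1) ha hab hM
  · by_contra! hcon
    exact key fun a b M ha hab hM => TwoBranchModel.value₂_sub_le_of_optimal hcon ha hab hM

end
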